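/- Fix the gate set consisting of the Hadamard gate, $T=\mathrm{diag}(1,e^{i\pi/4})$ and CNOT. Consider the following search problem. An input consists of - a number $n$ of qubits and a list of pairs $(\beta_k,U_k)$, $1\le k\le K$, with rational $\beta_k>0$ (in binary) and circuits $U_k$ on $n$ qubits, such that $A=\sum_k\beta_kU_k$ is a Hermitian $2^n\times 2^n$ matrix with spectral radius $\rho(A)\le 1$; - a classical program that, on input a row and a column index, computes the corresponding entry of $A$ exactly (as an element of $\mathbb{Q}(e^{i\pi/4})$), with a time bound given in unary; - circuits on $n$ qubits that prepare states $|b\rangle$, $|u_1\rangle$, $|u_2\rangle$ from $|0^n\rangle$; - in unary, a number $M$ such that $\sum_k\beta_k\le M$ and such that $L_R(\alpha_1|u_1\rangle+\alpha_2|u_2\rangle)$, where $L_R(x)=\|Ax-|b\rangle\|_2^2$, attains its minimum over $(\alpha_1,\alpha_2)\in\mathbb{C}^2$ at some point with $|\alpha_1|,|\alpha_2|\le M$; - a precision $\epsilon=1/E$, with the positive integer $E$ in unary. The task is to output $\hat\alpha_1,\hat\alpha_2\in\mathbb{Q}+i\mathbb{Q}$ such that $$L_R\Big(\sum_{i=1}^2\hat\alpha_i|u_i\rangle\Big)\le\min_{\alpha_1,\alpha_2\in\mathbb{C}}L_R\Big(\sum_{i=1}^2\alpha_i|u_i\rangle\Big)+\epsilon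 .$$ This problem is BQP-complete: a polynomial-time quantum algorithm solves it with probability at least $2/3$, and every promise problem in BQP reduces to it in classical polynomial time, by a map of instances and a map that reads off the answer from any solution. The same holds for the problem restricted to any one fixed precision $\epsilon=1/E$ with $E\ge 37$. Moreover, hardness holds through inputs in which $A$ is a CNOT. For a circuit $Q$ on $n\ge1$ qubits let $P_0$ and $P_1$ be the probabilities that measuring the first qubit of $Q|0^n\rangle$ yields $0$ and $1$. On $n+1$ qubits, one being added in front, let $A$ be the CNOT with control the second and target the first qubit, $|b\rangle=|u_1\rangle=|0\rangle\otimes Q|0^n\rangle$, $|u_2\rangle=|1\rangle\otimes Q|0^n\rangle$ and $M=1$. For suitable programs for the entries of $A$ this is an admissible input for every $E\ge1$, and for each fixed $E$ it is computable from $Q$ in polynomial time. Its unique optimal coefficients are $(\alpha_1,\alpha_2)=(P_0,P_1)$, and $(\hat\alpha_1,\hat\alpha_2)$ has loss within $\epsilon$ of the optimum if and only if $|\hat\alpha_1-P_0|^2+|\hat\alpha_2-P_1|^2\le\epsilon$. If a promise problem is decided, with error at most $1/3$, by circuits $Q_x$ that are computable from $x$ in polynomial time, then mapping $x$ to this input for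 $Q_x$ with any fixed $E\ge37$ is such a reduction. -/

import Mathlib

open scoped Matrix

namespace QLS

/-! ### Classical polynomial time

Programs over binary trees, with an explicit cost.  The cost of an evaluation bounds the size of
every value that is written during it, so cost and Turing-machine time are polynomially related. -/

/-- Binary trees, the data on which programs operate. -/
inductive Data where
  | leaf : Data
  | node : Data → Data → Data

/-- The number of vertices of a tree. -/
def Data.size : Data → ℕ
  | .leaf => 1
  | .node l r => l.size + r.size + 1

/-- Programs; each one computes a partial function from trees to trees. -/
inductive Code where
  /-- return the leaf -/
  | nil : Code
  /-- return the argument -/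
  | id : Code
  /-- left subtree (a leaf stays a leaf) -/
  | fst : Code
  /-- right subtree (a leaf stays a leaf) -/
  | snd : Code
  /-- `pair f g`: run `f` and `g` on the argument and join the two results -/
  | pair : Code → Code → Code
  /-- `comp f g`: run `g`, then `f` on its result -/
  | comp : Code → Code → Code
  /-- `cond c f g`: run `c`; if it returns a leaf run `f` on the argument, otherwise `g` -/
  | cond : Code → Code → Code → Code
  /-- `loop c f`: as long as `c` returns a node on the current value, replace that value by the
  result of `f` on it -/
  | loop : Code → Code → Code

/-- `Eval c x y t`: the program `c` halts on `x` with result `y` and cost `t`. -/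
inductive Eval : Code → Data → Data → ℕ → Prop where
  | nil (x : Data) : Eval .nil x .leaf 1
  | id (x : Data) : Eval .id x x x.size
  | fst_leaf : Eval .fst .leaf .leaf 1
  | fst_node (a b : Data) : Eval .fst (.node a b) a (Data.node a b).size
  | snd_leaf : Eval .snd .leaf .leaf 1
  | snd_node (a b : Data) : Eval .snd (.node a b) b (Data.node a b).size
  | pair {f g : Code} {x a b : Data} {s t : ℕ} :
      Eval f x a s → Eval g x b t → Eval (.pair f g) x (.node a b) (s + t + 1)
  | comp {f g : Code} {x y z : Data} {s t : ℕ} :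
      Eval g x y s → Eval f y z t → Eval (.comp f g) x z (s + t + 1)
  | cond_leaf {c f g : Code} {x y : Data} {s t : ℕ} :
      Eval c x .leaf s → Eval f x y t → Eval (.cond c f g) x y (s + t + 1)
  | cond_node {c f g : Code} {x y a b : Data} {s t : ℕ} :
      Eval c x (.node a b) s → Eval g x y t → Eval (.cond c f g) x y (s + t + 1)
  | loop_done {c f : Code} {x : Data} {s : ℕ} :
      Eval c x .leaf s → Eval (.loop c f) x x (s + x.size + 1)
  | loop_step {c f : Code} {x y z a b : Data} {s t r : ℕ} :
      Eval c x (.node a b) s → Eval f x y t → Eval (.loop c f) y z r →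
      Eval (.loop c f) x z (s + t + r + 1)

/-- The result of an evaluation is not larger than its cost. -/
theorem Eval.size_le {c : Code} {x y : Data} {t : ℕ} (h : Eval c x y t) : y.size ≤ t := by
  induction h with
  | nil | fst_leaf | snd_leaf => exact le_rfl
  | id => exact le_rfl
  | fst_node a b | snd_node a b => simp only [Data.size]; omega
  | pair _ _ ih1 ih2 => simp only [Data.size]; omega
  | comp _ _ ih1 ih2 => omega
  | cond_leaf _ _ ih1 ih2 | cond_node _ _ ih1 ih2 => omega
  | loop_done => omega
  | loop_step => omega

/-- Result and cost of an evaluation are unique. -/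
theorem Eval.unique {c : Code} {x y : Data} {t : ℕ} (h : Eval c x y t) :
    ∀ {y' : Data} {t' : ℕ}, Eval c x y' t' → y = y' ∧ t = t' := by
  induction h with
  | nil | fst_leaf | snd_leaf | id | fst_node | snd_node =>
    intro y' t' h'
    cases h'
    exact ⟨rfl, rfl⟩
  | pair _ _ ih1 ih2 =>
    intro y' t' h'
    cases h' with
    | pair h1 h2 =>
      obtain ⟨rfl, rfl⟩ := ih1 h1
      obtain ⟨rfl, rfl⟩ := ih2 h2
      exact ⟨rfl, rfl⟩
  | comp _ _ ih1 ih2 =>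
    intro y' t' h'
    cases h' with
    | comp h1 h2 =>
      obtain ⟨rfl, rfl⟩ := ih1 h1
      obtain ⟨rfl, rfl⟩ := ih2 h2
      exact ⟨rfl, rfl⟩
  | cond_leaf _ _ ih1 ih2 =>
    intro y' t' h'
    cases h' with
    | cond_leaf h1 h2 => exact ⟨(ih2 h2).1, by rw [(ih1 h1).2, (ih2 h2).2]⟩
    | cond_node h1 h2 => exact absurd (ih1 h1).1 (by simp)
  | cond_node _ _ ih1 ih2 =>
    intro y' t' h'
    cases h' with
    | cond_leaf h1 h2 => exact absurd (ih1 h1).1 (by simp)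
    | cond_node h1 h2 => exact ⟨(ih2 h2).1, by rw [(ih1 h1).2, (ih2 h2).2]⟩
  | loop_done _ ih1 =>
    intro y' t' h'
    cases h' with
    | loop_done h1 => exact ⟨rfl, by rw [(ih1 h1).2]⟩
    | loop_step h1 _ _ => exact absurd (ih1 h1).1 (by simp)
  | loop_step _ _ _ ih1 ih2 ih3 =>
    intro y' t' h'
    cases h' with
    | loop_done h1 => exact absurd (ih1 h1).1 (by simp)
    | loop_step h1 h2 h3 =>
      obtain ⟨_, rfl⟩ := ih1 h1
      obtain ⟨rfl, rfl⟩ := ih2 h2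
      obtain ⟨rfl, rfl⟩ := ih3 h3
      exact ⟨rfl, rfl⟩

/-- The fixed representation of the elements of a type as trees. -/
class Enc (α : Type) where
  enc : α → Data

/-- Unary representation of a natural number. -/
def unary : ℕ → Data
  | 0 => .leaf
  | k + 1 => .node .leaf (unary k)

instance : Enc Bool where
  enc b := if b then .node .leaf .leaf else .leaf

/-- Lists as right-nested trees. -/
def encList {α : Type} (e : α → Data) : List α → Data
  | [] => .leaf
  | a :: l => .node (e a) (encList e l)

instance {α : Type} [Enc α] : Enc (List α) where
  enc := encList Enc.enc

instance {α β : Type} [Enc α] [Enc β] : Enc (α × β) where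
  enc p := .node (Enc.enc p.1) (Enc.enc p.2)

/-- Binary representation of a natural number, least significant bit first. -/
def binary (k : ℕ) : Data := Enc.enc k.bits

/-- Integers as a sign bit and an absolute value in binary. -/
instance : Enc ℤ where
  enc z := .node (Enc.enc (decide (z < 0))) (binary z.natAbs)

/-- Programs as data. -/
def encCode : Code → Data
  | .nil => .node (unary 0) .leaf
  | .id => .node (unary 1) .leaf
  | .fst => .node (unary 2) .leaf
  | .snd => .node (unary 3) .leaf
  | .pair f g => .node (unary 4) (.node (encCode f) (encCode g))
  | .comp f g => .node (unary 5) (.node (encCode f) (encCode g))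
  | .cond c f g => .node (unary 6) (.node (encCode c) (.node (encCode f) (encCode g)))
  | .loop c f => .node (unary 7) (.node (encCode c) (encCode f))

instance : Enc Code where
  enc := encCode

/-- `f` is computable in time polynomial in the size of its argument. -/
def PolyTime {α β : Type} [Enc α] [Enc β] (f : α → β) : Prop :=
  ∃ (c : Code) (p : Polynomial ℕ), ∀ a : α,
    ∃ t : ℕ, t ≤ p.eval (Enc.enc a).size ∧ Eval c (Enc.enc a) (Enc.enc (f a)) t

/-! ### Finite descriptions of numbers -/

/-- A rational number as a fraction (not necessarily reduced), in binary. -/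
structure Frac where
  num : ℤ
  den : ℕ+

/-- The value of a fraction. -/
noncomputable def Frac.val (q : Frac) : ℝ := (q.num : ℝ) / ((q.den : ℕ) : ℝ)

instance : Enc Frac where
  enc q := .node (Enc.enc q.num) (binary q.den)

/-- A complex number with rational real and imaginary part. -/
structure CFrac where
  re : Frac
  im : Frac

/-- The value of a complex fraction. -/
noncomputable def CFrac.val (z : CFrac) : ℂ := ⟨z.re.val, z.im.val⟩

instance : Enc CFrac where
  enc z := .node (Enc.enc z.re) (Enc.enc z.im)

/-- The primitive eighth root of unity `exp (i π / 4)`. -/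
noncomputable def zeta : ℂ := Complex.exp (Complex.I * (Real.pi / 4))

/-- An element `(a + b ζ + c ζ² + d ζ³) / den` of the field `ℚ(ζ)`, `ζ = exp (i π / 4)`.  All
entries of a rational combination of circuits over Hadamard, `T` and CNOT gates lie in it. -/
structure Cyc where
  a : ℤ
  b : ℤ
  c : ℤ
  d : ℤ
  den : ℕ+

/-- The value of an element of `ℚ(ζ)`. -/
noncomputable def Cyc.val (z : Cyc) : ℂ :=
  ((z.a : ℂ) + (z.b : ℂ) * zeta + (z.c : ℂ) * zeta ^ 2 + (z.d : ℂ) * zeta ^ 3) / ((z.den : ℕ) : ℂ)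

instance : Enc Cyc where
  enc z := .node (.node (Enc.enc z.a) (Enc.enc z.b))
    (.node (.node (Enc.enc z.c) (Enc.enc z.d)) (binary z.den))

/-! ### Quantum circuits -/

/-- Computational basis states of `n` qubits; operators on `n` qubits are matrices over them. -/
abbrev Basis (n : ℕ) : Type := Fin n → Bool

/-- The gates of the universal set Hadamard, `T = diag(1, exp (i π / 4))`, controlled-NOT. -/
inductive Gate (n : ℕ) where
  | had (q : Fin n) : Gate n
  | tee (q : Fin n) : Gate n
  | cnot (control target : Fin n) (h : control ≠ target) : Gate n

/-- The unitary matrix of a gate. -/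
noncomputable def Gate.mat {n : ℕ} : Gate n → Matrix (Basis n) (Basis n) ℂ
  | .had q => Matrix.of fun x y =>
      if ∀ j, j ≠ q → x j = y j then
        (if x q && y q then -1 else 1) * ((Real.sqrt 2 : ℝ) : ℂ)⁻¹
      else 0
  | .tee q => Matrix.diagonal fun x => if x q then zeta else 1
  | .cnot c t _ => Matrix.of fun x y =>
      if x = Function.update y t (xor (y t) (y c)) then 1 else 0

/-- A circuit is the list of its gates in the order in which they are applied. -/
abbrev Circuit (n : ℕ) : Type := List (Gate n)

/-- The unitary `U_T ⋯ U_1` of the circuit `[U_1, …, U_T]`. -/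
noncomputable def Circuit.mat {n : ℕ} : Circuit n → Matrix (Basis n) (Basis n) ℂ
  | [] => 1
  | g :: c => Circuit.mat c * g.mat

/-- The basis state `|0…0⟩`. -/
def zeroBasis (n : ℕ) : Basis n := fun _ => false

/-- The state that the circuit prepares from `|0…0⟩`. -/
noncomputable def Circuit.state {n : ℕ} (c : Circuit n) : Basis n → ℂ :=
  Circuit.mat c *ᵥ Pi.single (zeroBasis n) 1

/-- The probability that measuring the first qubit of the prepared state yields `v`. -/
noncomputable def Circuit.prob {n : ℕ} (c : Circuit (n + 1)) (v : Bool) : ℝ :=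
  ∑ z : Basis (n + 1), if z 0 = v then ‖Circuit.state c z‖ ^ 2 else 0

instance {n : ℕ} : Enc (Gate n) where
  enc
    | .had q => .node (unary 0) (unary q)
    | .tee q => .node (unary 1) (unary q)
    | .cnot c t _ => .node (unary 2) (.node (unary c) (unary t))

/-- A circuit on any number of qubits. -/
structure AnyCircuit where
  n : ℕ
  circ : Circuit n

instance : Enc AnyCircuit where
  enc C := .node (unary C.n) (Enc.enc C.circ)

/-- A circuit on at least one qubit; the first qubit is the output qubit. -/
structure OutCircuit where
  n : ℕ
  circ : Circuit (n + 1)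

instance : Enc OutCircuit where
  enc C := .node (unary (C.n + 1)) (Enc.enc C.circ)

/-! ### BQP and BQP-completeness -/

/-- A promise problem on bit strings. -/
structure PromiseProblem where
  yes : Set (List Bool)
  no : Set (List Bool)
  disj : Disjoint yes no

/-- The circuits `Q x` decide `L` with error at most `1/3`: the output qubit is `1` with
probability at least `2/3` on yes-instances and at most `1/3` on no-instances. -/
def Decides (Q : List Bool → OutCircuit) (L : PromiseProblem) : Prop :=
  (∀ x ∈ L.yes, 2 / 3 ≤ Circuit.prob (Q x).circ true) ∧
  (∀ x ∈ L.no, Circuit.prob (Q x).circ true ≤ 1 / 3)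

/-- The promise problems decided by polynomial-time generated quantum circuits (the input is
hard-wired into the circuit). -/
def BQP : Set PromiseProblem :=
  {L | ∃ Q : List Bool → OutCircuit, PolyTime Q ∧ Decides Q L}

/-- A search problem: on an input `a` that fulfils the promise, output some `y` with `sol a y`. -/
structure SearchProblem (α β : Type) where
  promise : α → Prop
  sol : α → β → Prop

open Classical in
/-- The probability that the event `S` holds for the outcomes, when each circuit of the list is run
once on `|0…0⟩`, independently, and all of its qubits are measured in the computational basis. -/
noncomputable def runProb : List AnyCircuit → (List (List Bool) → Prop) → ℝ
  | [], S => if S [] then 1 else 0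
  | C :: Cs, S => ∑ z : Basis C.n,
      ‖Circuit.state C.circ z‖ ^ 2 * runProb Cs fun zs => S (List.ofFn z :: zs)

/-- The search problem is solved by a polynomial-time quantum algorithm with success probability
at least `2/3`: polynomial-time classical preprocessing writes down circuits, these are run and
measured, and polynomial-time classical postprocessing computes the output. -/
def SolvableInBQP {α β : Type} [Enc α] [Enc β] (P : SearchProblem α β) : Prop :=
  ∃ (gen : α → List AnyCircuit) (post : α × List (List Bool) → β),
    PolyTime gen ∧ PolyTime post ∧
    ∀ a, P.promise a → 2 / 3 ≤ runProb (gen a) fun zs => P.sol a (post (a, zs))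

/-- `f`, `g` reduce the promise problem `L` to the search problem `P` in polynomial time: `f` maps
instances to instances, and `g` reads off the answer from any solution. -/
def Reduction {α β : Type} [Enc α] [Enc β] (L : PromiseProblem) (P : SearchProblem α β)
    (f : List Bool → α) (g : List Bool × β → Bool) : Prop :=
  PolyTime f ∧ PolyTime g ∧
  (∀ x ∈ L.yes, P.promise (f x) ∧ ∀ y, P.sol (f x) y → g (x, y) = true) ∧
  (∀ x ∈ L.no, P.promise (f x) ∧ ∀ y, P.sol (f x) y → g (x, y) = false)

/-- Every problem in BQP reduces to `P` in classical polynomial time. -/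
def BQPHard {α β : Type} [Enc α] [Enc β] (P : SearchProblem α β) : Prop :=
  ∀ L ∈ BQP, ∃ (f : List Bool → α) (g : List Bool × β → Bool), Reduction L P f g

/-- `P` is solvable in quantum polynomial time and hard for BQP. -/
def BQPComplete {α β : Type} [Enc α] [Enc β] (P : SearchProblem α β) : Prop :=
  SolvableInBQP P ∧ BQPHard P

/-! ### Optimizing the combination coefficients -/

/-- The regression loss `‖A x - b‖₂²`. -/
noncomputable def regLoss {ι : Type} [Fintype ι] (A : Matrix ι ι ℂ) (b x : ι → ℂ) : ℝ :=
  ‖WithLp.toLp 2 (A *ᵥ x - b)‖ ^ 2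

/-- The input of the coefficient optimization problem. -/
structure Inst where
  /-- number of qubits -/
  n : ℕ
  /-- the unitary decomposition: the pairs `(β_k, U_k)` -/
  terms : List (Frac × Circuit n)
  /-- a classical program for the entries of the matrix -/
  entryCode : Code
  /-- a bound on the cost of one run of that program -/
  entryTime : ℕ
  /-- circuit for `|b⟩` -/
  b : Circuit n
  /-- circuit for `|u₁⟩` -/
  u₁ : Circuit n
  /-- circuit for `|u₂⟩` -/
  u₂ : Circuit n
  /-- bound on `∑ β_k` and on the magnitude of some optimal coefficients -/
  bound : ℕ
  /-- inverse precision, `ε = 1 / invEps` -/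
  invEps : ℕ

/-- Qubit number, time bound, magnitude bound and inverse precision are given in unary, so that
polynomial time means polynomial in these quantities; the `β_k` are given in binary. -/
instance : Enc Inst where
  enc I := .node (.node (unary I.n) (.node (Enc.enc I.terms)
      (.node (Enc.enc I.entryCode) (unary I.entryTime))))
    (.node (.node (Enc.enc I.b) (.node (Enc.enc I.u₁) (Enc.enc I.u₂)))
      (.node (unary I.bound) (unary I.invEps)))

/-- The matrix `A = ∑ β_k U_k`. -/
noncomputable def Inst.A (I : Inst) : Matrix (Basis I.n) (Basis I.n) ℂ :=
  (I.terms.map fun t => (t.1.val : ℂ) • Circuit.mat t.2).sum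

/-- The regression loss of `α₁ |u₁⟩ + α₂ |u₂⟩`. -/
noncomputable def Inst.loss (I : Inst) (α₁ α₂ : ℂ) : ℝ :=
  regLoss I.A (Circuit.state I.b) (α₁ • Circuit.state I.u₁ + α₂ • Circuit.state I.u₂)

/-- The loss of `(α₁, α₂)` exceeds the minimum over all coefficients by at most `ε`. -/
def Inst.NearOptimal (I : Inst) (ε : ℝ) (α₁ α₂ : ℂ) : Prop :=
  ∀ γ₁ γ₂ : ℂ, I.loss α₁ α₂ ≤ I.loss γ₁ γ₂ + ε

/-- Admissible inputs. -/
structure Inst.Valid (I : Inst) : Prop where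
  hermitian : I.A.IsHermitian
  spectral : spectralRadius ℂ I.A ≤ 1
  beta_pos : ∀ t ∈ I.terms, 0 < t.1.val
  /-- every entry of `A` is computed exactly by the given program within the given time -/
  entries : ∀ x y : Basis I.n, ∃ (v : Cyc) (t : ℕ), t ≤ I.entryTime ∧
    Eval I.entryCode (Enc.enc (List.ofFn x, List.ofFn y)) (Enc.enc v) t ∧ v.val = I.A x y
  beta_sum : (I.terms.map fun t => t.1.val).sum ≤ I.bound
  coeff_bound : ∃ α₁ α₂ : ℂ, ‖α₁‖ ≤ I.bound ∧ ‖α₂‖ ≤ I.bound ∧ I.NearOptimal 0 α₁ α₂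
  invEps_pos : 0 < I.invEps

/-- Output `α̂₁, α̂₂` whose loss is `ε`-close to the optimum over the span of `u₁`, `u₂`; here `ε` is
part of the input. -/
noncomputable def combProblem : SearchProblem Inst (CFrac × CFrac) where
  promise I := I.Valid
  sol I y := I.NearOptimal (1 / (I.invEps : ℝ)) y.1.val y.2.val

/-- The same problem for one fixed precision `ε = 1 / E`. -/
noncomputable def combProblemAt (E : ℕ) : SearchProblem Inst (CFrac × CFrac) where
  promise I := I.Valid ∧ I.invEps = E
  sol I y := I.NearOptimal (1 / (E : ℝ)) y.1.val y.2.val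

/-! ### The instances with a controlled-NOT matrix -/

/-- A gate acting on the last `n` of `n + 1` qubits. -/
def Gate.shift {n : ℕ} : Gate n → Gate (n + 1)
  | .had q => .had q.succ
  | .tee q => .tee q.succ
  | .cnot c t h => .cnot c.succ t.succ fun e => h (Fin.succ_injective n e)

/-- The circuit on the last `n` of `n + 1` qubits. -/
def Circuit.shift {n : ℕ} (c : Circuit n) : Circuit (n + 1) := c.map Gate.shift

/-- The gate `X = H Z H` with `Z = T⁴`, on the first qubit. -/
def flipFirst (n : ℕ) : Circuit (n + 1) := [.had 0, .tee 0, .tee 0, .tee 0, .tee 0, .had 0]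

/-- For a circuit `Q` with one qubit added in front: `A` is the controlled-NOT with the second
qubit as control and the first (added) qubit as target, `|b⟩ = |u₁⟩ = |0⟩ ⊗ Q|0…0⟩` and
`|u₂⟩ = |1⟩ ⊗ Q|0…0⟩`. -/
def cnotInst (Q : OutCircuit) (E : ℕ) (entryCode : Code) (entryTime : ℕ) : Inst where
  n := Q.n + 2
  terms := [(⟨1, 1⟩, [.cnot 1 0 (by simp)])]
  entryCode := entryCode
  entryTime := entryTime
  b := Circuit.shift Q.circ
  u₁ := Circuit.shift Q.circ
  u₂ := flipFirst (Q.n + 1) ++ Circuit.shift Q.circ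
  bound := 1
  invEps := E

end QLS

/-!
The loss `‖A (α₁ u₁ + α₂ u₂) - b‖²` is a quadratic function of the coefficients, determined by the
inner products of the vectors `A u₁`, `A u₂` and `b`.

*Algorithm.*  Rounding the coefficients `β_k` to multiples of `1 / D` makes `A u` approximately a
uniform sum of states that circuits prepare, divided by `D` (`norm_mulVec_sum_sub_le`), so each inner
product is approximately `1 / D²` times a sum of inner products of circuit states.  A Hadamard test
is run once for every pair of circuits (`hadamardTest_mean`); its controlled circuits are written
with the given gates.  By Chebyshev's inequality (`one_sub_le_runProb`) all sums of outcomes are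
close to their expected values with probability at least `2 / 3`, and then the Gram matrix and the
right-hand side of the normal equations are known up to `δ`.  The Gram matrix may be singular or
badly conditioned.  Therefore `3δ` is added to its diagonal: this makes it definite, and it changes
the loss by `O(M² δ)` at coefficients of size at most `M`, of which some are optimal.  So the solution
of the modified equations by Cramer's rule has nearly optimal loss (`regularized_least_squares`).
All numbers in this computation have polynomially bounded absolute value, because `M`, `1 / ε` and
the number of terms count as unary; only the `β_k` are binary, and they are merely compared with
small fractions (`PTime.mul_binary_le`).

*Polynomial time.*  `PTime e f` says that `f` is computed from `e` in polynomial time, where both are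
families of trees over a common index type.  Working with families makes it possible to treat
variables of dependent types, such as a circuit on a variable number of qubits, without an encoding
of the sigma type.  The classical parts are composed from closure properties of this relation, of
which the fundamental one is folding over a list with states of bounded size
(`PTime.foldl_of_size_le`).

*Hardness.*  For the controlled-NOT instance, `A` swaps `|0⟩ψ` and `|1⟩ψ` on the part of `Q|0…0⟩`
whose first qubit is `1`, and fixes them on the rest.  Since both parts are orthogonal, the loss is
`P₀ (|α₁ - 1|² + |α₂|²) + P₁ (|α₂ - 1|² + |α₁|²)`, which is `|α₁ - P₀|² + |α₂ - P₁|²` plus a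
constant (`cnotInst_loss`).  Thus a solution determines `P₁` up to `√ε < 1 / 6`, which decides
whether it is at least `2 / 3` or at most `1 / 3` (`reduction_cnotInst`).
-/

namespace QLS

/-! ### Closure properties of polynomial time -/

/-- The tree `f a` is computed from the tree `e a` by one program, in time polynomial in the size
of `e a`, for all `a`.  The index type serves as a context: `e a` holds the encodings of all
variables in scope, whose types may depend on each other.  By definition `PolyTime f` is
`PTime Enc.enc fun a => Enc.enc (f a)`. -/
def PTime {α : Type} (e f : α → Data) : Prop :=
  ∃ (c : Code) (p : Polynomial ℕ), ∀ a : α, ∃ t : ℕ, t ≤ p.eval (e a).size ∧ Eval c (e a) (f a) t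

theorem eval_mono_nat (p : Polynomial ℕ) {x y : ℕ} (h : x ≤ y) : p.eval x ≤ p.eval y := by
  induction p using Polynomial.induction_on' with
  | add p q hp hq => simpa using add_le_add hp hq
  | monomial n a => simpa using Nat.mul_le_mul_left a (Nat.pow_le_pow_left h n)

theorem Data.size_pos (d : Data) : 0 < d.size := by
  cases d <;> simp [Data.size]

/-- The size of `f a` is polynomially bounded in the size of `e a`. -/
def PBound {α : Type} (e f : α → Data) : Prop :=
  ∃ q : Polynomial ℕ, ∀ a : α, (f a).size ≤ q.eval (e a).size

namespace PTime

variable {α α' : Type} {e f g h : α → Data}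

theorem bound (hf : PTime e f) : PBound e f := by
  obtain ⟨c, p, hc⟩ := hf
  refine ⟨p, fun a => ?_⟩
  obtain ⟨t, ht, hE⟩ := hc a
  exact hE.size_le.trans ht

theorem refl (e : α → Data) : PTime e e :=
  ⟨.id, Polynomial.X, fun a => ⟨_, by simp, Eval.id _⟩⟩

theorem leaf : PTime e fun _ => Data.leaf :=
  ⟨.nil, 1, fun a => ⟨1, by simp, Eval.nil _⟩⟩

theorem trans (hf : PTime e f) (hg : PTime f g) : PTime e g := by
  obtain ⟨cf, p, hf⟩ := hf
  obtain ⟨cg, q, hg⟩ := hg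
  refine ⟨.comp cg cf, p + q.comp p + 1, fun a => ?_⟩
  obtain ⟨s, hs, hEs⟩ := hf a
  obtain ⟨t, ht, hEt⟩ := hg a
  refine ⟨_, ?_, Eval.comp hEs hEt⟩
  have := eval_mono_nat q (hEs.size_le.trans hs)
  simp only [Polynomial.eval_add, Polynomial.eval_comp, Polynomial.eval_one]
  omega

theorem node (hf : PTime e f) (hg : PTime e g) : PTime e fun a => Data.node (f a) (g a) := by
  obtain ⟨cf, p, hf⟩ := hf
  obtain ⟨cg, q, hg⟩ := hg
  refine ⟨.pair cf cg, p + q + 1, fun a => ?_⟩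
  obtain ⟨s, hs, hEs⟩ := hf a
  obtain ⟨t, ht, hEt⟩ := hg a
  refine ⟨_, ?_, Eval.pair hEs hEt⟩
  simp only [Polynomial.eval_add, Polynomial.eval_one]
  omega

theorem const (d : Data) : PTime e fun _ => d := by
  induction d with
  | leaf => exact leaf
  | node l r hl hr => exact hl.node hr

theorem fst (hf : PTime e fun a => Data.node (f a) (g a)) : PTime e f :=
  hf.trans ⟨.fst, Polynomial.X, fun a => ⟨_, by simp, Eval.fst_node _ _⟩⟩

theorem snd (hf : PTime e fun a => Data.node (f a) (g a)) : PTime e g :=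
  hf.trans ⟨.snd, Polynomial.X, fun a => ⟨_, by simp, Eval.snd_node _ _⟩⟩

theorem reindex (hf : PTime e f) (φ : α' → α) : PTime (fun a => e (φ a)) fun a => f (φ a) := by
  obtain ⟨c, p, hc⟩ := hf
  exact ⟨c, p, fun a => hc (φ a)⟩

theorem congr (hf : PTime e f) (hfg : ∀ a, f a = g a) : PTime e g := by
  rwa [← funext hfg]

/-- A case distinction; each branch needs to work only where it is taken. -/
theorem cond (hc : PTime e f)
    (h1 : PTime (fun a : {a // f a = Data.leaf} => e a) fun a => h a)
    (h2 : PTime (fun a : {a // f a ≠ Data.leaf} => e a) fun a => h a) : PTime e h := by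
  obtain ⟨c, p, hc⟩ := hc
  obtain ⟨c1, p1, h1⟩ := h1
  obtain ⟨c2, p2, h2⟩ := h2
  refine ⟨.cond c c1 c2, p + p1 + p2 + 1, fun a => ?_⟩
  obtain ⟨s, hs, hEs⟩ := hc a
  simp only [Polynomial.eval_add, Polynomial.eval_one]
  by_cases hl : f a = Data.leaf
  · obtain ⟨t, ht, hEt⟩ := h1 ⟨a, hl⟩
    rw [hl] at hEs
    exact ⟨_, by dsimp only at ht; omega, Eval.cond_leaf hEs hEt⟩
  · obtain ⟨t, ht, hEt⟩ := h2 ⟨a, hl⟩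
    obtain ⟨l, r, hlr⟩ : ∃ l r, f a = Data.node l r := by
      cases hd : f a with
      | leaf => exact absurd hd hl
      | node l r => exact ⟨l, r, rfl⟩
    rw [hlr] at hEs
    exact ⟨_, by dsimp only at ht; omega, Eval.cond_node hEs hEt⟩

theorem ite {b : α → Bool} (hb : PTime e fun a => Enc.enc (b a)) (hf : PTime e f)
    (hg : PTime e g) : PTime e fun a => if b a then f a else g a := by
  refine hb.cond ((hg.reindex Subtype.val).congr ?_) ((hf.reindex Subtype.val).congr ?_)
  · rintro ⟨a, ha⟩
    cases hba : b a
    · simp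
    · rw [hba] at ha
      exact absurd ha (by simp [Enc.enc])
  · rintro ⟨a, ha⟩
    cases hba : b a
    · rw [hba] at ha
      exact absurd rfl ha
    · simp

theorem bool_false : PTime e fun _ => Enc.enc false := const _

theorem bool_true : PTime e fun _ => Enc.enc true := const _

theorem bool_not {b : α → Bool} (hb : PTime e fun a => Enc.enc (b a)) :
    PTime e fun a => Enc.enc (!b a) :=
  (hb.ite bool_false bool_true).congr fun a => by cases b a <;> rfl

theorem bool_and {b c : α → Bool} (hb : PTime e fun a => Enc.enc (b a))
    (hc : PTime e fun a => Enc.enc (c a)) : PTime e fun a => Enc.enc (b a && c a) :=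
  (hb.ite hc bool_false).congr fun a => by cases b a <;> rfl

theorem bool_xor {b c : α → Bool} (hb : PTime e fun a => Enc.enc (b a))
    (hc : PTime e fun a => Enc.enc (c a)) : PTime e fun a => Enc.enc (xor (b a) (c a)) :=
  (hb.ite hc.bool_not hc).congr fun a => by cases b a <;> simp

end PTime

/-! ### Folding over lists -/

theorem encList_append_size {β : Type} (eb : β → Data) (l₁ l₂ : List β) :
    (encList eb (l₁ ++ l₂)).size + 1 = (encList eb l₁).size + (encList eb l₂).size := by
  induction l₁ with
  | nil => simp [encList, Data.size]; omega
  | cons b l ih => simp only [List.cons_append, encList, Data.size]; omega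

theorem length_le_size_encList {β : Type} (eb : β → Data) (l : List β) :
    l.length ≤ (encList eb l).size := by
  induction l with
  | nil => simp
  | cons b l ih => simp only [List.length_cons, encList, Data.size]; omega

theorem size_le_size_encList {β : Type} (eb : β → Data) {l : List β} {b : β} (hb : b ∈ l) :
    (eb b).size ≤ (encList eb l).size := by
  induction l with
  | nil => simp at hb
  | cons c l ih =>
    simp only [encList, Data.size]
    rcases List.mem_cons.1 hb with rfl | hb
    · omega
    · have := ih hb; omega

namespace PTime

variable {α : Type} {e : α → Data} {σ β γ : α → Type}

/-- Folding over a list, if all intermediate states have polynomial size. -/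
theorem foldl_of_size_le (es : ∀ a, σ a → Data) (eb : ∀ a, β a → Data)
    {l : ∀ a, List (β a)} {s₀ : ∀ a, σ a} {step : ∀ a, σ a → β a → σ a}
    (hl : PTime e fun a => encList (eb a) (l a)) (h₀ : PTime e fun a => es a (s₀ a))
    (hstep : PTime
      (fun x : Σ a, σ a × β a => Data.node (e x.1) (.node (es x.1 x.2.1) (eb x.1 x.2.2)))
      fun x => es x.1 (step x.1 x.2.1 x.2.2))
    (hq : ∃ q : Polynomial ℕ, ∀ a, ∀ l', l' <+: l a →
      (es a (l'.foldl (step a) (s₀ a))).size ≤ q.eval (e a).size) :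
    PTime e fun a => es a ((l a).foldl (step a) (s₀ a)) := by
  obtain ⟨q, hq⟩ := hq
  obtain ⟨ql, hql⟩ := hl.bound
  -- the body of the loop, on states that consist of the rest of the list, `e a`, and the
  -- intermediate result
  have hbody : PTime
      (fun x : Σ a, σ a × β a × List (β a) => Data.node
        (.node (eb x.1 x.2.2.1) (encList (eb x.1) x.2.2.2)) (.node (e x.1) (es x.1 x.2.1)))
      (fun x => Data.node (encList (eb x.1) x.2.2.2)
        (.node (e x.1) (es x.1 (step x.1 x.2.1 x.2.2.1)))) := by
    have h1 := (PTime.refl (fun x : Σ a, σ a × β a × List (β a) => Data.node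
        (.node (eb x.1 x.2.2.1) (encList (eb x.1) x.2.2.2)) (.node (e x.1) (es x.1 x.2.1))))
    have h2 := h1.snd.fst.node (h1.snd.snd.node h1.fst.fst)
    exact h1.fst.snd.node (h1.snd.fst.node (h2.trans
      (hstep.reindex fun x : Σ a, σ a × β a × List (β a) => ⟨x.1, x.2.1, x.2.2.1⟩)))
  obtain ⟨cb, pb, hb⟩ := hbody
  have hloop : PTime (fun a => Data.node (encList (eb a) (l a)) (.node (e a) (es a (s₀ a))))
      (fun a => Data.node .leaf (.node (e a) (es a ((l a).foldl (step a) (s₀ a))))) := by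
    -- `N` bounds the size of all states, in terms of the size of `e a`
    let N : Polynomial ℕ := ql + Polynomial.X + q + 2
    let C : Polynomial ℕ := N + N + pb.comp N + 1
    refine ⟨.loop .fst cb, (Polynomial.X + 1) * C, fun a => ?_⟩
    have hmain : ∀ (r pre : List (β a)), pre ++ r = l a → ∃ t, t ≤ (r.length + 1) *
        C.eval (e a).size ∧ Eval (.loop .fst cb)
        (.node (encList (eb a) r) (.node (e a) (es a (pre.foldl (step a) (s₀ a)))))
        (.node .leaf (.node (e a) (es a ((l a).foldl (step a) (s₀ a))))) t := by
      intro r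
      induction r with
      | nil =>
        intro pre hpre
        rw [List.append_nil] at hpre
        subst hpre
        refine ⟨_, ?_, Eval.loop_done (Eval.fst_node _ _)⟩
        have h1 := hq a _ (List.prefix_refl _)
        have h2 := hql a
        have h3 : (encList (eb a) ([] : List (β a))).size ≤ (encList (eb a) (l a)).size :=
          Data.size_pos _
        simp only [Data.size, C, N, Polynomial.eval_add, Polynomial.eval_X, Polynomial.eval_comp,
          Polynomial.eval_one, Polynomial.eval_ofNat, List.length_nil] at *
        omega
      | cons b r ih =>
        intro pre hpre
        obtain ⟨t, ht, hE⟩ := ih (pre ++ [b]) (by simpa using hpre)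
        obtain ⟨s, hs, hEs⟩ := hb ⟨a, pre.foldl (step a) (s₀ a), b, r⟩
        rw [List.foldl_append] at hE
        refine ⟨_, ?_, Eval.loop_step (Eval.fst_node _ _) hEs hE⟩
        have h1 := hq a pre ⟨_, hpre⟩
        have h2 := hql a
        have h3 := encList_append_size (eb a) pre (b :: r)
        rw [hpre] at h3
        have h4 := Data.size_pos (encList (eb a) pre)
        have h5 : (Data.node (.node (eb a b) (encList (eb a) r))
            (.node (e a) (es a (pre.foldl (step a) (s₀ a))))).size ≤ N.eval (e a).size := by
          simp only [encList, Data.size, N, Polynomial.eval_add, Polynomial.eval_X,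
            Polynomial.eval_ofNat] at *
          omega
        have h6 := eval_mono_nat pb h5
        have h7 : C.eval (e a).size = N.eval (e a).size + N.eval (e a).size +
            pb.eval (N.eval (e a).size) + 1 := by simp [C]
        dsimp only at hs
        have h8 : (r.length + 1 + 1) * C.eval (e a).size =
          (r.length + 1) * C.eval (e a).size + C.eval (e a).size := by ring
        rw [List.length_cons, h8]
        simp only [encList]
        omega
    obtain ⟨t, ht, hE⟩ := hmain (l a) [] rfl
    refine ⟨t, ht.trans ?_, hE⟩
    rw [Polynomial.eval_mul]
    have h1 := length_le_size_encList (eb a) (l a)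
    dsimp only
    have h2 : (encList (eb a) (l a)).size ≤
        (Data.node (encList (eb a) (l a)) (.node (e a) (es a (s₀ a)))).size := by
      simp only [Data.size]; omega
    have h3 : (e a).size ≤
        (Data.node (encList (eb a) (l a)) (.node (e a) (es a (s₀ a)))).size := by
      simp only [Data.size]; omega
    refine Nat.mul_le_mul ?_ (eval_mono_nat C h3)
    rw [Polynomial.eval_add, Polynomial.eval_X, Polynomial.eval_one]
    omega
  exact ((hl.node ((refl e).node h₀)).trans hloop).snd.snd

/-- Folding over a list, if every step increases the size by a polynomially bounded amount. -/
theorem foldl (es : ∀ a, σ a → Data) (eb : ∀ a, β a → Data)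
    {l : ∀ a, List (β a)} {s₀ : ∀ a, σ a} {step : ∀ a, σ a → β a → σ a}
    (hl : PTime e fun a => encList (eb a) (l a)) (h₀ : PTime e fun a => es a (s₀ a))
    (hstep : PTime
      (fun x : Σ a, σ a × β a => Data.node (e x.1) (.node (es x.1 x.2.1) (eb x.1 x.2.2)))
      fun x => es x.1 (step x.1 x.2.1 x.2.2))
    (hq : ∃ q : Polynomial ℕ, ∀ a s, ∀ b ∈ l a,
      (es a (step a s b)).size ≤ (es a s).size + q.eval (e a).size) :
    PTime e fun a => es a ((l a).foldl (step a) (s₀ a)) := by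
  obtain ⟨q, hq⟩ := hq
  obtain ⟨ql, hql⟩ := hl.bound
  obtain ⟨q₀, hq₀⟩ := h₀.bound
  refine foldl_of_size_le es eb hl h₀ hstep ⟨q₀ + ql * q, fun a l' hl' => ?_⟩
  have key : ∀ (r : List (β a)) (s : σ a), (∀ b ∈ r, b ∈ l a) →
      (es a (r.foldl (step a) s)).size ≤ (es a s).size + r.length * q.eval (e a).size := by
    intro r
    induction r with
    | nil => intro s _; simp
    | cons b r ih =>
      intro s hr
      have h1 := ih (step a s b) fun c hc => hr c (List.mem_cons_of_mem _ hc)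
      have h2 := hq a s b (hr b List.mem_cons_self)
      rw [List.foldl_cons, List.length_cons, Nat.succ_mul]
      omega
  have h1 := key l' (s₀ a) fun b hb => hl'.subset hb
  have h2 : (es a (s₀ a)).size ≤ _ := hq₀ a
  have h3 : l'.length ≤ ql.eval (e a).size :=
    (hl'.length_le.trans (length_le_size_encList (eb a) (l a))).trans (hql a)
  have h4 := Nat.mul_le_mul_right (q.eval (e a).size) h3
  simp only [Polynomial.eval_add, Polynomial.eval_mul]
  omega

/-- The elements of a computable list have polynomially bounded size; so have the results of a
computation on them. -/
theorem bound_mem (eb : ∀ a, β a → Data) {l : ∀ a, List (β a)}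
    (hl : PTime e fun a => encList (eb a) (l a)) {f : ∀ a, β a → Data}
    (hf : PTime (fun x : Σ a, β a => Data.node (e x.1) (eb x.1 x.2)) fun x => f x.1 x.2) :
    ∃ q : Polynomial ℕ, ∀ a, ∀ b ∈ l a, (f a b).size ≤ q.eval (e a).size := by
  obtain ⟨ql, hql⟩ := hl.bound
  obtain ⟨q, hq⟩ := hf.bound
  refine ⟨q.comp (Polynomial.X + ql + 1), fun a b hb => (hq ⟨a, b⟩).trans ?_⟩
  rw [Polynomial.eval_comp]
  apply eval_mono_nat
  have : (encList (eb a) (l a)).size ≤ _ := hql a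
  have := size_le_size_encList (eb a) hb
  simp only [Data.size, Polynomial.eval_add, Polynomial.eval_X, Polynomial.eval_one]
  omega

theorem nil (eb : ∀ a, β a → Data) : PTime e fun a => encList (eb a) [] := leaf

theorem reverse (eb : ∀ a, β a → Data) {l : ∀ a, List (β a)}
    (hl : PTime e fun a => encList (eb a) (l a)) :
    PTime e fun a => encList (eb a) (l a).reverse := by
  refine (foldl (σ := fun a => List (β a)) (fun a => encList (eb a)) eb (s₀ := fun _ => [])
    (step := fun a s b => b :: s) hl (nil eb) ?_ ?_).congr ?_
  · have h := refl (fun x : Σ a, List (β a) × β a =>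
      Data.node (e x.1) (.node (encList (eb x.1) x.2.1) (eb x.1 x.2.2)))
    exact h.snd.snd.node h.snd.fst
  · obtain ⟨q, hq⟩ := hl.bound
    refine ⟨q + 1, fun a s b hb => ?_⟩
    have : (encList (eb a) (l a)).size ≤ _ := hq a
    have := size_le_size_encList (eb a) hb
    simp only [encList, Data.size, Polynomial.eval_add, Polynomial.eval_one]
    omega
  · intro a
    simp

theorem tail (eb : ∀ a, β a → Data) {l : ∀ a, List (β a)}
    (hl : PTime e fun a => encList (eb a) (l a)) :
    PTime e fun a => encList (eb a) (l a).tail := by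
  refine hl.trans ⟨.snd, Polynomial.X, fun a => ⟨(encList (eb a) (l a)).size, by simp, ?_⟩⟩
  change Eval _ (encList (eb a) (l a)) (encList (eb a) (l a).tail) _
  rcases l a with _ | ⟨b, l⟩
  · exact Eval.snd_leaf
  · exact Eval.snd_node _ _

/-- On encodings the head of a list is the left subtree, also if the list is empty and the default
value is encoded by a leaf. -/
theorem headD (eb : ∀ a, β a → Data) {l : ∀ a, List (β a)} {d : ∀ a, β a}
    (hl : PTime e fun a => encList (eb a) (l a)) (hd : ∀ a, eb a (d a) = Data.leaf) :
    PTime e fun a => eb a ((l a).headD (d a)) := by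
  refine hl.trans ⟨.fst, Polynomial.X, fun a => ⟨(encList (eb a) (l a)).size, by simp, ?_⟩⟩
  change Eval _ (encList (eb a) (l a)) (eb a ((l a).headD (d a))) _
  rcases l a with _ | ⟨b, l⟩
  · rw [List.headD_nil, hd]
    exact Eval.fst_leaf
  · exact Eval.fst_node _ _

theorem foldr (es : ∀ a, σ a → Data) (eb : ∀ a, β a → Data)
    {l : ∀ a, List (β a)} {s₀ : ∀ a, σ a} {step : ∀ a, β a → σ a → σ a}
    (hl : PTime e fun a => encList (eb a) (l a)) (h₀ : PTime e fun a => es a (s₀ a))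
    (hstep : PTime
      (fun x : Σ a, σ a × β a => Data.node (e x.1) (.node (es x.1 x.2.1) (eb x.1 x.2.2)))
      fun x => es x.1 (step x.1 x.2.2 x.2.1))
    (hq : ∃ q : Polynomial ℕ, ∀ a s, ∀ b ∈ l a,
      (es a (step a b s)).size ≤ (es a s).size + q.eval (e a).size) :
    PTime e fun a => es a ((l a).foldr (step a) (s₀ a)) := by
  obtain ⟨q, hq⟩ := hq
  refine (foldl es eb (step := fun a s b => step a b s) (reverse eb hl) h₀ hstep
    ⟨q, fun a s b hb => hq a s b (List.mem_reverse.1 hb)⟩).congr fun a => ?_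
  rw [List.foldl_reverse]

theorem append (eb : ∀ a, β a → Data) {l₁ l₂ : ∀ a, List (β a)}
    (h₁ : PTime e fun a => encList (eb a) (l₁ a)) (h₂ : PTime e fun a => encList (eb a) (l₂ a)) :
    PTime e fun a => encList (eb a) (l₁ a ++ l₂ a) := by
  refine (foldr (σ := fun a => List (β a)) (fun a => encList (eb a)) eb
    (step := fun a b s => b :: s) h₁ h₂ ?_ ?_).congr ?_
  · have h := refl (fun x : Σ a, List (β a) × β a =>
      Data.node (e x.1) (.node (encList (eb x.1) x.2.1) (eb x.1 x.2.2)))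
    exact h.snd.snd.node h.snd.fst
  · obtain ⟨q, hq⟩ := h₁.bound
    refine ⟨q + 1, fun a s b hb => ?_⟩
    have : (encList (eb a) (l₁ a)).size ≤ _ := hq a
    have := size_le_size_encList (eb a) hb
    simp only [encList, Data.size, Polynomial.eval_add, Polynomial.eval_one]
    omega
  · intro a
    simp

theorem flatMap (eb : ∀ a, β a → Data) (eg : ∀ a, γ a → Data) {l : ∀ a, List (β a)}
    {f : ∀ a, β a → List (γ a)} (hl : PTime e fun a => encList (eb a) (l a))
    (hf : PTime (fun x : Σ a, β a => Data.node (e x.1) (eb x.1 x.2))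
      fun x => encList (eg x.1) (f x.1 x.2)) :
    PTime e fun a => encList (eg a) ((l a).flatMap (f a)) := by
  refine (foldr (σ := fun a => List (γ a)) (fun a => encList (eg a)) eb (s₀ := fun _ => [])
    (step := fun a b s => f a b ++ s) hl (nil eg) ?_ ?_).congr ?_
  · have h := refl (fun x : Σ a, List (γ a) × β a =>
      Data.node (e x.1) (.node (encList (eg x.1) x.2.1) (eb x.1 x.2.2)))
    exact append (β := fun x : Σ a, List (γ a) × β a => γ x.1) (fun x => eg x.1)
      ((h.fst.node h.snd.snd).trans
        (hf.reindex fun x : Σ a, List (γ a) × β a => ⟨x.1, x.2.2⟩)) h.snd.fst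
  · obtain ⟨q, hq⟩ := bound_mem eb (f := fun a b => encList (eg a) (f a b)) hl hf
    refine ⟨q, fun a s b hb => ?_⟩
    have : (encList (eg a) (f a b)).size ≤ _ := hq a b hb
    have := encList_append_size (eg a) (f a b) s
    omega
  · intro a
    congr 1
    induction l a with
    | nil => rfl
    | cons b l ih => simp [ih]

theorem map (eb : ∀ a, β a → Data) (eg : ∀ a, γ a → Data) {l : ∀ a, List (β a)}
    {f : ∀ a, β a → γ a} (hl : PTime e fun a => encList (eb a) (l a))
    (hf : PTime (fun x : Σ a, β a => Data.node (e x.1) (eb x.1 x.2)) fun x => eg x.1 (f x.1 x.2)) :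
    PTime e fun a => encList (eg a) ((l a).map (f a)) :=
  (flatMap eb eg (f := fun a b => [f a b]) hl (hf.node leaf)).congr fun a => by
    rw [List.map_eq_flatMap]

end PTime

/-! ### Arithmetic with numbers in unary -/

theorem unary_eq_encList (n : ℕ) :
    unary n = encList (fun _ : Unit => Data.leaf) (List.replicate n ()) := by
  induction n with
  | zero => rfl
  | succ n ih => rw [unary, ih]; rfl

theorem size_unary (n : ℕ) : (unary n).size = 2 * n + 1 := by
  induction n with
  | zero => rfl
  | succ n ih => simp only [unary, Data.size, ih]; omega

namespace PTime

variable {α : Type} {e : α → Data} {σ β γ : α → Type}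

/-- Iteration, if all intermediate states have polynomial size. -/
theorem iterate_of_le (es : ∀ a, σ a → Data) {n : α → ℕ} {s₀ : ∀ a, σ a}
    {step : ∀ a, σ a → σ a}
    (hn : PTime e fun a => unary (n a)) (h₀ : PTime e fun a => es a (s₀ a))
    (hstep : PTime (fun x : Σ a, σ a => Data.node (e x.1) (es x.1 x.2))
      fun x => es x.1 (step x.1 x.2))
    (hq : ∃ q : Polynomial ℕ, ∀ a, ∀ k ≤ n a,
      (es a ((step a)^[k] (s₀ a))).size ≤ q.eval (e a).size) :
    PTime e fun a => es a ((step a)^[n a] (s₀ a)) := by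
  obtain ⟨q, hq⟩ := hq
  refine (foldl_of_size_le es (β := fun _ => Unit) (fun _ _ => Data.leaf)
    (l := fun a => List.replicate (n a) ()) (step := fun a s _ => step a s)
    (hn.congr fun a => unary_eq_encList _) h₀ ?_ ⟨q, fun a l' hl' => ?_⟩).congr fun a => ?_
  · have h := refl (fun x : Σ a, σ a × Unit =>
      Data.node (e x.1) (.node (es x.1 x.2.1) Data.leaf))
    exact (h.fst.node h.snd.fst).trans (hstep.reindex fun x : Σ a, σ a × Unit => ⟨x.1, x.2.1⟩)
  · rw [List.foldl_const]
    exact hq a _ (hl'.length_le.trans_eq List.length_replicate)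
  · rw [List.foldl_const, List.length_replicate]

/-- Iteration, if every step increases the size by a polynomially bounded amount. -/
theorem iterate (es : ∀ a, σ a → Data) {n : α → ℕ} {s₀ : ∀ a, σ a} {step : ∀ a, σ a → σ a}
    (hn : PTime e fun a => unary (n a)) (h₀ : PTime e fun a => es a (s₀ a))
    (hstep : PTime (fun x : Σ a, σ a => Data.node (e x.1) (es x.1 x.2))
      fun x => es x.1 (step x.1 x.2))
    (hq : ∃ q : Polynomial ℕ, ∀ a s, (es a (step a s)).size ≤ (es a s).size + q.eval (e a).size) :
    PTime e fun a => es a ((step a)^[n a] (s₀ a)) := by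
  obtain ⟨q, hq⟩ := hq
  refine (foldl es (β := fun _ => Unit) (fun _ _ => Data.leaf)
    (l := fun a => List.replicate (n a) ()) (step := fun a s _ => step a s)
    (hn.congr fun a => unary_eq_encList _) h₀ ?_ ⟨q, fun a s _ _ => hq a s⟩).congr fun a => ?_
  · have h := refl (fun x : Σ a, σ a × Unit =>
      Data.node (e x.1) (.node (es x.1 x.2.1) Data.leaf))
    exact (h.fst.node h.snd.fst).trans (hstep.reindex fun x : Σ a, σ a × Unit => ⟨x.1, x.2.1⟩)
  · rw [List.foldl_const, List.length_replicate]

variable {m n k : α → ℕ}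

theorem unary_const (k : ℕ) : PTime e fun _ => unary k := const _

theorem unary_succ (hn : PTime e fun a => unary (n a)) : PTime e fun a => unary (n a + 1) :=
  leaf.node hn

theorem unary_pred (hn : PTime e fun a => unary (n a)) : PTime e fun a => unary (n a - 1) := by
  refine hn.trans ⟨.snd, Polynomial.X, fun a => ⟨(unary (n a)).size, by simp, ?_⟩⟩
  change Eval _ (unary (n a)) (unary (n a - 1)) _
  rcases n a with _ | k
  · exact Eval.snd_leaf
  · exact Eval.snd_node _ _

theorem unary_add (hm : PTime e fun a => unary (m a)) (hn : PTime e fun a => unary (n a)) :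
    PTime e fun a => unary (m a + n a) := by
  refine (iterate (σ := fun _ => ℕ) (fun _ => unary) (step := fun _ s => s + 1) hn hm ?_ ?_).congr
    fun a => ?_
  · exact unary_succ (refl _).snd
  · exact ⟨2, fun a s => by simp [size_unary]; omega⟩
  · congr 1
    generalize n a = k
    induction k with
    | zero => rfl
    | succ k ih => rw [Function.iterate_succ_apply', ih]; omega

theorem unary_sub (hm : PTime e fun a => unary (m a)) (hn : PTime e fun a => unary (n a)) :
    PTime e fun a => unary (m a - n a) := by
  refine (iterate (σ := fun _ => ℕ) (fun _ => unary) (step := fun _ s => s - 1) hn hm ?_ ?_).congr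
    fun a => ?_
  · exact unary_pred (refl _).snd
  · exact ⟨0, fun a s => by simp [size_unary]⟩
  · congr 1
    generalize n a = k
    induction k with
    | zero => rfl
    | succ k ih => rw [Function.iterate_succ_apply', ih]; omega

theorem unary_mul (hm : PTime e fun a => unary (m a)) (hn : PTime e fun a => unary (n a)) :
    PTime e fun a => unary (m a * n a) := by
  refine (iterate (σ := fun _ => ℕ) (fun _ => unary) (s₀ := fun _ => 0)
    (step := fun a s => s + m a) hn leaf ?_ ?_).congr fun a => ?_
  · have h := refl (fun x : Σ _ : α, ℕ => Data.node (e x.1) (unary x.2))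
    exact unary_add h.snd (h.fst.trans (hm.reindex fun x : Σ _ : α, ℕ => x.1))
  · obtain ⟨q, hq⟩ := hm.bound
    exact ⟨q, fun a s => by have := hq a; simp only [size_unary] at *; omega⟩
  · congr 1
    generalize n a = k
    induction k with
    | zero => rfl
    | succ k ih => rw [Function.iterate_succ_apply', ih]; ring

theorem unary_half (hn : PTime e fun a => unary (n a)) : PTime e fun a => unary (n a / 2) := by
  -- the pair of the halves rounded down and up is updated by `(s, t) ↦ (t, s + 1)`
  refine fst (g := fun a => unary ((n a + 1) / 2))
    ((iterate (σ := fun _ => ℕ × ℕ) (fun _ s => Data.node (unary s.1) (unary s.2))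
      (s₀ := fun _ => (0, 0)) (step := fun _ s => (s.2, s.1 + 1)) hn (leaf.node leaf) ?_ ?_).congr
    fun a => ?_)
  · have h := refl (fun x : Σ _ : α, ℕ × ℕ => Data.node (e x.1)
      (.node (unary x.2.1) (unary x.2.2)))
    exact h.snd.snd.node (unary_succ h.snd.fst)
  · exact ⟨2, fun a s => by simp only [size_unary, Data.size, Polynomial.eval_ofNat]; omega⟩
  · generalize n a = k
    have : (fun s : ℕ × ℕ => (s.2, s.1 + 1))^[k] (0, 0) = (k / 2, (k + 1) / 2) := by
      induction k with
      | zero => rfl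
      | succ k ih =>
        rw [Function.iterate_succ_apply', ih]
        ext <;> simp
        omega
    rw [this]

theorem unary_eq_zero (hn : PTime e fun a => unary (n a)) :
    PTime e fun a => Enc.enc (decide (n a = 0)) := by
  refine hn.cond (bool_true.congr ?_) (bool_false.congr ?_)
  · rintro ⟨a, ha⟩
    rcases hna : n a with _ | k
    · simp
    · simp [hna, unary] at ha
  · rintro ⟨a, ha⟩
    rcases hna : n a with _ | k
    · simp [hna, unary] at ha
    · simp

theorem unary_le (hm : PTime e fun a => unary (m a)) (hn : PTime e fun a => unary (n a)) :
    PTime e fun a => Enc.enc (decide (m a ≤ n a)) :=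
  (unary_eq_zero (unary_sub hm hn)).congr fun a => by simp [Nat.sub_eq_zero_iff_le]

theorem unary_eq (hm : PTime e fun a => unary (m a)) (hn : PTime e fun a => unary (n a)) :
    PTime e fun a => Enc.enc (decide (m a = n a)) :=
  (bool_and (unary_le hm hn) (unary_le hn hm)).congr fun a => by
    rw [← Bool.decide_and]
    congr 2
    exact propext le_antisymm_iff.symm

theorem unary_ite {b : α → Bool} (hb : PTime e fun a => Enc.enc (b a))
    (hm : PTime e fun a => unary (m a)) (hn : PTime e fun a => unary (n a)) :
    PTime e fun a => unary (if b a then m a else n a) :=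
  (hb.ite hm hn).congr fun a => by cases b a <;> rfl

theorem unary_eval (p : Polynomial ℕ) (hn : PTime e fun a => unary (n a)) :
    PTime e fun a => unary (p.eval (n a)) := by
  induction p using Polynomial.induction_on with
  | C k => simpa using const _
  | add p q hp hq => simpa using unary_add hp hq
  | monomial k c ih =>
    refine (unary_mul ih hn).congr fun a => ?_
    simp [pow_succ, mul_assoc]

theorem countP (eb : ∀ a, β a → Data) {l : ∀ a, List (β a)} {p : ∀ a, β a → Bool}
    (hl : PTime e fun a => encList (eb a) (l a))
    (hp : PTime (fun x : Σ a, β a => Data.node (e x.1) (eb x.1 x.2))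
      fun x => Enc.enc (p x.1 x.2)) :
    PTime e fun a => unary ((l a).countP (p a)) := by
  refine (foldr (σ := fun _ => ℕ) (fun _ => unary) eb (s₀ := fun _ => 0)
    (step := fun a b s => if p a b then s + 1 else s) hl leaf ?_ ?_).congr ?_
  · have h := refl (fun x : Σ a, ℕ × β a => Data.node (e x.1) (.node (unary x.2.1) (eb x.1 x.2.2)))
    exact unary_ite ((h.fst.node h.snd.snd).trans
      (hp.reindex fun x : Σ a, ℕ × β a => ⟨x.1, x.2.2⟩)) (unary_succ h.snd.fst) h.snd.fst
  · refine ⟨2, fun a s b _ => ?_⟩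
    simp only [size_unary, Polynomial.eval_ofNat]
    split_ifs <;> omega
  · intro a
    congr 1
    induction l a with
    | nil => rfl
    | cons b l ih => rw [List.foldr_cons, ih, List.countP_cons]; split_ifs <;> rfl

theorem length (eb : ∀ a, β a → Data) {l : ∀ a, List (β a)}
    (hl : PTime e fun a => encList (eb a) (l a)) : PTime e fun a => unary (l a).length :=
  (countP eb (p := fun _ _ => true) hl bool_true).congr fun a => by simp

theorem range (hn : PTime e fun a => unary (n a)) :
    PTime e fun a => encList unary (List.range (n a)) := by
  have hs : ∀ k, (fun s : ℕ × List ℕ => (s.1 + 1, s.1 :: s.2))^[k] (0, []) =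
      (k, (List.range k).reverse) := by
    intro k
    induction k with
    | zero => rfl
    | succ k ih =>
      rw [Function.iterate_succ_apply', ih, List.range_succ, List.reverse_append]
      rfl
  have hlist : ∀ k, (encList unary (List.range k).reverse).size ≤ 2 * k * k + 1 := by
    intro k
    induction k with
    | zero => simp [encList, Data.size]
    | succ k ih =>
      rw [List.range_succ, List.reverse_append]
      simp only [List.reverse_cons, List.reverse_nil, List.nil_append, List.cons_append, encList,
        Data.size, size_unary]
      nlinarith
  have key : PTime e fun a =>
      Data.node (unary (n a)) (encList unary (List.range (n a)).reverse) := by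
    refine (iterate_of_le (σ := fun _ => ℕ × List ℕ)
      (fun _ s => Data.node (unary s.1) (encList unary s.2)) (s₀ := fun _ => (0, []))
      (step := fun _ s => (s.1 + 1, s.1 :: s.2)) hn (leaf.node leaf) ?_ ?_).congr fun a => ?_
    · have h := refl (fun x : Σ _ : α, ℕ × List ℕ => Data.node (e x.1)
        (.node (unary x.2.1) (encList unary x.2.2)))
      exact (unary_succ h.snd.fst).node (h.snd.fst.node h.snd.snd)
    · obtain ⟨q, hq⟩ := hn.bound
      refine ⟨2 * q * q + 2 * q + 3, fun a k hk => ?_⟩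
      have h1 : (unary (n a)).size ≤ _ := hq a
      have h2 := hlist k
      rw [size_unary] at h1
      rw [hs]
      simp only [Data.size, size_unary, Polynomial.eval_add, Polynomial.eval_mul,
        Polynomial.eval_ofNat]
      have h3 : k ≤ q.eval (e a).size := by omega
      nlinarith
    · rw [hs]
  exact (reverse (β := fun _ => ℕ) (fun _ => unary) key.snd).congr fun a => by
    rw [List.reverse_reverse]

end PTime

namespace PTime

variable {α : Type} {e : α → Data} {β γ : α → Type}

theorem replicate (eb : ∀ a, β a → Data) {n : α → ℕ} {b : ∀ a, β a}
    (hn : PTime e fun a => unary (n a)) (hb : PTime e fun a => eb a (b a)) :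
    PTime e fun a => encList (eb a) (List.replicate (n a) (b a)) :=
  (map (β := fun _ => ℕ) (fun _ => unary) eb (f := fun a _ => b a) (range hn)
    ((refl _).fst.trans (hb.reindex fun x : Σ _ : α, ℕ => x.1))).congr fun a => by
      rw [List.map_const', List.length_range]

end PTime

/-! ### Numbers in binary -/

/-- Moving the lowest bit of a number to a list. -/
def shiftBit (s : ℕ × List Bool) : ℕ × List Bool :=
  if s.1 = 0 then s else (s.1 / 2, decide (s.1 % 2 = 1) :: s.2)

theorem bits_of_pos {n : ℕ} (hn : n ≠ 0) :
    n.bits = decide (n % 2 = 1) :: (n / 2).bits := by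
  have h : n.bodd = decide (n % 2 = 1) := by
    rw [Nat.mod_two_of_bodd]; cases n.bodd <;> rfl
  conv_lhs => rw [← Nat.bit_bodd_div2 n]
  rw [Nat.bits_append_bit, h, Nat.div2_val]
  intro h0
  by_contra hb
  rw [← Nat.bit_bodd_div2 n, h0] at hn
  cases hb' : n.bodd <;> simp_all

theorem shiftBit_iterate (k n : ℕ) (r : List Bool) (h : n ≤ k) :
    shiftBit^[k] (n, r) = (0, n.bits.reverse ++ r) := by
  induction k generalizing n r with
  | zero => obtain rfl : n = 0 := by omega
            simp
  | succ k ih =>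
    rw [Function.iterate_succ_apply]
    by_cases hn : n = 0
    · subst hn
      have : shiftBit (0, r) = (0, r) := rfl
      rw [this, ih 0 r (Nat.zero_le k)]
    · have : shiftBit (n, r) = (n / 2, decide (n % 2 = 1) :: r) := by simp [shiftBit, hn]
      rw [this, ih _ _ (by omega), bits_of_pos hn]
      simp

/-- The value of a list of bits, least significant bit first. -/
def bitsVal : List Bool → ℕ
  | [] => 0
  | b :: l => b.toNat + 2 * bitsVal l

theorem bitsVal_bits (n : ℕ) : bitsVal n.bits = n := by
  induction n using Nat.strong_induction_on with
  | _ n ih =>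
    by_cases hn : n = 0
    · subst hn; rfl
    · rw [bits_of_pos hn, bitsVal, ih _ (by omega)]
      by_cases h : n % 2 = 1 <;> simp [h] <;> omega

/-- One step of the comparison of `c * y` and `D * x`, for numbers `x`, `y` in binary: the new value
is `c + ⌊(u - c + D * a - c * b) / 2⌋` for the current bits `a` of `x` and `b` of `y`.  The offset
`c` keeps the carry nonnegative; starting from `c` it is at most `c + D`, so that it can be held in
unary. -/
def carryStep (D c : ℕ) (a b : Bool) (u : ℕ) : ℕ :=
  (u + (if a then D else 0) + (if b then 0 else c)) / 2

/-- The carry that remains after comparing `c * y` and `D * x` bit by bit; the second list is padded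
with zeros while there are bits in the first one. -/
def carryFst (D c : ℕ) (l : List Bool) (s : ℕ × List Bool) : ℕ × List Bool :=
  l.foldl (fun s a => (carryStep D c a (s.2.headD false) s.1, s.2.tail)) s

/-- The carry when the first list is exhausted. -/
def carrySnd (D c : ℕ) (s : ℕ × List Bool) : ℕ :=
  s.2.foldl (fun u b => carryStep D c false b u) s.1

theorem le_carryStep_iff (D c u x y : ℕ) (a b : Bool) :
    c + c * y ≤ carryStep D c a b u + D * x ↔
      c + c * (b.toNat + 2 * y) ≤ u + D * (a.toNat + 2 * x) := by
  have h1 : c * (b.toNat + 2 * y) = c * b.toNat + 2 * (c * y) := by ring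
  have h2 : D * (a.toNat + 2 * x) = D * a.toNat + 2 * (D * x) := by ring
  rw [h1, h2, carryStep]
  generalize c * y = cy
  generalize D * x = dx
  cases a <;> cases b <;> simp <;> omega

theorem le_carrySnd_iff (D c : ℕ) (l : List Bool) (u : ℕ) :
    c ≤ carrySnd D c (u, l) ↔ c + c * bitsVal l ≤ u := by
  induction l generalizing u with
  | nil => simp [carrySnd, bitsVal]
  | cons b l ih =>
    have := le_carryStep_iff D c u 0 (bitsVal l) false b
    simp only [Bool.toNat_false, mul_zero, add_zero] at this
    rw [bitsVal, ← this, ← ih]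
    rfl

theorem le_carryFst_iff (D c : ℕ) (l l' : List Bool) (u : ℕ) :
    c ≤ carrySnd D c (carryFst D c l (u, l')) ↔ c + c * bitsVal l' ≤ u + D * bitsVal l := by
  induction l generalizing u l' with
  | nil => simpa [carryFst, bitsVal] using le_carrySnd_iff D c l' u
  | cons a l ih =>
    have h : carryFst D c (a :: l) (u, l') =
      carryFst D c l (carryStep D c a (l'.headD false) u, l'.tail) := rfl
    have h' : bitsVal l' = (l'.headD false).toNat + 2 * bitsVal l'.tail := by
      cases l' <;> rfl
    rw [h, ih, h', bitsVal, le_carryStep_iff]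

namespace PTime

variable {α : Type} {e : α → Data} {c D x y : α → ℕ}

theorem binary_of_unary (hx : PTime e fun a => unary (x a)) :
    PTime e fun a => binary (x a) := by
  have key := iterate (σ := fun _ => ℕ × List Bool)
    (fun _ s => Data.node (unary s.1) (Enc.enc s.2)) (s₀ := fun a => (x a, []))
    (step := fun _ => shiftBit) hx (hx.node leaf) ?_ ?_
  · have h2 : PTime e fun a => Enc.enc (x a).bits.reverse := (key.congr fun a => by
      rw [shiftBit_iterate _ _ _ le_rfl, List.append_nil]).snd
    exact (reverse (β := fun _ => Bool) (fun _ => Enc.enc) h2).congr fun a => by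
      rw [List.reverse_reverse]; rfl
  · have h := refl (fun x : Σ _ : α, ℕ × List Bool => Data.node (e x.1)
      (.node (unary x.2.1) (Enc.enc x.2.2)))
    have hp : PTime _ fun x : Σ _ : α, ℕ × List Bool =>
        Enc.enc (decide (x.2.1 - 2 * (x.2.1 / 2) = 1)) :=
      unary_eq (unary_sub h.snd.fst (unary_mul (unary_const 2) (unary_half h.snd.fst)))
        (unary_const 1)
    refine ((unary_eq_zero h.snd.fst).ite h.snd
      ((unary_half h.snd.fst).node (hp.node h.snd.snd))).congr ?_
    rintro ⟨a, n, l⟩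
    have : n % 2 = n - 2 * (n / 2) := by omega
    simp only [shiftBit, this]
    by_cases hn : n = 0
    · simp [hn]
    · simp only [hn, decide_false, Bool.false_eq_true, if_false]
      rfl
  · refine ⟨4, fun a s => ?_⟩
    obtain ⟨n, l⟩ := s
    by_cases hn : n = 0
    · simp [shiftBit, hn]
    · have h : (Enc.enc (decide (n % 2 = 1) :: l) : Data) =
        .node (Enc.enc (decide (n % 2 = 1))) (Enc.enc l) := rfl
      have h' : ∀ b : Bool, (Enc.enc b).size ≤ 3 := by decide
      have := h' (decide (n % 2 = 1))
      simp only [shiftBit, hn, if_false, Data.size, h, size_unary, Polynomial.eval_ofNat]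
      omega

theorem unary_carryStep {u : α → ℕ} {p q : α → Bool} (hD : PTime e fun a => unary (D a))
    (hc : PTime e fun a => unary (c a)) (hp : PTime e fun a => Enc.enc (p a))
    (hq : PTime e fun a => Enc.enc (q a)) (hu : PTime e fun a => unary (u a)) :
    PTime e fun a => unary (carryStep (D a) (c a) (p a) (q a) (u a)) :=
  unary_half (unary_add (unary_add hu (unary_ite hp hD (unary_const 0)))
    (unary_ite hq (unary_const 0) hc))

/-- Comparison of multiples of two numbers given by lists of bits, with factors in unary. -/
theorem mul_bitsVal_le {x y : α → List Bool} (hD : PTime e fun a => unary (D a))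
    (hc : PTime e fun a => unary (c a)) (hx : PTime e fun a => Enc.enc (x a))
    (hy : PTime e fun a => Enc.enc (y a)) :
    PTime e fun a => Enc.enc (decide (c a * bitsVal (y a) ≤ D a * bitsVal (x a))) := by
  obtain ⟨qc, hqc⟩ := hc.bound
  obtain ⟨qD, hqD⟩ := hD.bound
  have hcarry : ∀ D c a b u, (unary (carryStep D c a b u)).size ≤
      (unary u).size + ((unary D).size + (unary c).size) := by
    intro D c a b u
    simp only [size_unary, carryStep]
    split_ifs <;> omega
  have h1 : PTime e fun a => Data.node
      (unary (carryFst (D a) (c a) (x a) (c a, (y a))).1)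
      (Enc.enc (carryFst (D a) (c a) (x a) (c a, (y a))).2) := by
    refine foldl (σ := fun _ => ℕ × List Bool) (β := fun _ => Bool)
      (fun _ s => Data.node (unary s.1) (Enc.enc s.2)) (fun _ => Enc.enc)
      (l := fun a => (x a)) (s₀ := fun a => (c a, (y a)))
      (step := fun a s p => (carryStep (D a) (c a) p (s.2.headD false) s.1, s.2.tail)) hx
      (hc.node hy) ?_ ?_
    · have h := refl (fun x : Σ _ : α, (ℕ × List Bool) × Bool => Data.node (e x.1)
        (.node (.node (unary x.2.1.1) (Enc.enc x.2.1.2)) (Enc.enc x.2.2)))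
      have hl := h.snd.fst.snd
      have hhead : PTime _ fun x : Σ _ : α, (ℕ × List Bool) × Bool =>
          Enc.enc (x.2.1.2.headD false) :=
        headD (β := fun _ => Bool) (fun _ => Enc.enc) hl fun _ => rfl
      have htail : PTime _ fun x : Σ _ : α, (ℕ × List Bool) × Bool =>
          Enc.enc x.2.1.2.tail := tail (β := fun _ => Bool) (fun _ => Enc.enc) hl
      exact (unary_carryStep
        (h.fst.trans (hD.reindex fun x : Σ _ : α, (ℕ × List Bool) × Bool => x.1))
        (h.fst.trans (hc.reindex fun x : Σ _ : α, (ℕ × List Bool) × Bool => x.1))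
        h.snd.snd hhead h.snd.fst.fst).node htail
    · refine ⟨qD + qc, fun a s b _ => ?_⟩
      have h1 : (unary (c a)).size ≤ _ := hqc a
      have h2 : (unary (D a)).size ≤ _ := hqD a
      have h3 := hcarry (D a) (c a) b (s.2.headD false) s.1
      have h4 : (Enc.enc s.2.tail).size ≤ (Enc.enc s.2).size := by
        rcases s.2 with _ | ⟨b, l⟩
        · exact le_rfl
        · change _ ≤ (Data.node (Enc.enc b) (Enc.enc l)).size
          simp only [Data.size, List.tail_cons]
          omega
      simp only [Data.size, Polynomial.eval_add]
      omega
  have h2 : PTime e fun a => unary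
      (carrySnd (D a) (c a) (carryFst (D a) (c a) (x a) (c a, (y a)))) := by
    refine foldl (σ := fun _ => ℕ) (β := fun _ => Bool) (fun _ => unary) (fun _ => Enc.enc)
      (l := fun a => (carryFst (D a) (c a) (x a) (c a, (y a))).2) h1.snd h1.fst ?_ ?_
    · have h := refl (fun x : Σ _ : α, ℕ × Bool => Data.node (e x.1)
        (.node (unary x.2.1) (Enc.enc x.2.2)))
      exact unary_carryStep
        (h.fst.trans (hD.reindex fun x : Σ _ : α, ℕ × Bool => x.1))
        (h.fst.trans (hc.reindex fun x : Σ _ : α, ℕ × Bool => x.1)) bool_false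
        h.snd.snd h.snd.fst
    · refine ⟨qD + qc, fun a s b _ => ?_⟩
      have h1 : (unary (c a)).size ≤ _ := hqc a
      have h2 : (unary (D a)).size ≤ _ := hqD a
      have h3 := hcarry (D a) (c a) false b s
      simp only [Polynomial.eval_add]
      omega
  refine (unary_le hc h2).congr fun a => ?_
  congr 1
  rw [decide_eq_decide, le_carryFst_iff]
  omega

/-- Comparison of multiples of two numbers in binary, with factors in unary. -/
theorem mul_binary_le (hD : PTime e fun a => unary (D a)) (hc : PTime e fun a => unary (c a))
    (hx : PTime e fun a => binary (x a)) (hy : PTime e fun a => binary (y a)) :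
    PTime e fun a => Enc.enc (decide (c a * y a ≤ D a * x a)) :=
  (mul_bitsVal_le hD hc hx hy).congr fun a => by simp only [bitsVal_bits]

end PTime

/-! ### Integers with polynomially bounded absolute value -/

/-- The integer `z a` is computed from `e a`, as a difference of two numbers in unary.  Its absolute
value is then polynomially bounded. -/
def SmallInt {α : Type} (e : α → Data) (z : α → ℤ) : Prop :=
  ∃ m n : α → ℕ, PTime e (fun a => unary (m a)) ∧ PTime e (fun a => unary (n a)) ∧
    ∀ a, z a = m a - n a

namespace SmallInt

variable {α : Type} {e : α → Data} {z w : α → ℤ}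

theorem natCast {n : α → ℕ} (hn : PTime e fun a => unary (n a)) :
    SmallInt e fun a => (n a : ℤ) := ⟨n, fun _ => 0, hn, PTime.leaf, fun a => by simp⟩

theorem add : SmallInt e z → SmallInt e w → SmallInt e fun a => z a + w a := by
  rintro ⟨m, n, hm, hn, hz⟩ ⟨m', n', hm', hn', hw⟩
  exact ⟨_, _, hm.unary_add hm', hn.unary_add hn',
    fun a => by dsimp only; rw [hz, hw]; push_cast; ring⟩

theorem sub : SmallInt e z → SmallInt e w → SmallInt e fun a => z a - w a := by
  rintro ⟨m, n, hm, hn, hz⟩ ⟨m', n', hm', hn', hw⟩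
  exact ⟨_, _, hm.unary_add hn', hn.unary_add hm',
    fun a => by dsimp only; rw [hz, hw]; push_cast; ring⟩

theorem neg (hz : SmallInt e z) : SmallInt e fun a => -z a := by
  obtain ⟨m, n, hm, hn, hz⟩ := hz
  exact ⟨n, m, hn, hm, fun a => by dsimp only; rw [hz]; ring⟩

theorem mul : SmallInt e z → SmallInt e w → SmallInt e fun a => z a * w a := by
  rintro ⟨m, n, hm, hn, hz⟩ ⟨m', n', hm', hn', hw⟩
  exact ⟨_, _, (hm.unary_mul hm').unary_add (hn.unary_mul hn'),
    (hm.unary_mul hn').unary_add (hn.unary_mul hm'),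
    fun a => by dsimp only; rw [hz, hw]; push_cast; ring⟩

theorem toNat (hz : SmallInt e z) : PTime e fun a => unary (z a).toNat := by
  obtain ⟨m, n, hm, hn, hz⟩ := hz
  exact (hm.unary_sub hn).congr fun a => by rw [hz, Int.toNat_sub]

theorem enc (hz : SmallInt e z) : PTime e fun a => Enc.enc (z a) := by
  obtain ⟨m, n, hm, hn, hz⟩ := hz
  refine ((hn.unary_le hm).bool_not.node
    ((hm.unary_sub hn).unary_add (hn.unary_sub hm)).binary_of_unary).congr fun a => ?_
  have h1 : (m a - n a) + (n a - m a) = (z a).natAbs := by have := hz a; omega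
  have h2 : (!decide (n a ≤ m a)) = decide (z a < 0) := by
    rw [← decide_not]
    refine decide_eq_decide.2 ?_
    have := hz a
    omega
  rw [h1, h2]
  rfl

end SmallInt

/-! ### Pairing up two lists -/

/-- Pairs of corresponding elements of two lists of lists; the second list is filled up with empty
lists. -/
def zipPad {β γ : Type} : List β → List (List γ) → List (β × List γ)
  | [], _ => []
  | b :: l, r => (b, r.headD []) :: zipPad l r.tail

theorem zipPad_foldl {β γ : Type} (l : List β) (r : List (List γ)) (s : List (β × List γ)) :
    (l.foldl (fun (s : List (List γ) × List (β × List γ)) b =>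
      (s.1.tail, (b, s.1.headD []) :: s.2)) (r, s)).2 = (zipPad l r).reverse ++ s := by
  induction l generalizing r s with
  | nil => rfl
  | cons b l ih => rw [List.foldl_cons, ih]; simp [zipPad]

theorem PTime.zipPad {α : Type} {e : α → Data} {β γ : Type} (eb : β → Data) (eg : γ → Data)
    {l : α → List β} {r : α → List (List γ)} (hl : PTime e fun a => encList eb (l a))
    (hr : PTime e fun a => encList (encList eg) (r a)) :
    PTime e fun a => encList (fun p : β × List γ => Data.node (eb p.1) (encList eg p.2))
      (zipPad (l a) (r a)) := by
  have key : PTime e fun a => Data.node _ _ := foldl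
    (σ := fun _ => List (List γ) × List (β × List γ)) (β := fun _ => β)
    (fun _ s => Data.node (encList (encList eg) s.1)
      (encList (fun p : β × List γ => Data.node (eb p.1) (encList eg p.2)) s.2)) (fun _ => eb)
    (s₀ := fun a => (r a, [])) (step := fun _ s b => (s.1.tail, (b, s.1.headD []) :: s.2))
    hl (hr.node leaf) ?_ ?_
  · refine (reverse (β := fun _ => β × List γ) (fun _ p => Data.node (eb p.1) (encList eg p.2))
      key.snd).congr fun a => ?_
    rw [zipPad_foldl, List.append_nil, List.reverse_reverse]
  · have h := refl (fun x : Σ _ : α, (List (List γ) × List (β × List γ)) × β => Data.node (e x.1)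
      (.node (.node (encList (encList eg) x.2.1.1)
        (encList (fun p : β × List γ => Data.node (eb p.1) (encList eg p.2)) x.2.1.2)) (eb x.2.2)))
    have hl := h.snd.fst.fst
    have hhead : PTime _ fun x : Σ _ : α, (List (List γ) × List (β × List γ)) × β =>
        encList eg (x.2.1.1.headD []) :=
      headD (β := fun _ => List γ) (fun _ => encList eg) hl fun _ => rfl
    have htail : PTime _ fun x : Σ _ : α, (List (List γ) × List (β × List γ)) × β =>
        encList (encList eg) x.2.1.1.tail :=
      tail (β := fun _ => List γ) (fun _ => encList eg) hl
    exact htail.node ((h.snd.snd.node hhead).node h.snd.fst.snd)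
  · obtain ⟨q, hq⟩ := hl.bound
    refine ⟨q + 4, fun a s b hb => ?_⟩
    have h1 : (encList eb (l a)).size ≤ _ := hq a
    have h2 := size_le_size_encList eb hb
    rcases s with ⟨_ | ⟨z, r⟩, s⟩ <;>
    · simp only [encList, Data.size, List.tail_cons, List.tail_nil, List.headD_cons, List.headD_nil,
        Polynomial.eval_add, Polynomial.eval_ofNat]
      omega

/-! ### The action of gates on states -/

theorem zeta_sq : zeta ^ 2 = Complex.I := by
  rw [zeta, ← Complex.exp_nat_mul, show ((2 : ℕ) : ℂ) * (Complex.I * (Real.pi / 4)) =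
    Real.pi / 2 * Complex.I by push_cast; ring, Complex.exp_pi_div_two_mul_I]

theorem zeta_pow_four : zeta ^ 4 = -1 := by
  rw [show zeta ^ 4 = (zeta ^ 2) ^ 2 by ring, zeta_sq, Complex.I_sq]

theorem zeta_mul_pow_seven : zeta * zeta ^ 7 = 1 := by
  linear_combination (zeta ^ 4 - 1) * zeta_pow_four

theorem norm_zeta : ‖zeta‖ = 1 := by
  rw [zeta, mul_comm, show ((Real.pi : ℂ) / 4) = ((Real.pi / 4 : ℝ) : ℂ) by push_cast; rfl]
  exact Complex.norm_exp_ofReal_mul_I _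

/-- The normalization `1 / √2` of the Hadamard gate. -/
noncomputable abbrev rsqrt : ℂ := ((Real.sqrt 2 : ℝ) : ℂ)⁻¹

theorem rsqrt_sq : rsqrt ^ 2 = 1 / 2 := by
  rw [inv_pow, ← Complex.ofReal_pow, Real.sq_sqrt (by norm_num)]
  norm_num

theorem two_mul_rsqrt : 2 * rsqrt = zeta - zeta ^ 3 := by
  have h1 : zeta = rsqrt + rsqrt * Complex.I := by
    rw [zeta, mul_comm, Complex.exp_mul_I, show ((Real.pi : ℂ) / 4) = ((Real.pi / 4 : ℝ) : ℂ) by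
      push_cast; rfl, ← Complex.ofReal_cos, ← Complex.ofReal_sin, Real.cos_pi_div_four,
      Real.sin_pi_div_four]
    have h2 : ((Real.sqrt 2 / 2 : ℝ) : ℂ) = rsqrt := by
      rw [Real.sqrt_div_self', Complex.ofReal_div, Complex.ofReal_one, one_div]
    rw [h2]
  rw [show zeta ^ 3 = zeta ^ 2 * zeta by ring, zeta_sq, h1]
  linear_combination rsqrt * Complex.I_sq

section Action

variable {n : ℕ}

open Function (update)

theorem had_mulVec (q : Fin n) (ψ : Basis n → ℂ) (x : Basis n) :
    ((Gate.had q).mat *ᵥ ψ) x =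
      rsqrt * (ψ (update x q false) + (if x q then -1 else 1) * ψ (update x q true)) := by
  have hne : update x q false ≠ update x q true := fun h => by
    simpa using congrFun h q
  rw [Matrix.mulVec, dotProduct, Finset.sum_eq_add (update x q false) (update x q true) hne]
  · simp only [Gate.mat, Matrix.of_apply]
    rw [if_pos (c := ∀ j, _) fun j hj => (Function.update_of_ne hj _ _).symm,
      if_pos (c := ∀ j, _) fun j hj => (Function.update_of_ne hj _ _).symm]
    simp only [Function.update_self, Bool.and_false, Bool.and_true, Bool.false_eq_true, if_false]
    ring
  · rintro y _ ⟨h1, h2⟩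
    simp only [Gate.mat, Matrix.of_apply]
    rw [if_neg, zero_mul]
    intro h
    have hy : y = update x q (y q) := by
      funext j
      by_cases hj : j = q
      · subst hj; simp
      · rw [Function.update_of_ne hj, h j hj]
    cases hq : y q <;> rw [hq] at hy
    · exact h1 hy
    · exact h2 hy
  · exact fun h => absurd (Finset.mem_univ _) h
  · exact fun h => absurd (Finset.mem_univ _) h

theorem tee_mulVec (q : Fin n) (ψ : Basis n → ℂ) (x : Basis n) :
    ((Gate.tee q).mat *ᵥ ψ) x = (if x q then zeta else 1) * ψ x := by
  rw [Gate.mat, Matrix.mulVec_diagonal]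

theorem cnot_mulVec (c t : Fin n) (h : c ≠ t) (ψ : Basis n → ℂ) (x : Basis n) :
    ((Gate.cnot c t h).mat *ᵥ ψ) x = ψ (update x t (xor (x t) (x c))) := by
  rw [Matrix.mulVec, dotProduct, Finset.sum_eq_single (update x t (xor (x t) (x c)))]
  · simp only [Gate.mat, Matrix.of_apply]
    rw [if_pos, one_mul]
    simp [Function.update_of_ne h]
  · intro y _ hy
    simp only [Gate.mat, Matrix.of_apply]
    rw [if_neg, zero_mul]
    rintro rfl
    apply hy
    simp [Function.update_of_ne h]
  · exact fun h => absurd (Finset.mem_univ _) h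

theorem Circuit.mat_nil_mulVec (ψ : Basis n → ℂ) : Circuit.mat ([] : Circuit n) *ᵥ ψ = ψ :=
  Matrix.one_mulVec ψ

theorem Circuit.mat_cons_mulVec (g : Gate n) (c : Circuit n) (ψ : Basis n → ℂ) :
    Circuit.mat (g :: c) *ᵥ ψ = Circuit.mat c *ᵥ (g.mat *ᵥ ψ) := by
  rw [Circuit.mat, Matrix.mulVec_mulVec]

theorem Circuit.mat_append_mulVec (c d : Circuit n) (ψ : Basis n → ℂ) :
    Circuit.mat (c ++ d) *ᵥ ψ = Circuit.mat d *ᵥ (Circuit.mat c *ᵥ ψ) := by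
  induction c generalizing ψ with
  | nil => rw [List.nil_append, Circuit.mat_nil_mulVec]
  | cons g c ih => rw [List.cons_append, Circuit.mat_cons_mulVec, ih, Circuit.mat_cons_mulVec]

theorem tee_pow_mulVec (k : ℕ) (q : Fin n) (ψ : Basis n → ℂ) (x : Basis n) :
    (Circuit.mat (List.replicate k (.tee q)) *ᵥ ψ) x = (if x q then zeta ^ k else 1) * ψ x := by
  induction k generalizing ψ with
  | zero => simp [Circuit.mat_nil_mulVec]
  | succ k ih =>
    rw [List.replicate_succ, Circuit.mat_cons_mulVec, ih, tee_mulVec]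
    split_ifs <;> ring

/-! ### Unitarity -/

/-- The squared norm of a state. -/
noncomputable def normSq (ψ : Basis n → ℂ) : ℝ := ∑ x, ‖ψ x‖ ^ 2

theorem update_not_involutive (q : Fin n) :
    Function.Involutive fun x : Basis n => update x q (!x q) := fun x => by simp

theorem sum_update_not (q : Fin n) (f : Basis n → ℝ) :
    ∑ x, f (update x q (!x q)) = ∑ x, f x :=
  Equiv.sum_comp (update_not_involutive q).toPerm f

theorem Gate.normSq_mulVec (g : Gate n) (ψ : Basis n → ℂ) : normSq (g.mat *ᵥ ψ) = normSq ψ := by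
  unfold normSq
  cases g with
  | had q =>
    have h1 := sum_update_not q fun x => ‖((Gate.had q).mat *ᵥ ψ) x‖ ^ 2
    have h2 := sum_update_not q fun x => ‖ψ x‖ ^ 2
    have h3 : ∑ x, (‖((Gate.had q).mat *ᵥ ψ) x‖ ^ 2 +
        ‖((Gate.had q).mat *ᵥ ψ) (update x q (!x q))‖ ^ 2) =
        ∑ x, (‖ψ x‖ ^ 2 + ‖ψ (update x q (!x q))‖ ^ 2) := by
      refine Finset.sum_congr rfl fun x _ => ?_
      have hr : ‖rsqrt‖ ^ 2 = 1 / 2 := by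
        rw [← norm_pow, rsqrt_sq]; norm_num
      have hp : ∀ u v : ℂ, ‖rsqrt * (u + v)‖ ^ 2 + ‖rsqrt * (u + -v)‖ ^ 2 = ‖u‖ ^ 2 + ‖v‖ ^ 2 := by
        intro u v
        have := parallelogram_law_with_norm ℝ u v
        rw [norm_mul, norm_mul, mul_pow, mul_pow, hr, ← sub_eq_add_neg]
        nlinarith
      rw [had_mulVec, had_mulVec]
      cases hx : x q
      · have h := hp (ψ x) (ψ (update x q true))
        have hxx : update x q false = x := by rw [← hx, Function.update_eq_self]
        simpa [hxx] using h
      · have h := hp (ψ (update x q false)) (ψ x)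
        have hxx : update x q true = x := by rw [← hx, Function.update_eq_self]
        simp [hxx] at h ⊢
        linarith
    rw [Finset.sum_add_distrib, Finset.sum_add_distrib, h1, h2] at h3
    linarith
  | tee q =>
    refine Finset.sum_congr rfl fun x _ => ?_
    rw [tee_mulVec]
    split_ifs <;> simp [norm_zeta]
  | cnot c t h =>
    have hinv : Function.Involutive fun x : Basis n => update x t (xor (x t) (x c)) := fun x => by
      simp [Function.update_of_ne h]
    rw [← Equiv.sum_comp hinv.toPerm fun x => ‖ψ x‖ ^ 2]
    exact Finset.sum_congr rfl fun x _ => by rw [cnot_mulVec]; rfl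

theorem Circuit.normSq_mulVec (c : Circuit n) (ψ : Basis n → ℂ) :
    normSq (Circuit.mat c *ᵥ ψ) = normSq ψ := by
  induction c generalizing ψ with
  | nil => rw [Circuit.mat_nil_mulVec]
  | cons g c ih => rw [Circuit.mat_cons_mulVec, ih, Gate.normSq_mulVec]

theorem Circuit.normSq_state (c : Circuit n) : normSq (Circuit.state c) = 1 := by
  rw [Circuit.state, Circuit.normSq_mulVec, normSq, Finset.sum_eq_single (zeroBasis n)]
  · simp
  · intro x _ hx; simp [hx]
  · exact fun h => absurd (Finset.mem_univ _) h

/-! ### Controlled gates -/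

/-- The phase `-1` on the basis states in which three qubits are all `1`, from the expansion of
`4abc` into `a + b + c`, the negated sums of two of the bits modulo 2, and the sum of all three
modulo 2; `T⁷` is the inverse of `T`. -/
def ccz (a b c : Fin n) (hab : a ≠ b) (hac : a ≠ c) (hbc : b ≠ c) : Circuit n :=
  [.tee a, .tee b, .tee c, .cnot a b hab] ++ List.replicate 7 (.tee b) ++
  [.cnot b c hbc, .tee c, .cnot a b hab, .cnot b c hbc] ++ List.replicate 7 (.tee c) ++
  [.cnot a c hac, .cnot b c hbc] ++ List.replicate 7 (.tee c) ++ [.cnot b c hbc]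

theorem ccz_mulVec (a b c : Fin n) (hab : a ≠ b) (hac : a ≠ c) (hbc : b ≠ c) (ψ : Basis n → ℂ)
    (x : Basis n) : (Circuit.mat (ccz a b c hab hac hbc) *ᵥ ψ) x =
      (if x a && x b && x c then -1 else 1) * ψ x := by
  -- the state at the basis states that differ from `x` only in the three qubits
  let pt (p q s : Bool) : Basis n := update (update (update x a p) b q) c s
  have hx : x = pt (x a) (x b) (x c) := by simp [pt]
  have ha : ∀ p q s, pt p q s a = p := fun p q s => by simp [pt, hab, hac]
  have hb : ∀ p q s, pt p q s b = q := fun p q s => by simp [pt, hbc]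
  have hc : ∀ p q s, pt p q s c = s := fun p q s => by simp [pt]
  have hub : ∀ p q s t, update (pt p q s) b t = pt p t s := fun p q s t => by
    simp only [pt]
    rw [Function.update_comm hbc.symm, Function.update_idem, Function.update_comm hbc]
  have huc : ∀ p q s t, update (pt p q s) c t = pt p q t := fun p q s t => by simp [pt]
  have h1 := zeta_mul_pow_seven
  rw [hx, ha, hb, hc]
  generalize x a = p
  generalize x b = q
  generalize x c = s
  simp only [ccz, Circuit.mat_append_mulVec, Circuit.mat_cons_mulVec, Circuit.mat_nil_mulVec,
    tee_pow_mulVec, tee_mulVec, cnot_mulVec, ha, hb, hc, hub, huc]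
  generalize hz : zeta ^ 7 = z at *
  cases p <;> cases q <;> cases s <;> simp <;>
  first
  | linear_combination (zeta * z + 1) * ψ (pt _ _ _) * h1
  | linear_combination ψ (pt _ _ _) * zeta_pow_four

/-- The controlled-controlled-NOT gate with target `c`. -/
def toffoli (a b c : Fin n) (hab : a ≠ b) (hac : a ≠ c) (hbc : b ≠ c) : Circuit n :=
  .had c :: (ccz a b c hab hac hbc ++ [.had c])

theorem toffoli_mulVec (a b c : Fin n) (hab : a ≠ b) (hac : a ≠ c) (hbc : b ≠ c)
    (ψ : Basis n → ℂ) (x : Basis n) : (Circuit.mat (toffoli a b c hab hac hbc) *ᵥ ψ) x =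
      ψ (update x c (xor (x c) (x a && x b))) := by
  have hr := rsqrt_sq
  simp only [toffoli, Circuit.mat_append_mulVec, Circuit.mat_cons_mulVec, Circuit.mat_nil_mulVec,
    had_mulVec, ccz_mulVec, Function.update_self, Function.update_idem,
    Function.update_of_ne hac, Function.update_of_ne hbc]
  generalize rsqrt = r at *
  cases ha : x a <;> cases hb : x b <;> cases hc : x c <;> simp <;>
  first
  | linear_combination 2 * ψ (update x c false) * hr
  | linear_combination 2 * ψ (update x c true) * hr

/-- The controlled version of a gate, on two more qubits: qubit `0` is the control, and qubit `1` is
an auxiliary qubit that is `0` before and after.  The gate `T` is applied to the conjunction of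
its qubit with the control, which is held by the auxiliary qubit; the controlled Hadamard gate is
a controlled-NOT conjugated with an operator that takes the eigenvectors of `X` to those of the
Hadamard gate. -/
def ctrlGate : Gate n → Circuit (n + 2)
  | .had q => List.replicate 6 (.tee q.succ.succ) ++ [.had q.succ.succ] ++
      List.replicate 7 (.tee q.succ.succ) ++ [.cnot 0 q.succ.succ (Fin.succ_ne_zero _).symm,
      .tee q.succ.succ, .had q.succ.succ, .tee q.succ.succ, .tee q.succ.succ]
  | .tee q =>
      toffoli 0 q.succ.succ 1 (Fin.succ_ne_zero _).symm (by simp)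
        (by simp [Fin.ext_iff]) ++ .tee 1 ::
      toffoli 0 q.succ.succ 1 (Fin.succ_ne_zero _).symm (by simp)
        (by simp [Fin.ext_iff])
  | .cnot c t h =>
      toffoli 0 c.succ.succ t.succ.succ (Fin.succ_ne_zero _).symm (Fin.succ_ne_zero _).symm
        (by simpa [Fin.ext_iff] using h)

/-- The controlled version of a circuit. -/
def ctrl (c : Circuit n) : Circuit (n + 2) := c.flatMap ctrlGate

/-- The state `|0⟩|0⟩ψ₀ + |1⟩|0⟩ψ₁`. -/
def branches (ψ₀ ψ₁ : Basis n → ℂ) (x : Basis (n + 2)) : ℂ :=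
  if x 1 then 0 else (if x 0 then ψ₁ else ψ₀) fun i => x i.succ.succ

theorem update_succ_succ (x : Basis (n + 2)) (q : Fin n) (b : Bool) :
    (fun i : Fin n => update x q.succ.succ b i.succ.succ) =
      update (fun i : Fin n => x i.succ.succ) q b := by
  funext i
  by_cases h : i = q
  · subst h; simp
  · rw [Function.update_of_ne h, Function.update_of_ne]
    simpa [Fin.ext_iff] using h

theorem ctrlGate_mulVec (g : Gate n) (ψ₀ ψ₁ : Basis n → ℂ) :
    Circuit.mat (ctrlGate g) *ᵥ branches ψ₀ ψ₁ = branches ψ₀ (g.mat *ᵥ ψ₁) := by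
  funext x
  have h0 : ∀ q : Fin n, (0 : Fin (n + 2)) ≠ q.succ.succ := fun q => (Fin.succ_ne_zero _).symm
  have h1 : ∀ q : Fin n, (1 : Fin (n + 2)) ≠ q.succ.succ := fun q => by simp [Fin.ext_iff]
  cases g with
  | had q =>
    have hr := rsqrt_sq
    have hz := two_mul_rsqrt
    have h4 := zeta_pow_four
    simp only [ctrlGate, Circuit.mat_append_mulVec, Circuit.mat_cons_mulVec,
      Circuit.mat_nil_mulVec, had_mulVec, tee_mulVec, tee_pow_mulVec, cnot_mulVec, branches,
      Function.update_self, Function.update_idem, Function.update_of_ne (h0 q),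
      Function.update_of_ne (h1 q), update_succ_succ]
    set y : Basis n := fun i => x i.succ.succ with hy
    have hyq : y q = x q.succ.succ := rfl
    have hu : ∀ s, y q = s → y = update y q s := fun s hs => by
      rw [← hs, Function.update_eq_self]
    by_cases hx1 : x 1
    · simp [hx1]
    have h8 : zeta ^ 8 = 1 := by linear_combination (zeta ^ 4 - 1) * h4
    cases hx0 : x 0 <;> cases hq : x q.succ.succ <;> rw [hq] at hyq <;>
      simp only [hx1, had_mulVec, hyq, Bool.false_eq_true, if_true, if_false, Bool.xor_true,
        Bool.xor_false, Bool.not_false, Bool.not_true, one_mul] <;>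
      generalize rsqrt = r at *
    · rw [hu _ hyq, Function.update_idem, Function.update_idem]
      generalize ψ₀ (update y q false) = A
      generalize ψ₀ (update y q true) = B
      linear_combination r ^ 2 * (A - zeta ^ 6 * B) * h8 + 2 * A * hr
    · rw [hu _ hyq, Function.update_idem, Function.update_idem]
      generalize ψ₀ (update y q false) = A
      generalize ψ₀ (update y q true) = B
      linear_combination (-zeta ^ 2 * r ^ 2 * (A - zeta ^ 6 * B) + 2 * r ^ 2 * B) * h8 + 2 * B * hr
    · generalize ψ₁ (update y q false) = A
      generalize ψ₁ (update y q true) = B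
      linear_combination r ^ 2 * (zeta ^ 3 * A - zeta * (zeta ^ 8 - zeta ^ 4 + 1) * B +
        zeta ^ 3 * B) * h4 - r ^ 2 * (A + B) * hz + 2 * r * (A + B) * hr
    · generalize ψ₁ (update y q false) = A
      generalize ψ₁ (update y q true) = B
      linear_combination r ^ 2 * (zeta * (zeta ^ 4 - 1) * A -
        zeta ^ 3 * (zeta ^ 8 - zeta ^ 4 + 1) * B - zeta * (zeta ^ 4 - 1) * B) * h4 -
        r ^ 2 * (A - B) * hz + 2 * r * (A - B) * hr
  | tee q =>
    simp only [ctrlGate, Circuit.mat_append_mulVec, Circuit.mat_cons_mulVec, toffoli_mulVec,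
      tee_mulVec, Function.update_self, Function.update_idem, ne_eq, zero_ne_one, not_false_eq_true,
      Function.update_of_ne, (h1 q).symm, Bool.xor_assoc, Bool.xor_self, Bool.xor_false,
      Function.update_eq_self, branches]
    by_cases hx1 : x 1
    · simp [hx1]
    · cases hx0 : x 0 <;> simp [hx1, tee_mulVec]
  | cnot c t h =>
    simp only [ctrlGate, toffoli_mulVec, branches, Function.update_of_ne (h0 t),
      Function.update_of_ne (h1 t), update_succ_succ]
    cases hx0 : x 0 <;> simp [cnot_mulVec]

theorem ctrl_mulVec (c : Circuit n) (ψ₀ ψ₁ : Basis n → ℂ) :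
    Circuit.mat (ctrl c) *ᵥ branches ψ₀ ψ₁ = branches ψ₀ (Circuit.mat c *ᵥ ψ₁) := by
  induction c generalizing ψ₁ with
  | nil => rw [ctrl, List.flatMap_nil, Circuit.mat_nil_mulVec, Circuit.mat_nil_mulVec]
  | cons g c ih =>
    rw [ctrl, List.flatMap_cons, Circuit.mat_append_mulVec, ctrlGate_mulVec, ← ctrl, ih,
      Circuit.mat_cons_mulVec]

/-! ### Interference of two states -/

theorem flipFirst_mulVec (ψ : Basis (n + 1) → ℂ) (x : Basis (n + 1)) :
    (Circuit.mat (flipFirst n) *ᵥ ψ) x = ψ (update x 0 (!x 0)) := by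
  have hr := rsqrt_sq
  have h4 := zeta_pow_four
  simp only [flipFirst, Circuit.mat_cons_mulVec, Circuit.mat_nil_mulVec, had_mulVec, tee_mulVec,
    Function.update_self, Function.update_idem, if_true, if_false, Bool.false_eq_true]
  generalize rsqrt = r at *
  cases hx : x 0 <;> simp only [Bool.not_false, Bool.not_true, if_true, if_false,
    Bool.false_eq_true, one_mul]
  · generalize ψ (update x 0 true) = B
    generalize ψ (update x 0 false) = A
    linear_combination r ^ 2 * (A - B) * h4 + 2 * B * hr
  · generalize ψ (update x 0 true) = B
    generalize ψ (update x 0 false) = A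
    linear_combination -r ^ 2 * (A - B) * h4 + 2 * A * hr

theorem flipFirst_branches (ψ₀ ψ₁ : Basis n → ℂ) :
    Circuit.mat (flipFirst (n + 1)) *ᵥ branches ψ₀ ψ₁ = branches ψ₁ ψ₀ := by
  funext x
  rw [flipFirst_mulVec]
  have h1 : (1 : Fin (n + 2)) ≠ 0 := by simp
  have h2 : (fun i : Fin n => update x 0 (!x 0) i.succ.succ) = fun i : Fin n => x i.succ.succ := by
    funext i; rw [Function.update_of_ne (Fin.succ_ne_zero _)]
  simp only [branches, Function.update_of_ne h1, Function.update_self, h2]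
  cases x 0 <;> rfl

theorem had_branches (ψ₀ ψ₁ : Basis n → ℂ) :
    (Gate.had (0 : Fin (n + 2))).mat *ᵥ branches ψ₀ ψ₁ =
      branches (rsqrt • (ψ₀ + ψ₁)) (rsqrt • (ψ₀ - ψ₁)) := by
  funext x
  rw [had_mulVec]
  have h1 : (1 : Fin (n + 2)) ≠ 0 := by simp
  have h2 : ∀ b, (fun i : Fin n => update x 0 b i.succ.succ) = fun i : Fin n => x i.succ.succ := by
    intro b; funext i; rw [Function.update_of_ne (Fin.succ_ne_zero _)]
  simp only [branches, Function.update_of_ne h1, Function.update_self, h2]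
  by_cases hx1 : x 1
  · simp [hx1]
  · cases hx0 : x 0 <;> simp [hx1, sub_eq_add_neg]

theorem tee_branches (ψ₀ ψ₁ : Basis n → ℂ) (k : ℕ) :
    Circuit.mat (List.replicate k (.tee (0 : Fin (n + 2)))) *ᵥ branches ψ₀ ψ₁ =
      branches ψ₀ (zeta ^ k • ψ₁) := by
  funext x
  rw [tee_pow_mulVec]
  simp only [branches]
  by_cases hx1 : x 1
  · simp [hx1]
  · cases hx0 : x 0 <;> simp [hx1]

/-- The Hadamard test: the outcome of the first qubit estimates the real part of the inner product
of the states that `V` and `W` prepare or, if `im` is set, of that product multiplied by `i`. -/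
def hadamardTest (V W : Circuit n) (im : Bool) : Circuit (n + 2) :=
  .had 0 :: (ctrl V ++ flipFirst (n + 1) ++ ctrl W ++
    List.replicate (if im then 2 else 0) (.tee 0) ++ [.had 0])

theorem hadamardTest_state (V W : Circuit n) (im : Bool) :
    Circuit.state (hadamardTest V W im) =
      let ω : ℂ := if im then Complex.I else 1
      branches ((1 / 2 : ℂ) • (Circuit.state V + ω • Circuit.state W))
        ((1 / 2 : ℂ) • (Circuit.state V - ω • Circuit.state W)) := by
  have h0 : (Pi.single (zeroBasis (n + 2)) 1 : Basis (n + 2) → ℂ) =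
      branches (Pi.single (zeroBasis n) 1) 0 := by
    funext x
    simp only [branches, Pi.single_apply]
    by_cases hx1 : x 1
    · rw [if_pos hx1, if_neg]
      rintro rfl
      simp [zeroBasis] at hx1
    · by_cases hx0 : x 0
      · rw [if_neg, if_neg hx1, if_pos hx0]
        · rfl
        · rintro rfl
          simp [zeroBasis] at hx0
      · rw [if_neg hx1, if_neg hx0]
        simp only [Pi.single_apply]
        congr 1
        refine propext ⟨fun h => by rw [h]; rfl, fun h => ?_⟩
        funext i
        refine Fin.cases ?_ (fun i => Fin.cases ?_ (fun i => ?_) i) i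
        · simpa [zeroBasis] using hx0
        · simpa [zeroBasis] using hx1
        · exact congrFun h i
  have hω : zeta ^ (if im then 2 else 0 : ℕ) = if im then Complex.I else 1 := by
    split_ifs
    · exact zeta_sq
    · simp
  rw [Circuit.state, hadamardTest]
  simp only [Circuit.mat_append_mulVec, Circuit.mat_cons_mulVec, Circuit.mat_nil_mulVec]
  rw [h0, had_branches, ctrl_mulVec, flipFirst_branches, ctrl_mulVec, tee_branches, had_branches,
    hω]
  simp only [add_zero, sub_zero, Matrix.mulVec_smul]
  change branches (rsqrt • (rsqrt • Circuit.state V + _ • rsqrt • Circuit.state W))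
    (rsqrt • (rsqrt • Circuit.state V - _ • rsqrt • Circuit.state W)) = _
  congr 1
  · rw [smul_comm _ rsqrt, ← smul_add, smul_smul, ← sq, rsqrt_sq]
  · rw [smul_comm _ rsqrt, ← smul_sub, smul_smul, ← sq, rsqrt_sq]

theorem sum_basis_succ (f : Basis (n + 1) → ℝ) :
    ∑ x, f x = ∑ y : Basis n, f (Fin.cons false y) + ∑ y : Basis n, f (Fin.cons true y) := by
  rw [← Equiv.sum_comp (Fin.consEquiv fun _ : Fin (n + 1) => Bool), Fintype.sum_prod_type,
    Fintype.sum_bool, add_comm]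
  rfl

/-- The expected outcome of the Hadamard test, with values `1` and `-1`. -/
theorem hadamardTest_mean (V W : Circuit n) (im : Bool) :
    ∑ z, ‖Circuit.state (hadamardTest V W im) z‖ ^ 2 * (if z 0 then -1 else 1) =
      ((if im then Complex.I else 1) * (star (Circuit.state V) ⬝ᵥ Circuit.state W)).re := by
  have hb : ∀ (ψ₀ ψ₁ : Basis n → ℂ), ∑ z, ‖branches ψ₀ ψ₁ z‖ ^ 2 * (if z 0 then -1 else 1) =
      ∑ y, (‖ψ₀ y‖ ^ 2 - ‖ψ₁ y‖ ^ 2) := by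
    intro ψ₀ ψ₁
    have h1 : ∀ (b c : Bool) (y : Basis n),
        (Fin.cons b (Fin.cons c y : Basis (n + 1)) : Basis (n + 2)) 1 = c := fun b c y => rfl
    have h2 : ∀ (b c : Bool) (y : Basis n), (fun i : Fin n =>
        (Fin.cons b (Fin.cons c y : Basis (n + 1)) : Basis (n + 2)) i.succ.succ) = y :=
      fun b c y => rfl
    rw [sum_basis_succ, sum_basis_succ, sum_basis_succ]
    simp only [branches, h1, h2, Fin.cons_zero]
    rw [Finset.sum_sub_distrib]
    simp [sub_eq_add_neg]
  rw [hadamardTest_state]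
  dsimp only
  rw [hb, dotProduct, Finset.mul_sum, Complex.re_sum]
  refine Finset.sum_congr rfl fun y _ => ?_
  generalize hω : (if im = true then Complex.I else 1 : ℂ) = ω
  have hω' : ω = 1 ∨ ω = Complex.I := by rw [← hω]; split_ifs <;> simp
  simp only [Pi.smul_apply, Pi.add_apply, Pi.sub_apply, smul_eq_mul, Pi.star_apply,
    ← Complex.normSq_eq_norm_sq, Complex.normSq_apply]
  generalize Circuit.state V y = a
  generalize Circuit.state W y = b
  rcases hω' with rfl | rfl <;> simp <;> ring

end Action

/-! ### Independent runs of circuits -/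

/-- The expected value of a function of the outcomes, when each circuit of the list is run once. -/
noncomputable def runExp : List AnyCircuit → (List (List Bool) → ℝ) → ℝ
  | [], F => F []
  | C :: Cs, F => ∑ z : Basis C.n,
      ‖Circuit.state C.circ z‖ ^ 2 * runExp Cs fun zs => F (List.ofFn z :: zs)

open Classical in
theorem runProb_eq_runExp (Cs : List AnyCircuit) (S : List (List Bool) → Prop) :
    runProb Cs S = runExp Cs fun zs => if S zs then 1 else 0 := by
  induction Cs generalizing S with
  | nil => rfl
  | cons C Cs ih => simp only [runProb, runExp, ih]

theorem runExp_mono (Cs : List AnyCircuit) {F G : List (List Bool) → ℝ} (h : ∀ zs, F zs ≤ G zs) :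
    runExp Cs F ≤ runExp Cs G := by
  induction Cs generalizing F G with
  | nil => exact h _
  | cons C Cs ih =>
    exact Finset.sum_le_sum fun z _ => mul_le_mul_of_nonneg_left (ih fun zs => h _) (by positivity)

theorem runExp_add (Cs : List AnyCircuit) (F G : List (List Bool) → ℝ) :
    (runExp Cs fun zs => F zs + G zs) = runExp Cs F + runExp Cs G := by
  induction Cs generalizing F G with
  | nil => rfl
  | cons C Cs ih => simp only [runExp, ih, mul_add, Finset.sum_add_distrib]

theorem runExp_const_mul (Cs : List AnyCircuit) (c : ℝ) (F : List (List Bool) → ℝ) :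
    (runExp Cs fun zs => c * F zs) = c * runExp Cs F := by
  induction Cs generalizing F with
  | nil => rfl
  | cons C Cs ih => simp only [runExp, ih, Finset.mul_sum, mul_left_comm]

theorem runExp_const (Cs : List AnyCircuit) (c : ℝ) : (runExp Cs fun _ => c) = c := by
  induction Cs with
  | nil => rfl
  | cons C Cs ih =>
    simp only [runExp, ih, ← Finset.sum_mul]
    have h : ∑ z, ‖Circuit.state C.circ z‖ ^ 2 = 1 := Circuit.normSq_state C.circ
    rw [h, one_mul]

theorem runExp_sum {ι : Type} (s : Finset ι) (Cs : List AnyCircuit)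
    (F : ι → List (List Bool) → ℝ) :
    (runExp Cs fun zs => ∑ i ∈ s, F i zs) = ∑ i ∈ s, runExp Cs (F i) := by
  classical
  induction s using Finset.induction_on with
  | empty => simpa using runExp_const Cs 0
  | insert i s hi ih => simp only [Finset.sum_insert hi, runExp_add, ih]

section Statistic

variable {β : Type} (h : β → List Bool → ℝ)

/-- The sum of the values `h b z`, for labelled circuits and their outcomes. -/
def statistic (ts : List (β × AnyCircuit)) (zs : List (List Bool)) : ℝ :=
  ((zipPad (ts.map Prod.fst) zs).map fun p => h p.1 p.2).sum

/-- The expected value of `h b z`, for the outcome `z` of one labelled circuit. -/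
noncomputable def testMean (t : β × AnyCircuit) : ℝ :=
  ∑ z, ‖Circuit.state t.2.circ z‖ ^ 2 * h t.1 (List.ofFn z)

theorem statistic_cons (t : β × AnyCircuit) (ts : List (β × AnyCircuit)) (z : List Bool)
    (zs : List (List Bool)) :
    statistic h (t :: ts) (z :: zs) = h t.1 z + statistic h ts zs := by
  simp [statistic, zipPad]

theorem runExp_statistic (ts : List (β × AnyCircuit)) :
    runExp (ts.map Prod.snd) (statistic h ts) = (ts.map (testMean h)).sum := by
  induction ts with
  | nil => simp [runExp, statistic, zipPad]
  | cons t ts ih =>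
    have h1 : ∑ z, ‖Circuit.state t.2.circ z‖ ^ 2 = 1 := Circuit.normSq_state t.2.circ
    simp only [List.map_cons, runExp, statistic_cons, runExp_add, runExp_const, ih, List.sum_cons,
      mul_add, Finset.sum_add_distrib, ← Finset.sum_mul, h1, one_mul]
    rfl

/-- The variance of a sum of independent outcomes is at most the sum of the second moments. -/
theorem runExp_statistic_sub_sq_le (ts : List (β × AnyCircuit)) :
    (runExp (ts.map Prod.snd) fun zs => (statistic h ts zs - (ts.map (testMean h)).sum) ^ 2) ≤
      (ts.map fun t => testMean (fun b z => h b z ^ 2) t).sum := by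
  induction ts with
  | nil => simp [runExp, statistic, zipPad]
  | cons t ts ih =>
    set m := testMean h t with hm
    set μ := (ts.map (testMean h)).sum with hμ
    have h1 : ∑ z, ‖Circuit.state t.2.circ z‖ ^ 2 = 1 := Circuit.normSq_state t.2.circ
    have hmean : (runExp (ts.map Prod.snd) fun zs => statistic h ts zs - μ) = 0 := by
      simp only [sub_eq_add_neg]
      rw [runExp_add, runExp_const, runExp_statistic, add_neg_cancel]
    have hexp : ∀ z : Basis t.2.n, (runExp (ts.map Prod.snd) fun zs =>
        (statistic h (t :: ts) (List.ofFn z :: zs) - ((t :: ts).map (testMean h)).sum) ^ 2) =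
        (h t.1 (List.ofFn z) - m) ^ 2 +
          runExp (ts.map Prod.snd) fun zs => (statistic h ts zs - μ) ^ 2 := by
      intro z
      have : ∀ zs, (statistic h (t :: ts) (List.ofFn z :: zs) -
          ((t :: ts).map (testMean h)).sum) ^ 2 = ((h t.1 (List.ofFn z) - m) ^ 2 +
          2 * (h t.1 (List.ofFn z) - m) * (statistic h ts zs - μ)) +
          (statistic h ts zs - μ) ^ 2 := by
        intro zs
        rw [statistic_cons, List.map_cons, List.sum_cons, ← hm, ← hμ]
        ring
      simp only [this]
      rw [runExp_add, runExp_add, runExp_const, runExp_const_mul, hmean, mul_zero, add_zero]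
    have hvar : ∑ z, ‖Circuit.state t.2.circ z‖ ^ 2 * (h t.1 (List.ofFn z) - m) ^ 2 =
        testMean (fun b z => h b z ^ 2) t - m ^ 2 := by
      have : ∀ z, ‖Circuit.state t.2.circ z‖ ^ 2 * (h t.1 (List.ofFn z) - m) ^ 2 =
          ‖Circuit.state t.2.circ z‖ ^ 2 * h t.1 (List.ofFn z) ^ 2 -
          2 * m * (‖Circuit.state t.2.circ z‖ ^ 2 * h t.1 (List.ofFn z)) +
          ‖Circuit.state t.2.circ z‖ ^ 2 * m ^ 2 := fun z => by ring
      simp only [this, Finset.sum_add_distrib, Finset.sum_sub_distrib, ← Finset.mul_sum,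
        ← Finset.sum_mul, h1]
      rw [show ∑ z, ‖Circuit.state t.2.circ z‖ ^ 2 * h t.1 (List.ofFn z) = m from rfl]
      rw [testMean]
      ring
    rw [List.map_cons, runExp]
    simp only [hexp, mul_add, Finset.sum_add_distrib, ← Finset.sum_mul, h1, one_mul, hvar]
    rw [List.map_cons, List.sum_cons]
    have := sq_nonneg m
    linarith

/-- Chebyshev's inequality for several statistics at once: outcomes for which all of them are close
to their expected values have property `S`. -/
theorem one_sub_le_runProb {ι : Type} [Fintype ι] (h : ι → β → List Bool → ℝ)
    (ts : List (β × AnyCircuit)) {η v : ℝ} (hη : 0 < η)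
    (hv : ∀ i, (ts.map fun t => testMean (fun b z => h i b z ^ 2) t).sum ≤ v)
    (S : List (List Bool) → Prop)
    (hS : ∀ zs, (∀ i, |statistic (h i) ts zs - (ts.map (testMean (h i))).sum| ≤ η) → S zs) :
    1 - Fintype.card ι * v / η ^ 2 ≤ runProb (ts.map Prod.snd) S := by
  classical
  rw [runProb_eq_runExp]
  let X : ι → List (List Bool) → ℝ := fun i zs =>
    (statistic (h i) ts zs - (ts.map (testMean (h i))).sum) ^ 2
  have h1 : ∀ zs, 1 + (-1 / η ^ 2) * ∑ i, X i zs ≤ if S zs then 1 else 0 := by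
    intro zs
    have hX : ∀ i, 0 ≤ X i zs := fun i => sq_nonneg _
    by_cases hs : S zs
    · rw [if_pos hs]
      have : 0 ≤ (1 / η ^ 2) * ∑ i, X i zs :=
        mul_nonneg (by positivity) (Finset.sum_nonneg fun i _ => hX i)
      rw [neg_div, neg_mul]
      linarith
    · rw [if_neg hs]
      obtain ⟨i, hi⟩ : ∃ i, η < |statistic (h i) ts zs - (ts.map (testMean (h i))).sum| := by
        by_contra! hcon
        exact hs (hS zs hcon)
      have h2 : η ^ 2 ≤ X i zs := by
        have := pow_le_pow_left₀ hη.le hi.le 2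
        rwa [sq_abs] at this
      have h3 : η ^ 2 ≤ ∑ i, X i zs :=
        h2.trans (Finset.single_le_sum (fun i _ => hX i) (Finset.mem_univ i))
      rw [neg_div, neg_mul, one_div, inv_mul_eq_div]
      have := (one_le_div (by positivity)).2 h3
      linarith
  refine le_trans ?_ (runExp_mono _ h1)
  rw [runExp_add, runExp_const, runExp_const_mul, runExp_sum]
  have h2 : ∑ i, runExp (ts.map Prod.snd) (X i) ≤ Fintype.card ι * v := by
    rw [← nsmul_eq_mul, ← Finset.card_univ, ← Finset.sum_const]
    exact Finset.sum_le_sum fun i _ => (runExp_statistic_sub_sq_le (h i) ts).trans (hv i)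
  rw [neg_div, neg_mul, one_div, inv_mul_eq_div]
  have := div_le_div_of_nonneg_right h2 (sq_nonneg η)
  linarith

end Statistic

/-! ### Least squares with perturbed data -/

open ComplexConjugate

/-- The Hermitian form with the matrix entries `g₁₁`, `g₂₂`, `g₁₂` and `conj g₁₂`. -/
noncomputable def hermForm (g₁₁ g₂₂ : ℝ) (g₁₂ x y : ℂ) : ℝ :=
  g₁₁ * ‖x‖ ^ 2 + g₂₂ * ‖y‖ ^ 2 + 2 * (conj x * y * g₁₂).re

/-- The linear part of the loss. -/
noncomputable def linForm (v₁ v₂ x y : ℂ) : ℝ := 2 * (conj x * v₁).re + 2 * (conj y * v₂).re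

theorem norm_sq_eq_hermForm {E : Type} [NormedAddCommGroup E] [InnerProductSpace ℂ E]
    (w₁ w₂ b : E) (x y : ℂ) : ‖x • w₁ + y • w₂ - b‖ ^ 2 =
      hermForm (‖w₁‖ ^ 2) (‖w₂‖ ^ 2) (inner ℂ w₁ w₂) x y -
        linForm (inner ℂ w₁ b) (inner ℂ w₂ b) x y + ‖b‖ ^ 2 := by
  rw [norm_sub_sq (𝕜 := ℂ), norm_add_sq (𝕜 := ℂ), inner_add_left, inner_smul_left, inner_smul_left,
    inner_smul_left, inner_smul_right, norm_smul, norm_smul, hermForm, linForm, map_add]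
  simp only [RCLike.re_to_complex]
  rw [mul_assoc]
  ring

theorem abs_hermForm_le {g₁₁ g₂₂ δ : ℝ} {g₁₂ : ℂ} (h₁₁ : |g₁₁| ≤ δ) (h₂₂ : |g₂₂| ≤ δ)
    (h₁₂ : ‖g₁₂‖ ≤ δ) (x y : ℂ) :
    |hermForm g₁₁ g₂₂ g₁₂ x y| ≤ 2 * δ * (‖x‖ ^ 2 + ‖y‖ ^ 2) := by
  have h1 : |(conj x * y * g₁₂).re| ≤ ‖x‖ * ‖y‖ * δ := by
    refine (Complex.abs_re_le_norm _).trans ?_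
    rw [norm_mul, norm_mul, RCLike.norm_conj]
    gcongr
  have h2 : |g₁₁ * ‖x‖ ^ 2| ≤ δ * ‖x‖ ^ 2 := by
    rw [abs_mul, abs_of_nonneg (sq_nonneg ‖x‖)]; gcongr
  have h3 : |g₂₂ * ‖y‖ ^ 2| ≤ δ * ‖y‖ ^ 2 := by
    rw [abs_mul, abs_of_nonneg (sq_nonneg ‖y‖)]; gcongr
  have hδ : 0 ≤ δ := (abs_nonneg _).trans h₁₁
  have h4 := mul_nonneg hδ (sq_nonneg (‖x‖ - ‖y‖))
  rw [abs_le] at *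
  constructor <;> simp only [hermForm] <;> nlinarith

theorem abs_linForm_le {δ : ℝ} {v₁ v₂ : ℂ} (h₁ : ‖v₁‖ ≤ δ) (h₂ : ‖v₂‖ ≤ δ) (x y : ℂ) :
    |linForm v₁ v₂ x y| ≤ δ * (2 + ‖x‖ ^ 2 + ‖y‖ ^ 2) := by
  have key : ∀ (z v : ℂ), ‖v‖ ≤ δ → |(conj z * v).re| ≤ ‖z‖ * δ := fun z v hv => by
    refine (Complex.abs_re_le_norm _).trans ?_
    rw [norm_mul, RCLike.norm_conj]
    gcongr
  have h3 := key x v₁ h₁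
  have h4 := key y v₂ h₂
  have hδ : 0 ≤ δ := (norm_nonneg _).trans h₁
  have h5 := mul_nonneg hδ (sq_nonneg (‖x‖ - 1))
  have h6 := mul_nonneg hδ (sq_nonneg (‖y‖ - 1))
  rw [abs_le] at *
  constructor <;> simp only [linForm] <;> nlinarith

/-- The solution of the normal equations minimizes the quadratic function: the difference is the
Hermitian form at the difference of the arguments. -/
theorem hermForm_sub_linForm_eq {h₁₁ h₂₂ : ℝ} {h₁₂ y₁ y₂ a₁ a₂ : ℂ}
    (e₁ : h₁₁ * a₁ + h₁₂ * a₂ = y₁) (e₂ : conj h₁₂ * a₁ + h₂₂ * a₂ = y₂) (x y : ℂ) :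
    hermForm h₁₁ h₂₂ h₁₂ x y - linForm y₁ y₂ x y =
      hermForm h₁₁ h₂₂ h₁₂ a₁ a₂ - linForm y₁ y₂ a₁ a₂ +
        hermForm h₁₁ h₂₂ h₁₂ (x - a₁) (y - a₂) := by
  subst e₁ e₂
  simp only [hermForm, linForm, ← Complex.normSq_eq_norm_sq, Complex.normSq_apply]
  simp
  ring

theorem normal_equations {h₁₁ h₂₂ d : ℝ} {h₁₂ : ℂ} (hd : d = h₁₁ * h₂₂ - ‖h₁₂‖ ^ 2) (hd0 : d ≠ 0)
    (y₁ y₂ : ℂ) :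
    h₁₁ * ((h₂₂ * y₁ - h₁₂ * y₂) / d) + h₁₂ * ((h₁₁ * y₂ - conj h₁₂ * y₁) / d) = y₁ ∧
    conj h₁₂ * ((h₂₂ * y₁ - h₁₂ * y₂) / d) + h₂₂ * ((h₁₁ * y₂ - conj h₁₂ * y₁) / d) = y₂ := by
  have hdc : (d : ℂ) = h₁₁ * h₂₂ - h₁₂ * conj h₁₂ := by
    rw [Complex.mul_conj, Complex.normSq_eq_norm_sq, hd]
    push_cast
    ring
  have hd0' : (d : ℂ) ≠ 0 := by exact_mod_cast hd0
  constructor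
  · rw [← mul_div_assoc, ← mul_div_assoc, ← add_div, div_eq_iff hd0']
    linear_combination -y₁ * hdc
  · rw [← mul_div_assoc, ← mul_div_assoc, ← add_div, div_eq_iff hd0']
    linear_combination -y₂ * hdc

/-- If the Gram matrix and the right-hand side of a least squares problem are known up to `δ`, then
adding `3δ` to the diagonal makes the matrix definite, and the solution of the modified normal
equations is nearly optimal, however badly conditioned the problem is. -/
theorem regularized_least_squares {E : Type} [NormedAddCommGroup E] [InnerProductSpace ℂ E]
    {w₁ w₂ b : E} {δ M h₁₁ h₂₂ : ℝ} {h₁₂ y₁ y₂ : ℂ} (hδ : 0 < δ)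
    (e₁₁ : |h₁₁ - ‖w₁‖ ^ 2 - 3 * δ| ≤ δ) (e₂₂ : |h₂₂ - ‖w₂‖ ^ 2 - 3 * δ| ≤ δ)
    (e₁₂ : ‖h₁₂ - inner ℂ w₁ w₂‖ ≤ δ) (e₁ : ‖y₁ - inner ℂ w₁ b‖ ≤ δ)
    (e₂ : ‖y₂ - inner ℂ w₂ b‖ ≤ δ) {d : ℝ} (hd : d = h₁₁ * h₂₂ - ‖h₁₂‖ ^ 2) :
    0 < d ∧ ∀ x y : ℂ, ‖x‖ ≤ M → ‖y‖ ≤ M →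
      ‖((h₂₂ * y₁ - h₁₂ * y₂) / d) • w₁ + ((h₁₁ * y₂ - conj h₁₂ * y₁) / d) • w₂ - b‖ ^ 2 ≤
        ‖x • w₁ + y • w₂ - b‖ ^ 2 + 16 * (M + 1) ^ 2 * δ := by
  have hq : ∀ x y : ℂ, |hermForm h₁₁ h₂₂ h₁₂ x y - 3 * δ * (‖x‖ ^ 2 + ‖y‖ ^ 2) -
      hermForm (‖w₁‖ ^ 2) (‖w₂‖ ^ 2) (inner ℂ w₁ w₂) x y| ≤ 2 * δ * (‖x‖ ^ 2 + ‖y‖ ^ 2) := by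
    intro x y
    have := abs_hermForm_le e₁₁ e₂₂ e₁₂ x y
    convert this using 2
    simp only [hermForm, mul_sub, Complex.sub_re]
    ring
  have hl : ∀ x y : ℂ, |linForm y₁ y₂ x y - linForm (inner ℂ w₁ b) (inner ℂ w₂ b) x y| ≤
      δ * (2 + ‖x‖ ^ 2 + ‖y‖ ^ 2) := by
    intro x y
    have := abs_linForm_le e₁ e₂ x y
    convert this using 2
    simp only [linForm, mul_sub, Complex.sub_re]
    ring
  have hpos : ∀ x y : ℂ, δ * (‖x‖ ^ 2 + ‖y‖ ^ 2) ≤ hermForm h₁₁ h₂₂ h₁₂ x y := by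
    intro x y
    have h1 := (abs_le.1 (hq x y)).1
    have h2 := norm_sq_eq_hermForm w₁ w₂ 0 x y
    simp only [sub_zero, inner_zero_right, norm_zero, linForm, mul_zero, Complex.zero_re, add_zero,
      ne_eq, OfNat.ofNat_ne_zero, not_false_eq_true, zero_pow] at h2
    have h3 := sq_nonneg ‖x • w₁ + y • w₂‖
    linarith
  have hd0 : 0 < d := by
    have h1 := hpos 1 0
    simp only [hermForm, norm_one, norm_zero, mul_zero, zero_mul, Complex.zero_re] at h1
    have h11 : 0 < h₁₁ := by nlinarith
    have h2 := hpos (-h₁₂) h₁₁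
    have h3 : hermForm h₁₁ h₂₂ h₁₂ (-h₁₂) h₁₁ = h₁₁ * d := by
      have h4 : (conj (-h₁₂) * h₁₁ * h₁₂).re = -(h₁₁ * ‖h₁₂‖ ^ 2) := by
        rw [← Complex.normSq_eq_norm_sq, Complex.normSq_apply]
        simp
        ring
      rw [hermForm, h4, hd, norm_neg, Complex.norm_real, Real.norm_eq_abs, sq_abs]
      ring
    rw [h3, Complex.norm_real, Real.norm_eq_abs, sq_abs, norm_neg] at h2
    have h5 : 0 < δ * (‖h₁₂‖ ^ 2 + h₁₁ ^ 2) := by positivity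
    exact (mul_pos_iff_of_pos_left h11).1 (h5.trans_le h2)
  refine ⟨hd0, fun x y hx hy => ?_⟩
  obtain ⟨n₁, n₂⟩ := normal_equations hd hd0.ne' y₁ y₂
  generalize (h₂₂ * y₁ - h₁₂ * y₂) / (d : ℂ) = a₁ at *
  generalize (h₁₁ * y₂ - conj h₁₂ * y₁) / (d : ℂ) = a₂ at *
  have hmin := hermForm_sub_linForm_eq n₁ n₂ x y
  have h1 := hpos (x - a₁) (y - a₂)
  have h2 : 0 ≤ δ * (‖x - a₁‖ ^ 2 + ‖y - a₂‖ ^ 2) := by positivity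
  have h3 := (abs_le.1 (hq a₁ a₂)).1
  have h4 := (abs_le.1 (hl a₁ a₂)).2
  have h5 := (abs_le.1 (hq x y)).2
  have h6 := (abs_le.1 (hl x y)).1
  rw [norm_sq_eq_hermForm, norm_sq_eq_hermForm]
  have hM : 0 ≤ M := (norm_nonneg _).trans hx
  have h7 : ‖x‖ ^ 2 ≤ M ^ 2 := by gcongr
  have h8 : ‖y‖ ^ 2 ≤ M ^ 2 := by gcongr
  have h9 := mul_le_mul_of_nonneg_left h7 hδ.le
  have h10 := mul_le_mul_of_nonneg_left h8 hδ.le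
  have h11 : 0 ≤ δ * M := by positivity
  have h12 : 0 ≤ δ * M ^ 2 := by positivity
  nlinarith

/-! ### Approximation of the matrix by a uniform sum of circuits -/

section Approximation

variable {n : ℕ}

/-- The state prepared by a circuit, as an element of the Hilbert space. -/
noncomputable def ket (c : Circuit n) : EuclideanSpace ℂ (Basis n) :=
  WithLp.toLp 2 (Circuit.state c)

theorem norm_toLp_sq (ψ : Basis n → ℂ) :
    ‖(WithLp.toLp 2 ψ : EuclideanSpace ℂ (Basis n))‖ ^ 2 = normSq ψ := by
  rw [EuclideanSpace.norm_sq_eq]; rfl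

theorem norm_ket (c : Circuit n) : ‖ket c‖ = 1 := by
  have h : ‖ket c‖ ^ 2 = 1 := by rw [ket, norm_toLp_sq, Circuit.normSq_state]
  exact (pow_eq_one_iff_of_nonneg (norm_nonneg _) two_ne_zero).1 h

theorem inner_ket (c d : Circuit n) :
    inner ℂ (ket c) (ket d) = star (Circuit.state c) ⬝ᵥ Circuit.state d := by
  rw [ket, ket, EuclideanSpace.inner_toLp_toLp, dotProduct_comm]

theorem ket_append (u c : Circuit n) :
    ket (u ++ c) = WithLp.toLp 2 (Circuit.mat c *ᵥ Circuit.state u) := by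
  rw [ket, Circuit.state, Circuit.mat_append_mulVec, Circuit.state]

/-- The sum of the states that the circuits of a list prepare. -/
noncomputable def ketSum (l : List (Circuit n)) : EuclideanSpace ℂ (Basis n) := (l.map ket).sum

theorem ketSum_append (l l' : List (Circuit n)) : ketSum (l ++ l') = ketSum l + ketSum l' := by
  simp [ketSum]

theorem ketSum_replicate (k : ℕ) (c : Circuit n) :
    ketSum (List.replicate k c) = (k : ℂ) • ket c := by
  rw [ketSum, List.map_replicate, List.sum_replicate, Nat.cast_smul_eq_nsmul]

theorem norm_ketSum_le (l : List (Circuit n)) : ‖ketSum l‖ ≤ l.length := by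
  induction l with
  | nil => simp [ketSum]
  | cons c l ih =>
    have h : ketSum (c :: l) = ket c + ketSum l := by simp [ketSum]
    rw [h]
    refine (norm_add_le _ _).trans ?_
    rw [norm_ket, List.length_cons]
    push_cast
    linarith

/-- The integer part of `D q`, capped at `D M`. -/
def copies (D M : ℕ) (q : Frac) : ℕ :=
  (List.range (D * M)).countP fun c => decide ((c + 1) * (q.den : ℕ) ≤ D * q.num.natAbs)

theorem copies_eq (D M : ℕ) (q : Frac) :
    copies D M q = min (D * M) (D * q.num.natAbs / (q.den : ℕ)) := by
  unfold copies
  generalize D * M = N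
  have hden : 0 < (q.den : ℕ) := q.den.pos
  induction N with
  | zero => simp
  | succ N ih =>
    rw [List.range_succ, List.countP_append, ih, List.countP_singleton]
    simp only [← Nat.le_div_iff_mul_le hden, decide_eq_true_eq]
    split_ifs <;> omega

theorem copies_bounds {D M : ℕ} {q : Frac} (hq : 0 < q.val) (hM : q.val ≤ M) :
    (copies D M q : ℝ) ≤ D * q.val ∧ D * q.val ≤ copies D M q + 1 := by
  have hden : 0 < (q.den : ℕ) := q.den.pos
  have hdenR : (0 : ℝ) < ((q.den : ℕ) : ℝ) := by exact_mod_cast hden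
  have hnum : 0 < q.num := by
    rw [Frac.val, div_pos_iff_of_pos_right hdenR] at hq
    exact_mod_cast hq
  obtain ⟨k, hk⟩ := Int.eq_ofNat_of_zero_le hnum.le
  have hv : q.val = (k : ℝ) / ((q.den : ℕ) : ℝ) := by rw [Frac.val, hk]; norm_num
  have hab : q.num.natAbs = k := by omega
  rw [hv, div_le_iff₀ hdenR] at hM
  have hM' : k ≤ M * (q.den : ℕ) := by exact_mod_cast hM
  have hle : D * k / (q.den : ℕ) ≤ D * M := by
    rw [Nat.div_le_iff_le_mul_add_pred hden]
    have := Nat.mul_le_mul_left D hM'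
    nlinarith
  have hc : copies D M q = D * k / (q.den : ℕ) := by rw [copies_eq, hab, min_eq_right hle]
  rw [hc, hv, ← mul_div_assoc, div_le_iff₀ hdenR, le_div_iff₀ hdenR]
  constructor
  · exact_mod_cast Nat.div_mul_le_self _ _
  · exact_mod_cast (Nat.lt_div_mul_add hden).le.trans (by rw [add_mul, one_mul])

/-- Each circuit of a linear combination, repeated in proportion to its coefficient. -/
def unitTerms (D M : ℕ) (ts : List (Frac × Circuit n)) : List (Circuit n) :=
  ts.flatMap fun t => List.replicate (copies D M t.1) t.2

variable {D M : ℕ} {ts : List (Frac × Circuit n)}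

theorem length_unitTerms_le (h : ∀ t ∈ ts, 0 < t.1.val ∧ t.1.val ≤ M) :
    ((unitTerms D M ts).length : ℝ) ≤ D * (ts.map fun t => t.1.val).sum := by
  induction ts with
  | nil => simp [unitTerms]
  | cons t ts ih =>
    have h1 := copies_bounds (D := D) (h t List.mem_cons_self).1 (h t List.mem_cons_self).2
    have h2 := ih fun t ht => h t (List.mem_cons_of_mem _ ht)
    rw [unitTerms, List.flatMap_cons, List.length_append, List.length_replicate, List.map_cons,
      List.sum_cons]
    rw [unitTerms] at h2
    push_cast
    linarith [h1.1]

theorem norm_mulVec_sum_sub_le (hD : 0 < D) (h : ∀ t ∈ ts, 0 < t.1.val ∧ t.1.val ≤ M)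
    (u : Circuit n) :
    ‖WithLp.toLp 2 ((ts.map fun t => (t.1.val : ℂ) • Circuit.mat t.2).sum *ᵥ Circuit.state u) -
      (D : ℂ)⁻¹ • ketSum ((unitTerms D M ts).map (u ++ ·))‖ ≤ ts.length / D := by
  induction ts with
  | nil => simp [unitTerms, ketSum]
  | cons t ts ih =>
    have h1 := copies_bounds (D := D) (h t List.mem_cons_self).1 (h t List.mem_cons_self).2
    have h2 := ih fun t ht => h t (List.mem_cons_of_mem _ ht)
    have hD' : (0 : ℝ) < D := by exact_mod_cast hD
    rw [unitTerms, List.flatMap_cons, List.map_append, ketSum_append, List.map_replicate,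
      ketSum_replicate, List.map_cons, List.sum_cons, Matrix.add_mulVec, Matrix.smul_mulVec,
      WithLp.toLp_add, WithLp.toLp_smul, ← ket_append, smul_add, smul_smul, add_sub_add_comm,
      ← sub_smul]
    refine (norm_add_le _ _).trans ?_
    rw [norm_smul, norm_ket, mul_one]
    have h3 : ‖(t.1.val : ℂ) - (D : ℂ)⁻¹ * (copies D M t.1 : ℂ)‖ ≤ 1 / D := by
      have : (t.1.val : ℂ) - (D : ℂ)⁻¹ * (copies D M t.1 : ℂ) =
          ((t.1.val - copies D M t.1 / D : ℝ) : ℂ) := by push_cast; ring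
      rw [this, Complex.norm_real, Real.norm_eq_abs, abs_le]
      have e1 : (copies D M t.1 : ℝ) / D ≤ t.1.val := (div_le_iff₀' hD').2 h1.1
      have e2 : t.1.val ≤ (copies D M t.1 : ℝ) / D + 1 / D := by
        rw [← add_div, le_div_iff₀' hD']
        exact h1.2
      have e3 : 0 < 1 / (D : ℝ) := by positivity
      constructor <;> linarith
    rw [unitTerms] at h2
    rw [List.length_cons]
    push_cast
    rw [add_div, add_comm]
    linarith

theorem norm_mulVec_sum_le (h : ∀ t ∈ ts, 0 < t.1.val) (u : Circuit n) :
    ‖WithLp.toLp 2 ((ts.map fun t => (t.1.val : ℂ) • Circuit.mat t.2).sum *ᵥ Circuit.state u)‖ ≤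
      (ts.map fun t => t.1.val).sum := by
  induction ts with
  | nil => simp
  | cons t ts ih =>
    have h2 := ih fun t ht => h t (List.mem_cons_of_mem _ ht)
    rw [List.map_cons, List.sum_cons, List.map_cons, List.sum_cons, Matrix.add_mulVec,
      Matrix.smul_mulVec, WithLp.toLp_add, WithLp.toLp_smul, ← ket_append]
    refine (norm_add_le _ _).trans ?_
    rw [norm_smul, norm_ket, mul_one, Complex.norm_real, Real.norm_eq_abs,
      abs_of_pos (h t List.mem_cons_self)]
    linarith

end Approximation

/-! ### Hadamard tests for all pairs of circuits -/

section Tests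

variable {n : ℕ}

/-- The Hadamard tests for all pairs of circuits from two lists, with a common label. -/
def testBlock (k : ℕ) (im : Bool) (S S' : List (Circuit n)) : List (ℕ × AnyCircuit) :=
  S.flatMap fun V => S'.map fun W => (k, ⟨n + 2, hadamardTest V W im⟩)

/-- The value of an outcome of a test, counted for the label `k` only. -/
def sign (k : ℕ) (b : ℕ) (z : List Bool) : ℝ :=
  if b = k then (if z.headD false then -1 else 1) else 0

theorem sum_testMean_testBlock (k k' : ℕ) (im : Bool) (S S' : List (Circuit n)) :
    ((testBlock k' im S S').map (testMean (sign k))).sum =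
      if k' = k then ((if im then Complex.I else 1) * inner ℂ (ketSum S) (ketSum S')).re
      else 0 := by
  have h1 : ∀ V W : Circuit n, testMean (sign k) (k', ⟨n + 2, hadamardTest V W im⟩) =
      if k' = k then ((if im then Complex.I else 1) * inner ℂ (ket V) (ket W)).re else 0 := by
    intro V W
    rw [inner_ket, ← hadamardTest_mean, testMean]
    split_ifs with hk <;> simp [sign, hk, List.ofFn_succ]
  have h2 : ∀ V : Circuit n,
      ((S'.map fun W => (k', (⟨n + 2, hadamardTest V W im⟩ : AnyCircuit))).map
      (testMean (sign k))).sum =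
      if k' = k then ((if im then Complex.I else 1) * inner ℂ (ket V) (ketSum S')).re else 0 := by
    intro V
    induction S' with
    | nil => simp [ketSum]
    | cons W S' ih =>
      rw [List.map_cons, List.map_cons, List.sum_cons, ih, h1,
        show ketSum (W :: S') = ket W + ketSum S' by simp [ketSum], inner_add_right, mul_add,
        Complex.add_re]
      split_ifs <;> simp
  induction S with
  | nil => simp [testBlock, ketSum]
  | cons V S ih =>
    rw [testBlock, List.flatMap_cons, List.map_append, List.sum_append, ← testBlock, ih, h2,
      show ketSum (V :: S) = ket V + ketSum S by simp [ketSum], inner_add_left, mul_add,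
      Complex.add_re]
    split_ifs <;> simp

theorem sum_testMean_sq_testBlock (k k' : ℕ) (im : Bool) (S S' : List (Circuit n)) :
    ((testBlock k' im S S').map (testMean fun b z => sign k b z ^ 2)).sum =
      if k' = k then (S.length : ℝ) * S'.length else 0 := by
  have h1 : ∀ V W : Circuit n, testMean (fun b z => sign k b z ^ 2)
      (k', ⟨n + 2, hadamardTest V W im⟩) = if k' = k then 1 else 0 := by
    intro V W
    have h : ∑ z, ‖Circuit.state (hadamardTest V W im) z‖ ^ 2 = 1 := Circuit.normSq_state _
    rw [testMean]
    split_ifs with hk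
    · rw [← h]
      refine Finset.sum_congr rfl fun z _ => ?_
      simp only [sign, hk, if_true]
      split_ifs <;> ring
    · simp [sign, hk]
  have h2 : ∀ V : Circuit n,
      ((S'.map fun W => (k', (⟨n + 2, hadamardTest V W im⟩ : AnyCircuit))).map
      (testMean fun b z => sign k b z ^ 2)).sum = if k' = k then (S'.length : ℝ) else 0 := by
    intro V
    induction S' with
    | nil => simp
    | cons W S' ih =>
      rw [List.map_cons, List.map_cons, List.sum_cons, ih, h1, List.length_cons]
      split_ifs <;> simp [add_comm]
  induction S with
  | nil => simp [testBlock]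
  | cons V S ih =>
    rw [testBlock, List.flatMap_cons, List.map_append, List.sum_append, ← testBlock, ih, h2,
      List.length_cons]
    split_ifs
    · push_cast; ring
    · simp

/-- The number of outcomes `0` minus the number of outcomes `1` among the runs with label `k`. -/
def tally (k : ℕ) (l : List (ℕ × List Bool)) : ℤ :=
  (l.countP fun p => decide (p.1 = k) && !p.2.headD false : ℕ) -
    (l.countP fun p => decide (p.1 = k) && p.2.headD false : ℕ)

theorem tally_eq_statistic (k : ℕ) (ts : List (ℕ × AnyCircuit)) (zs : List (List Bool)) :
    (tally k (zipPad (ts.map Prod.fst) zs) : ℝ) = statistic (sign k) ts zs := by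
  rw [statistic]
  induction zipPad (ts.map Prod.fst) zs with
  | nil => simp [tally]
  | cons p l ih =>
    rw [List.map_cons, List.sum_cons, ← ih]
    simp only [tally, List.countP_cons, sign]
    by_cases hk : p.1 = k
    · cases p.2.headD false <;> simp [hk] <;> ring
    · simp [hk]

end Tests

/-! ### The quantum algorithm -/

namespace Inst

variable (I : Inst)

/-- The inverse of the accuracy `δ` to which the entries of the Gram matrix are needed. -/
def invAcc : ℕ := 16 * (I.bound + 1) ^ 2 * (I.invEps + 1)

/-- The factor by which the resolution exceeds `1 / δ`.  It makes the rounding error of the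
coefficients and the statistical error of the tallies small in comparison with `δ`. -/
def gap : ℕ := 32 * (I.bound + 1) * (I.terms.length + 1)

/-- The coefficients of the unitary decomposition are rounded to multiples of `1 / resolution`. -/
def resolution : ℕ := I.invAcc * I.gap

/-- Circuits whose states, divided by the resolution, add up to approximately `A u`. -/
def images (u : Circuit I.n) : List (Circuit I.n) :=
  (unitTerms I.resolution I.bound I.terms).map (u ++ ·)

/-- Circuits whose states, divided by the resolution, add up to `b`. -/
def target : List (Circuit I.n) := List.replicate I.resolution I.b

/-- All circuits that are run, with labels for the entries of the Gram matrix of `A u₁`, `A u₂`, `b`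
that they serve to estimate. -/
def tests : List (ℕ × AnyCircuit) :=
  testBlock 0 false (I.images I.u₁) (I.images I.u₁) ++
  (testBlock 1 false (I.images I.u₂) (I.images I.u₂) ++
  (testBlock 2 false (I.images I.u₁) (I.images I.u₂) ++
  (testBlock 3 true (I.images I.u₁) (I.images I.u₂) ++
  (testBlock 4 false (I.images I.u₁) I.target ++
  (testBlock 5 true (I.images I.u₁) I.target ++
  (testBlock 6 false (I.images I.u₂) I.target ++
  testBlock 7 true (I.images I.u₂) I.target))))))

/-- The inner products that the tallies estimate, up to the square of the resolution. -/
noncomputable def gramValue (k : ℕ) (w₁ w₂ b : EuclideanSpace ℂ (Basis I.n)) : ℝ :=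
  match k with
  | 0 => ‖w₁‖ ^ 2
  | 1 => ‖w₂‖ ^ 2
  | 2 => (inner ℂ w₁ w₂).re
  | 3 => -(inner ℂ w₁ w₂).im
  | 4 => (inner ℂ w₁ b).re
  | 5 => -(inner ℂ w₁ b).im
  | 6 => (inner ℂ w₂ b).re
  | _ => -(inner ℂ w₂ b).im

theorem sum_testMean_tests {k : ℕ} (hk : k < 8) :
    (I.tests.map (testMean (sign k))).sum =
      I.gramValue k (ketSum (I.images I.u₁)) (ketSum (I.images I.u₂)) (ketSum I.target) := by
  have hn : ∀ w : EuclideanSpace ℂ (Basis I.n), (inner ℂ w w).re = ‖w‖ ^ 2 := fun w => by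
    have := inner_self_eq_norm_sq (𝕜 := ℂ) w
    simpa using this
  simp only [tests, List.map_append, List.sum_append, sum_testMean_testBlock]
  interval_cases k <;> simp [gramValue, -inner_self_eq_norm_sq_to_K, hn]

theorem sum_testMean_sq_tests {k : ℕ} (hk : k < 8) {N : ℝ}
    (h₁ : ((I.images I.u₁).length : ℝ) ≤ N) (h₂ : ((I.images I.u₂).length : ℝ) ≤ N)
    (h₃ : (I.target.length : ℝ) ≤ N) :
    (I.tests.map (testMean fun b z => sign k b z ^ 2)).sum ≤ N ^ 2 := by
  have hN : ∀ {x y : ℕ}, (x : ℝ) ≤ N → (y : ℝ) ≤ N → (x : ℝ) * y ≤ N ^ 2 := fun {x y} hx hy => by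
    rw [sq]; exact mul_le_mul hx hy (Nat.cast_nonneg y) ((Nat.cast_nonneg x).trans hx)
  simp only [tests, List.map_append, List.sum_append, sum_testMean_sq_testBlock]
  interval_cases k <;> norm_num <;> apply hN <;> assumption

/-- The first diagonal entry of the modified normal equations, as an integer over the denominator
`resolution ^ 2`, from the tallies `T`.  The second summand stands for `3δ` with `δ = 1 / invAcc`,
because `resolution ^ 2 / invAcc = gap * resolution`. -/
def diag₁ (T : ℕ → ℤ) : ℤ := T 0 + 3 * (I.gap * I.resolution)

/-- The second diagonal entry of the modified normal equations, over the denominator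
`resolution ^ 2`. -/
def diag₂ (T : ℕ → ℤ) : ℤ := T 1 + 3 * (I.gap * I.resolution)

/-- The determinant of the modified normal equations, over the denominator `resolution ^ 4`; the
off-diagonal entry is `T 2 - i T 3`. -/
def det (T : ℕ → ℤ) : ℤ := I.diag₁ T * I.diag₂ T - (T 2 * T 2 + T 3 * T 3)

/-- A fraction with a given denominator, which is replaced by `1` if it is not positive. -/
def frac (z d : ℤ) : Frac := ⟨z, (d.toNat - 1).succPNat⟩

/-- The solution of the modified normal equations by Cramer's rule; the right-hand side consists of
`T 4 - i T 5` and `T 6 - i T 7`. -/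
def solution (T : ℕ → ℤ) : CFrac × CFrac :=
  (⟨frac (I.diag₂ T * T 4 - (T 2 * T 6 - T 3 * T 7)) (I.det T),
    frac (-(I.diag₂ T * T 5) + (T 2 * T 7 + T 3 * T 6)) (I.det T)⟩,
   ⟨frac (I.diag₁ T * T 6 - (T 2 * T 4 + T 3 * T 5)) (I.det T),
    frac (-(I.diag₁ T * T 7) + (T 2 * T 5 - T 3 * T 4)) (I.det T)⟩)

theorem frac_val {z d : ℤ} (hd : 0 < d) : (frac z d).val = (z : ℝ) / d := by
  rw [Frac.val, frac, Nat.succPNat_coe]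
  congr 1
  have : ((d.toNat - 1 + 1 : ℕ) : ℤ) = d := by omega
  exact_mod_cast congrArg (Int.cast : ℤ → ℝ) this

/-- The coefficients that are computed from the outcomes of the tests. -/
def coefficients (zs : List (List Bool)) : CFrac × CFrac :=
  I.solution fun k => tally k (zipPad (I.tests.map Prod.fst) zs)

/-- The vector `A u`. -/
noncomputable def image (u : Circuit I.n) : EuclideanSpace ℂ (Basis I.n) :=
  WithLp.toLp 2 (I.A *ᵥ Circuit.state u)

theorem loss_eq (x y : ℂ) :
    I.loss x y = ‖x • I.image I.u₁ + y • I.image I.u₂ - ket I.b‖ ^ 2 := by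
  rw [loss, regLoss, Matrix.mulVec_add, Matrix.mulVec_smul, Matrix.mulVec_smul]
  rfl

theorem norm_inner_sub_inner_le {E : Type} [NormedAddCommGroup E] [InnerProductSpace ℂ E]
    {a a' b b' : E} {N κ : ℝ} (ha : ‖a'‖ ≤ N) (hb : ‖b‖ ≤ N) (haa : ‖a - a'‖ ≤ κ)
    (hbb : ‖b - b'‖ ≤ κ) : ‖(inner ℂ a' b' : ℂ) - inner ℂ a b‖ ≤ 2 * N * κ := by
  have h : (inner ℂ a' b' : ℂ) - inner ℂ a b = -(inner ℂ a' (b - b') + inner ℂ (a - a') b) := by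
    rw [inner_sub_right, inner_sub_left]; ring
  rw [h, norm_neg]
  refine (norm_add_le _ _).trans ?_
  have h1 := norm_inner_le_norm (𝕜 := ℂ) a' (b - b')
  have h2 := norm_inner_le_norm (𝕜 := ℂ) (a - a') b
  have hN : 0 ≤ N := (norm_nonneg _).trans ha
  have hκ : 0 ≤ κ := (norm_nonneg _).trans haa
  have h3 := mul_le_mul ha hbb (norm_nonneg _) hN
  have h4 := mul_le_mul haa hb (norm_nonneg _) hκ
  linarith

variable {I}

theorem valid_bounds (hI : I.Valid) : ∀ t ∈ I.terms, 0 < t.1.val ∧ t.1.val ≤ I.bound := by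
  intro t ht
  refine ⟨hI.beta_pos t ht, le_trans ?_ hI.beta_sum⟩
  refine List.single_le_sum (l := I.terms.map fun t => t.1.val) ?_ _ (List.mem_map_of_mem ht)
  intro x hx
  obtain ⟨s, hs, rfl⟩ := List.mem_map.1 hx
  exact (hI.beta_pos s hs).le

theorem length_images_le (hI : I.Valid) (u : Circuit I.n) :
    ((I.images u).length : ℝ) ≤ I.resolution * (I.bound + 1) := by
  rw [images, List.length_map]
  refine (length_unitTerms_le (valid_bounds hI)).trans ?_
  gcongr
  exact hI.beta_sum.trans (by linarith)

theorem norm_image_sub_le (hI : I.Valid) (u : Circuit I.n) :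
    ‖I.image u - (I.resolution : ℂ)⁻¹ • ketSum (I.images u)‖ ≤ I.terms.length / I.resolution := by
  refine norm_mulVec_sum_sub_le ?_ (valid_bounds hI) u
  rw [resolution, invAcc, gap]
  positivity

theorem norm_image_le (hI : I.Valid) (u : Circuit I.n) : ‖I.image u‖ ≤ I.bound :=
  (norm_mulVec_sum_le hI.beta_pos u).trans hI.beta_sum

/-- An inner product of two vectors from approximations of the vectors and of the inner product of
these approximations. -/
theorem norm_estimate_sub_inner_le {E : Type} [NormedAddCommGroup E] [InnerProductSpace ℂ E]
    {a b s s' : E} {D : ℕ} {N κ δ p q : ℝ} (hD : (0 : ℝ) < D) (hs : ‖s‖ ≤ D * N) (hb : ‖b‖ ≤ N)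
    (haa : ‖a - (D : ℂ)⁻¹ • s‖ ≤ κ) (hbb : ‖b - (D : ℂ)⁻¹ • s'‖ ≤ κ)
    (hp : |p - (inner ℂ s s').re| ≤ D ^ 2 * δ) (hq : |q + (inner ℂ s s').im| ≤ D ^ 2 * δ) :
    ‖((p : ℂ) - q * Complex.I) / (D : ℂ) ^ 2 - inner ℂ a b‖ ≤ 2 * δ + 2 * N * κ := by
  have hDc : (D : ℂ) ≠ 0 := by exact_mod_cast hD.ne'
  have hs' : ‖(D : ℂ)⁻¹ • s‖ ≤ N := by
    rw [norm_smul, norm_inv, Complex.norm_natCast, inv_mul_le_iff₀ hD]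
    exact hs
  have h1 := norm_inner_sub_inner_le hs' hb haa hbb
  have h2 : (inner ℂ ((D : ℂ)⁻¹ • s) ((D : ℂ)⁻¹ • s') : ℂ) = inner ℂ s s' / (D : ℂ) ^ 2 := by
    rw [inner_smul_left, inner_smul_right, map_inv₀, Complex.conj_natCast]
    field_simp
  rw [h2] at h1
  have h3 : ‖((p : ℂ) - q * Complex.I) / (D : ℂ) ^ 2 - inner ℂ s s' / (D : ℂ) ^ 2‖ ≤ 2 * δ := by
    rw [← sub_div, norm_div, norm_pow, Complex.norm_natCast, div_le_iff₀ (by positivity)]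
    refine (Complex.norm_le_abs_re_add_abs_im _).trans ?_
    have e1 : ((p : ℂ) - q * Complex.I - inner ℂ s s').re = p - (inner ℂ s s').re := by simp
    have e2 : ((p : ℂ) - q * Complex.I - inner ℂ s s').im = -(q + (inner ℂ s s').im) := by
      simp; ring
    rw [e1, e2, abs_neg]
    linarith
  calc _ = ‖(((p : ℂ) - q * Complex.I) / (D : ℂ) ^ 2 - inner ℂ s s' / (D : ℂ) ^ 2) +
        (inner ℂ s s' / (D : ℂ) ^ 2 - inner ℂ a b)‖ := by congr 1; ring
    _ ≤ _ := (norm_add_le _ _).trans (add_le_add h3 h1)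

/-- If all tallies are close to their expected values, then the computed coefficients are nearly
optimal. -/
theorem nearOptimal_solution (hI : I.Valid) {T : ℕ → ℤ}
    (hT : ∀ k < 8, |(T k : ℝ) -
      I.gramValue k (ketSum (I.images I.u₁)) (ketSum (I.images I.u₂)) (ketSum I.target)| ≤
        (I.resolution : ℝ) ^ 2 / (4 * I.invAcc)) :
    I.NearOptimal (1 / (I.invEps : ℝ)) (I.solution T).1.val (I.solution T).2.val := by
  have hR : (0 : ℝ) < I.invAcc := by rw [invAcc]; positivity
  have hD : (0 : ℝ) < I.resolution := by rw [resolution, invAcc, gap]; positivity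
  have hDc : (I.resolution : ℂ) ≠ 0 := by exact_mod_cast hD.ne'
  have hDR : (I.resolution : ℝ) = I.invAcc * I.gap := by rw [resolution]; push_cast; ring
  set s₁ := ketSum (I.images I.u₁) with hs₁
  set s₂ := ketSum (I.images I.u₂) with hs₂
  set s₃ := ketSum I.target with hs₃
  have hlen : ∀ u : Circuit I.n, ‖ketSum (I.images u)‖ ≤ I.resolution * (I.bound + 1 : ℝ) :=
    fun u => (norm_ketSum_le _).trans (length_images_le hI u)
  have hM : (0 : ℝ) ≤ I.bound := Nat.cast_nonneg _
  have himg : ∀ u : Circuit I.n, ‖I.image u‖ ≤ (I.bound + 1 : ℝ) := fun u =>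
    (norm_image_le hI u).trans (by linarith)
  have ha₁ := norm_image_sub_le hI I.u₁
  have ha₂ := norm_image_sub_le hI I.u₂
  have hb : ‖ket I.b - (I.resolution : ℂ)⁻¹ • s₃‖ ≤ I.terms.length / I.resolution := by
    rw [hs₃, target, ketSum_replicate, smul_smul, inv_mul_cancel₀ hDc, one_smul, sub_self,
      norm_zero]
    positivity
  have hnb : ‖ket I.b‖ ≤ (I.bound + 1 : ℝ) := by rw [norm_ket]; linarith
  rw [← hs₁] at ha₁
  rw [← hs₂] at ha₂
  set δ : ℝ := 1 / I.invAcc with hδ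
  have hδ0 : 0 < δ := by positivity
  have hη : (I.resolution : ℝ) ^ 2 / (4 * I.invAcc) = (I.resolution : ℝ) ^ 2 * (δ / 4) := by
    rw [hδ]; field_simp
  rw [hη] at hT
  have t₀ := hT 0 (by norm_num)
  have t₁ := hT 1 (by norm_num)
  have t₂ := hT 2 (by norm_num)
  have t₃ := hT 3 (by norm_num)
  have t₄ := hT 4 (by norm_num)
  have t₅ := hT 5 (by norm_num)
  have t₆ := hT 6 (by norm_num)
  have t₇ := hT 7 (by norm_num)
  simp only [gramValue] at t₀ t₁ t₂ t₃ t₄ t₅ t₆ t₇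
  -- half of `δ` is left to the statistical error of the real and the imaginary part, and half of it
  -- to the rounding of the coefficients
  have hκ : 2 * (δ / 4) + 2 * (I.bound + 1 : ℝ) * (I.terms.length / I.resolution) ≤ δ := by
    have h1 : 2 * (I.bound + 1 : ℝ) * (I.terms.length / I.resolution) ≤ δ / 2 := by
      have hg : (I.gap : ℝ) = 32 * (I.bound + 1) * (I.terms.length + 1) := by
        rw [gap]; push_cast; ring
      rw [hδ, hDR, hg]
      field_simp
      have : (0 : ℝ) ≤ I.terms.length := Nat.cast_nonneg _
      linarith
    linarith
  have hest : ∀ {a b s s' : EuclideanSpace ℂ (Basis I.n)} {p q : ℝ},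
      ‖s‖ ≤ I.resolution * (I.bound + 1 : ℝ) → ‖b‖ ≤ (I.bound + 1 : ℝ) →
      ‖a - (I.resolution : ℂ)⁻¹ • s‖ ≤ I.terms.length / I.resolution →
      ‖b - (I.resolution : ℂ)⁻¹ • s'‖ ≤ I.terms.length / I.resolution →
      |p - (inner ℂ s s').re| ≤ (I.resolution : ℝ) ^ 2 * (δ / 4) →
      |q - -(inner ℂ s s').im| ≤ (I.resolution : ℝ) ^ 2 * (δ / 4) →
      ‖((p : ℂ) - q * Complex.I) / (I.resolution : ℂ) ^ 2 - inner ℂ a b‖ ≤ δ := by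
    intro a b s s' p q h1 h2 h3 h4 h5 h6
    rw [sub_neg_eq_add] at h6
    exact (norm_estimate_sub_inner_le hD h1 h2 h3 h4 h5 h6).trans hκ
  have hself : ∀ w : EuclideanSpace ℂ (Basis I.n), inner ℂ w w = ((‖w‖ ^ 2 : ℝ) : ℂ) := fun w => by
    rw [inner_self_eq_norm_sq_to_K]; norm_num
  have hdiag : ∀ {a s : EuclideanSpace ℂ (Basis I.n)} {z : ℤ},
      ‖s‖ ≤ I.resolution * (I.bound + 1 : ℝ) → ‖a‖ ≤ (I.bound + 1 : ℝ) →
      ‖a - (I.resolution : ℂ)⁻¹ • s‖ ≤ I.terms.length / I.resolution →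
      |(z : ℝ) - ‖s‖ ^ 2| ≤ (I.resolution : ℝ) ^ 2 * (δ / 4) →
      |((z + 3 * (I.gap * I.resolution) : ℤ) : ℝ) / (I.resolution : ℝ) ^ 2 - ‖a‖ ^ 2 - 3 * δ| ≤
        δ := by
    intro a s z h1 h2 h3 h4
    have h5 := hest (a := a) (b := a) (s := s) (s' := s) (p := z) (q := 0) h1 h2 h3 h3
      (by rw [hself, Complex.ofReal_re]; exact h4)
      (by rw [hself, Complex.ofReal_im]; simp; positivity)
    have h6 : ((z + 3 * (I.gap * I.resolution) : ℤ) : ℝ) / (I.resolution : ℝ) ^ 2 - ‖a‖ ^ 2 -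
        3 * δ = (z : ℝ) / (I.resolution : ℝ) ^ 2 - ‖a‖ ^ 2 := by
      have : (3 * (I.gap * I.resolution) : ℝ) / (I.resolution : ℝ) ^ 2 = 3 * δ := by
        rw [hδ, hDR]
        have hg : (0 : ℝ) < I.gap := by rw [gap]; positivity
        field_simp
      push_cast
      rw [add_div, this]
      ring
    rw [h6, ← Real.norm_eq_abs, ← Complex.norm_real]
    rw [hself] at h5
    convert h5 using 2
    push_cast
    ring
  have e₁₁ : |(I.diag₁ T : ℝ) / (I.resolution : ℝ) ^ 2 - ‖I.image I.u₁‖ ^ 2 - 3 * δ| ≤ δ :=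
    hdiag (z := T 0) (hlen I.u₁) (himg I.u₁) ha₁ t₀
  have e₂₂ : |(I.diag₂ T : ℝ) / (I.resolution : ℝ) ^ 2 - ‖I.image I.u₂‖ ^ 2 - 3 * δ| ≤ δ :=
    hdiag (z := T 1) (hlen I.u₂) (himg I.u₂) ha₂ t₁
  have e₁₂ := hest (p := T 2) (q := T 3) (hlen I.u₁) (himg I.u₂) ha₁ ha₂ t₂
    t₃
  have e₁ := hest (p := T 4) (q := T 5) (hlen I.u₁) hnb ha₁ hb t₄
    t₅
  have e₂ := hest (p := T 6) (q := T 7) (hlen I.u₂) hnb ha₂ hb t₆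
    t₇
  have hd : (I.det T : ℝ) / (I.resolution : ℝ) ^ 4 =
      (I.diag₁ T : ℝ) / (I.resolution : ℝ) ^ 2 * ((I.diag₂ T : ℝ) / (I.resolution : ℝ) ^ 2) -
      ‖(((T 2 : ℝ) : ℂ) - (T 3 : ℝ) * Complex.I) / (I.resolution : ℂ) ^ 2‖ ^ 2 := by
    have : ‖((T 2 : ℝ) : ℂ) - (T 3 : ℝ) * Complex.I‖ ^ 2 = (T 2 : ℝ) ^ 2 + (T 3 : ℝ) ^ 2 := by
      rw [← Complex.normSq_eq_norm_sq, Complex.normSq_apply]; simp; ring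
    rw [norm_div, norm_pow, Complex.norm_natCast, div_pow, this, det]
    push_cast
    field_simp
  obtain ⟨hpos, hopt⟩ := regularized_least_squares (M := I.bound) hδ0 e₁₁ e₂₂ e₁₂ e₁ e₂ hd
  have hdet : 0 < I.det T := by
    rw [div_pos_iff_of_pos_right (by positivity)] at hpos
    exact_mod_cast hpos
  have hdetc : (I.det T : ℂ) ≠ 0 := by exact_mod_cast hdet.ne'
  have hval : ∀ z w : ℤ, CFrac.val ⟨frac z (I.det T), frac w (I.det T)⟩ =
      ((z : ℂ) + w * Complex.I) / I.det T := by
    intro z w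
    have : CFrac.val ⟨frac z (I.det T), frac w (I.det T)⟩ =
        (((z : ℝ) / (I.det T : ℝ) : ℝ) : ℂ) + (((w : ℝ) / (I.det T : ℝ) : ℝ) : ℂ) * Complex.I := by
      rw [CFrac.val, frac_val hdet, frac_val hdet]
      apply Complex.ext <;> simp
    rw [this]
    push_cast
    field_simp
  obtain ⟨α₁, α₂, hα₁, hα₂, hα⟩ := hI.coeff_bound
  have hfin := hopt α₁ α₂ hα₁ hα₂
  have hδE : 16 * (I.bound + 1 : ℝ) ^ 2 * δ ≤ 1 / (I.invEps : ℝ) := by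
    have hE : (0 : ℝ) < I.invEps := by exact_mod_cast hI.invEps_pos
    have : (I.invAcc : ℝ) = 16 * (I.bound + 1) ^ 2 * (I.invEps + 1) := by
      rw [invAcc]; push_cast; ring
    rw [hδ, this, mul_one_div, ← div_div, div_self (by positivity)]
    exact one_div_le_one_div_of_le hE (by linarith)
  intro γ₁ γ₂
  have hγ := hα γ₁ γ₂
  rw [I.loss_eq α₁ α₂] at hγ
  have hsol : I.loss (I.solution T).1.val (I.solution T).2.val ≤
      ‖α₁ • I.image I.u₁ + α₂ • I.image I.u₂ - ket I.b‖ ^ 2 + 16 * (I.bound + 1 : ℝ) ^ 2 * δ := by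
    refine le_trans (le_of_eq ?_) hfin
    have hI2 := Complex.I_sq
    rw [loss_eq, solution, hval, hval]
    simp only [map_div₀, map_sub, map_mul, map_pow, Complex.conj_I, map_intCast,
      Complex.conj_natCast, Complex.ofReal_div, Complex.ofReal_pow, Complex.ofReal_natCast,
      Complex.ofReal_intCast]
    congr 5
    · push_cast
      field_simp
      linear_combination ((T 3 : ℂ) * (T 7 : ℂ)) * hI2
    · push_cast
      field_simp
      linear_combination (-(T 3 : ℂ) * (T 5 : ℂ)) * hI2
  linarith

/-- The algorithm succeeds with probability at least `2 / 3`, by Chebyshev's inequality for the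
eight tallies. -/
theorem two_thirds_le_runProb (hI : I.Valid) :
    2 / 3 ≤ runProb (I.tests.map Prod.snd) fun zs =>
      I.NearOptimal (1 / (I.invEps : ℝ)) (I.coefficients zs).1.val (I.coefficients zs).2.val := by
  have hR : (0 : ℝ) < I.invAcc := by rw [invAcc]; positivity
  have hD : (0 : ℝ) < I.resolution := by rw [resolution, invAcc, gap]; positivity
  refine le_trans ?_ (one_sub_le_runProb (ι := Fin 8) (fun k => sign k) I.tests
    (η := (I.resolution : ℝ) ^ 2 / (4 * I.invAcc))
    (v := (I.resolution * (I.bound + 1) : ℝ) ^ 2) (by positivity) (fun k => ?_) _ fun zs hzs => ?_)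
  · have h : (Fintype.card (Fin 8) : ℝ) * (I.resolution * (I.bound + 1) : ℝ) ^ 2 /
        ((I.resolution : ℝ) ^ 2 / (4 * I.invAcc)) ^ 2 = 1 / (8 * (I.terms.length + 1) ^ 2) := by
      have hg : (I.resolution : ℝ) = I.invAcc * (32 * (I.bound + 1) * (I.terms.length + 1)) := by
        rw [resolution, gap]; push_cast; ring
      have hK : (0 : ℝ) < I.terms.length + 1 := by positivity
      have hM : (0 : ℝ) < I.bound + 1 := by positivity
      rw [Fintype.card_fin, hg]
      field_simp
      norm_num
    rw [h]
    have : (1 : ℝ) / (8 * (I.terms.length + 1) ^ 2) ≤ 1 / 8 := by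
      apply one_div_le_one_div_of_le (by norm_num)
      have : (0 : ℝ) ≤ I.terms.length := Nat.cast_nonneg _
      nlinarith
    linarith
  · refine I.sum_testMean_sq_tests k.2 (length_images_le hI _) (length_images_le hI _) ?_
    rw [target, List.length_replicate]
    have : (0 : ℝ) ≤ I.bound := Nat.cast_nonneg _
    nlinarith
  · refine nearOptimal_solution hI fun k hk => ?_
    have := hzs ⟨k, hk⟩
    rwa [← tally_eq_statistic, I.sum_testMean_tests hk] at this

end Inst

/-! ### The circuits and the coefficients are computed in polynomial time -/

namespace PTime

section Gates

variable {α : Type} {e : α → Data} {n : α → ℕ}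

theorem had {q : ∀ x, Fin (n x)} (hq : PTime e fun x => unary (q x)) :
    PTime e fun x => Enc.enc (Gate.had (q x)) := (unary_const 0).node hq

theorem tee {q : ∀ x, Fin (n x)} (hq : PTime e fun x => unary (q x)) :
    PTime e fun x => Enc.enc (Gate.tee (q x)) := (unary_const 1).node hq

theorem cnot {c t : ∀ x, Fin (n x)} {h : ∀ x, c x ≠ t x} (hc : PTime e fun x => unary (c x))
    (ht : PTime e fun x => unary (t x)) :
    PTime e fun x => Enc.enc (Gate.cnot (c x) (t x) (h x)) := (unary_const 2).node (hc.node ht)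

theorem circuit_nil : PTime e fun x => Enc.enc ([] : Circuit (n x)) := leaf

theorem circuit_cons {g : ∀ x, Gate (n x)} {c : ∀ x, Circuit (n x)}
    (hg : PTime e fun x => Enc.enc (g x)) (hc : PTime e fun x => Enc.enc (c x)) :
    PTime e fun x => Enc.enc (g x :: c x) := hg.node hc

theorem circuit_append {c d : ∀ x, Circuit (n x)} (hc : PTime e fun x => Enc.enc (c x))
    (hd : PTime e fun x => Enc.enc (d x)) : PTime e fun x => Enc.enc (c x ++ d x) :=
  append (β := fun x => Gate (n x)) (fun _ => Enc.enc) hc hd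

theorem circuit_replicate (k : ℕ) {g : ∀ x, Gate (n x)} (hg : PTime e fun x => Enc.enc (g x)) :
    PTime e fun x => Enc.enc (List.replicate k (g x)) :=
  replicate (β := fun x => Gate (n x)) (fun _ => Enc.enc) (unary_const k) hg

theorem ccz {a b c : ∀ x, Fin (n x)} {hab : ∀ x, a x ≠ b x} {hac : ∀ x, a x ≠ c x}
    {hbc : ∀ x, b x ≠ c x} (ha : PTime e fun x => unary (a x)) (hb : PTime e fun x => unary (b x))
    (hc : PTime e fun x => unary (c x)) :
    PTime e fun x => Enc.enc (ccz (a x) (b x) (c x) (hab x) (hac x) (hbc x)) := by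
  unfold QLS.ccz
  repeat' first
    | exact ha
    | exact hb
    | exact hc
    | apply circuit_append
    | apply circuit_cons
    | apply circuit_nil
    | apply circuit_replicate
    | apply tee
    | apply cnot

theorem toffoli {a b c : ∀ x, Fin (n x)} {hab : ∀ x, a x ≠ b x} {hac : ∀ x, a x ≠ c x}
    {hbc : ∀ x, b x ≠ c x} (ha : PTime e fun x => unary (a x)) (hb : PTime e fun x => unary (b x))
    (hc : PTime e fun x => unary (c x)) :
    PTime e fun x => Enc.enc (toffoli (a x) (b x) (c x) (hab x) (hac x) (hbc x)) :=
  circuit_cons (had hc) (circuit_append (ccz ha hb hc) (circuit_cons (had hc) circuit_nil))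

/-- Computations on gates by a case distinction. -/
theorem gate_cases {F : (Σ n, Gate n) → Data}
    (hh : PTime (fun x : Σ n, Fin n => unary x.2) fun x => F ⟨x.1, .had x.2⟩)
    (ht : PTime (fun x : Σ n, Fin n => unary x.2) fun x => F ⟨x.1, .tee x.2⟩)
    (hc : PTime (fun x : Σ n, {p : Fin n × Fin n // p.1 ≠ p.2} =>
      Data.node (unary x.2.1.1) (unary x.2.1.2)) fun x => F ⟨x.1, .cnot x.2.1.1 x.2.1.2 x.2.2⟩) :
    PTime (fun g : Σ n, Gate n => Enc.enc g.2) F := by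
  -- the tag and the arguments of a gate
  let tag : (Σ n, Gate n) → Data := fun g => match g.2 with
    | .had _ => unary 0
    | .tee _ => unary 1
    | .cnot _ _ _ => unary 2
  let args : (Σ n, Gate n) → Data := fun g => match g.2 with
    | .had q => unary q
    | .tee q => unary q
    | .cnot c t _ => .node (unary c) (unary t)
  have h : PTime (fun g : Σ n, Gate n => Enc.enc g.2) fun g => Data.node (tag g) (args g) :=
    (refl _).congr fun ⟨n, g⟩ => by cases g <;> rfl
  refine h.fst.cond ?_ ?_
  · have hx : ∀ x : {g : Σ n, Gate n // tag g = Data.leaf}, ∃ y : Σ n, Fin n,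
        x.1 = ⟨y.1, .had y.2⟩ := by
      rintro ⟨⟨n, _ | _ | _⟩, hg⟩
      · exact ⟨⟨_, _⟩, rfl⟩
      · cases hg
      · cases hg
    choose φ hφ using hx
    exact ((h.reindex Subtype.val).snd.congr fun x => by rw [hφ x]).trans
      ((hh.reindex φ).congr fun x => by rw [← hφ x])
  · have h' := h.reindex (Subtype.val : {g : Σ n, Gate n // tag g ≠ Data.leaf} → _)
    have htag : PTime (fun x : {g : Σ n, Gate n // tag g ≠ Data.leaf} => Enc.enc x.1.2) fun x =>
        (match x.1.2 with | .tee _ => Data.leaf | _ => unary 1) := by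
      refine PTime.snd (f := fun _ => Data.leaf) (h'.fst.congr ?_)
      rintro ⟨⟨n, _ | _ | _⟩, hg⟩
      · exact absurd rfl hg
      · rfl
      · rfl
    refine htag.cond ?_ ?_
    · have hx : ∀ x : {x : {g : Σ n, Gate n // tag g ≠ Data.leaf} //
          (match x.1.2 with | .tee _ => Data.leaf | _ => unary 1) = Data.leaf}, ∃ y : Σ n, Fin n,
          x.1.1 = ⟨y.1, .tee y.2⟩ := by
        rintro ⟨⟨⟨n, _ | _ | _⟩, hg⟩, hg'⟩
        · exact absurd rfl hg
        · exact ⟨⟨_, _⟩, rfl⟩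
        · cases hg'
      choose φ hφ using hx
      exact ((h'.reindex Subtype.val).snd.congr fun x => by rw [hφ x]).trans
        ((ht.reindex φ).congr fun x => by rw [← hφ x])
    · have hx : ∀ x : {x : {g : Σ n, Gate n // tag g ≠ Data.leaf} //
          (match x.1.2 with | .tee _ => Data.leaf | _ => unary 1) ≠ Data.leaf},
          ∃ y : Σ n, {p : Fin n × Fin n // p.1 ≠ p.2},
          x.1.1 = ⟨y.1, .cnot y.2.1.1 y.2.1.2 y.2.2⟩ := by
        rintro ⟨⟨⟨n, _ | _ | ⟨c, t, hct⟩⟩, hg⟩, hg'⟩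
        · exact absurd rfl hg
        · exact absurd rfl hg'
        · exact ⟨⟨_, ⟨(c, t), hct⟩⟩, rfl⟩
      choose φ hφ using hx
      exact ((h'.reindex Subtype.val).snd.congr fun x => by rw [hφ x]).trans
        ((hc.reindex φ).congr fun x => by rw [← hφ x])

theorem ctrlGate : PTime (fun g : Σ n, Gate n => Enc.enc g.2) fun g => Enc.enc (ctrlGate g.2) := by
  have h0 : ∀ {α : Type} {e : α → Data} {n : α → ℕ},
      PTime e fun x => unary ((0 : Fin (n x + 2)) : ℕ) := leaf
  have h1 : ∀ {α : Type} {e : α → Data} {n : α → ℕ},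
      PTime e fun x => unary ((1 : Fin (n x + 2)) : ℕ) :=
    (unary_const 1).congr fun x => by simp
  have hs : ∀ {α : Type} {e : α → Data} {n : α → ℕ} {q : ∀ x, Fin (n x)},
      (PTime e fun x => unary (q x)) → PTime e fun x => unary ((q x).succ.succ : Fin (n x + 2)) :=
    fun hq => leaf.node (leaf.node hq)
  refine gate_cases ?_ ?_ ?_
  · have hq := hs (refl fun x : Σ n, Fin n => unary x.2)
    simp only [QLS.ctrlGate]
    repeat' first
      | exact hq
      | exact h0
      | apply circuit_append
      | apply circuit_cons
      | apply circuit_nil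
      | apply circuit_replicate
      | apply PTime.had
      | apply PTime.tee
      | apply PTime.cnot
  · have hq := hs (refl fun x : Σ n, Fin n => unary x.2)
    exact circuit_append (toffoli h0 hq h1) (circuit_cons (tee h1) (toffoli h0 hq h1))
  · have h := refl fun x : Σ n, {p : Fin n × Fin n // p.1 ≠ p.2} =>
      Data.node (unary x.2.1.1) (unary x.2.1.2)
    exact toffoli h0 (hs h.fst) (hs h.snd)

/-- Replacing every gate of a circuit. -/
theorem circuit_flatMap {k : ℕ} {V : ∀ x, Circuit (n x)} {f : ∀ {n : ℕ}, Gate n → Circuit (n + k)}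
    (hV : PTime e fun x => Enc.enc (V x))
    (hf : PTime (fun g : Σ n, Gate n => Enc.enc g.2) fun g => Enc.enc (f g.2)) :
    PTime e fun x => Enc.enc ((V x).flatMap f : Circuit (n x + k)) :=
  flatMap (β := fun x => Gate (n x)) (γ := fun x => Gate (n x + k)) (fun _ => Enc.enc)
    (fun _ => Enc.enc) hV ((refl _).snd.trans (hf.reindex fun x : Σ x, Gate (n x) => ⟨n x.1, x.2⟩))

theorem flipFirst : PTime e fun x => Enc.enc (flipFirst (n x)) :=
  -- the encoding of a gate does not depend on the number of qubits
  const (Enc.enc (QLS.flipFirst 0))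

theorem hadamardTest {V W : ∀ x, Circuit (n x)} (im : Bool) (hV : PTime e fun x => Enc.enc (V x))
    (hW : PTime e fun x => Enc.enc (W x)) :
    PTime e fun x => Enc.enc (hadamardTest (V x) (W x) im) := by
  have h0 : PTime e fun x => unary ((0 : Fin (n x + 2)) : ℕ) := leaf
  exact circuit_cons (had h0) (circuit_append (circuit_append (circuit_append (circuit_append
    (circuit_flatMap hV ctrlGate) flipFirst) (circuit_flatMap hW ctrlGate))
    (circuit_replicate _ (tee h0))) (circuit_cons (had h0) circuit_nil))

/-- The encoding of labelled circuits. -/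
def encTest (t : ℕ × AnyCircuit) : Data := .node (unary t.1) (Enc.enc t.2)

theorem testBlock (k : ℕ) (im : Bool) {S S' : ∀ x, List (Circuit (n x))}
    (hn : PTime e fun x => unary (n x))
    (hS : PTime e fun x => Enc.enc (S x)) (hS' : PTime e fun x => Enc.enc (S' x)) :
    PTime e fun x => encList encTest (testBlock k im (S x) (S' x)) := by
  refine flatMap (β := fun x => Circuit (n x)) (γ := fun _ => ℕ × AnyCircuit) (fun _ => Enc.enc)
    (fun _ => encTest) hS ?_
  have h := refl fun x : Σ x, Circuit (n x) => Data.node (e x.1) (Enc.enc x.2)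
  refine map (β := fun x : Σ x, Circuit (n x) => Circuit (n x.1)) (γ := fun _ => ℕ × AnyCircuit)
    (fun _ => Enc.enc) (fun _ => encTest)
    (h.fst.trans (hS'.reindex fun x : Σ x, Circuit (n x) => x.1)) ?_
  have h' := refl fun y : Σ x : Σ x, Circuit (n x), Circuit (n x.1) =>
    Data.node (Data.node (e y.1.1) (Enc.enc y.1.2)) (Enc.enc y.2)
  exact (unary_const k).node ((unary_succ (unary_succ (h'.fst.fst.trans
    (hn.reindex fun y : Σ x : Σ x, Circuit (n x), Circuit (n x.1) => y.1.1)))).node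
    (hadamardTest im h'.fst.snd h'.snd))

end Gates

section Terms

variable {α : Type} {e : α → Data} {n D M : α → ℕ}

theorem copies {q : α → Frac} (hD : PTime e fun x => unary (D x))
    (hM : PTime e fun x => unary (M x))
    (hq : PTime e fun x => Enc.enc (q x)) : PTime e fun x => unary (copies (D x) (M x) (q x)) := by
  refine countP (β := fun _ => ℕ) (fun _ => unary) (range (unary_mul hD hM)) ?_
  have h := refl fun x : Σ _ : α, ℕ => Data.node (e x.1) (unary x.2)
  have hq' : PTime _ fun x : Σ _ : α, ℕ => Enc.enc (q x.1) :=
    h.fst.trans (hq.reindex fun x : Σ _ : α, ℕ => x.1)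
  exact mul_binary_le (h.fst.trans (hD.reindex fun x : Σ _ : α, ℕ => x.1)) (unary_succ h.snd)
    hq'.fst.snd hq'.snd

theorem unitTerms {ts : ∀ x, List (Frac × Circuit (n x))} (hD : PTime e fun x => unary (D x))
    (hM : PTime e fun x => unary (M x)) (hts : PTime e fun x => Enc.enc (ts x)) :
    PTime e fun x => Enc.enc (unitTerms (D x) (M x) (ts x)) := by
  refine flatMap (β := fun x => Frac × Circuit (n x)) (γ := fun x => Circuit (n x))
    (fun _ => Enc.enc) (fun _ => Enc.enc) hts ?_
  have h := refl fun x : Σ x, Frac × Circuit (n x) =>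
    Data.node (e x.1) (Data.node (Enc.enc x.2.1) (Enc.enc x.2.2))
  exact replicate (β := fun x : Σ x, Frac × Circuit (n x) => Circuit (n x.1)) (fun _ => Enc.enc)
    (copies (h.fst.trans (hD.reindex fun x : Σ x, Frac × Circuit (n x) => x.1))
      (h.fst.trans (hM.reindex fun x : Σ x, Frac × Circuit (n x) => x.1)) h.snd.fst) h.snd.snd

end Terms

end PTime

namespace Inst

theorem ptime_gap : PTime Enc.enc fun I : Inst => unary I.gap := by
  have h := PTime.refl (Enc.enc : Inst → Data)
  exact ((PTime.unary_const 32).unary_mul h.snd.snd.fst.unary_succ).unary_mul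
    (PTime.length (β := fun I : Inst => Frac × Circuit I.n) (fun _ => Enc.enc)
      h.fst.snd.fst).unary_succ

theorem ptime_resolution : PTime Enc.enc fun I : Inst => unary I.resolution := by
  have h := PTime.refl (Enc.enc : Inst → Data)
  refine (PTime.unary_mul ?_ ptime_gap)
  exact ((PTime.unary_eval (16 * (Polynomial.X + 1) ^ 2) h.snd.snd.fst).congr
    fun I => by simp).unary_mul h.snd.snd.snd.unary_succ

theorem ptime_images {u : ∀ I : Inst, Circuit I.n} (hu : PTime Enc.enc fun I => Enc.enc (u I)) :
    PTime Enc.enc fun I : Inst => Enc.enc (I.images (u I)) := by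
  have h := PTime.refl (Enc.enc : Inst → Data)
  refine PTime.map (β := fun I : Inst => Circuit I.n) (γ := fun I : Inst => Circuit I.n)
    (fun _ => Enc.enc) (fun _ => Enc.enc)
    (PTime.unitTerms ptime_resolution h.snd.snd.fst h.fst.snd.fst) ?_
  have h' := PTime.refl fun x : Σ I : Inst, Circuit I.n => Data.node (Enc.enc x.1) (Enc.enc x.2)
  exact PTime.circuit_append
    (h'.fst.trans (hu.reindex fun x : Σ I : Inst, Circuit I.n => x.1)) h'.snd

theorem ptime_tests : PTime Enc.enc fun I : Inst => encList PTime.encTest I.tests := by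
  have h := PTime.refl (Enc.enc : Inst → Data)
  have hn := h.fst.fst
  have h₁ := ptime_images h.snd.fst.snd.fst
  have h₂ := ptime_images h.snd.fst.snd.snd
  have h₃ : PTime Enc.enc fun I : Inst => Enc.enc I.target :=
    PTime.replicate (β := fun I : Inst => Circuit I.n) (fun _ => Enc.enc) ptime_resolution
      h.snd.fst.fst
  have happ : ∀ {l l' : Inst → List (ℕ × AnyCircuit)},
      (PTime Enc.enc fun I => encList PTime.encTest (l I)) →
      (PTime Enc.enc fun I => encList PTime.encTest (l' I)) →
      PTime Enc.enc fun I => encList PTime.encTest (l I ++ l' I) := fun hl hl' =>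
    PTime.append (β := fun _ => ℕ × AnyCircuit) (fun _ => PTime.encTest) hl hl'
  exact happ (PTime.testBlock 0 false hn h₁ h₁) (happ (PTime.testBlock 1 false hn h₂ h₂)
    (happ (PTime.testBlock 2 false hn h₁ h₂) (happ (PTime.testBlock 3 true hn h₁ h₂)
    (happ (PTime.testBlock 4 false hn h₁ h₃) (happ (PTime.testBlock 5 true hn h₁ h₃)
    (happ (PTime.testBlock 6 false hn h₂ h₃) (PTime.testBlock 7 true hn h₂ h₃)))))))

theorem polyTime_circuits : PolyTime fun I : Inst => I.tests.map Prod.snd := by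
  refine PTime.map (β := fun _ => ℕ × AnyCircuit) (γ := fun _ => AnyCircuit)
    (fun _ => PTime.encTest) (fun _ => Enc.enc) ptime_tests ?_
  exact (PTime.refl fun x : Σ _ : Inst, ℕ × AnyCircuit => Data.node (Enc.enc x.1)
    (.node (unary x.2.1) (Enc.enc x.2.2))).snd.snd

theorem polyTime_coefficients :
    PolyTime fun p : Inst × List (List Bool) => p.1.coefficients p.2 := by
  have h := PTime.refl (Enc.enc : Inst × List (List Bool) → Data)
  have hlabels : PTime Enc.enc fun p : Inst × List (List Bool) =>
      encList unary (p.1.tests.map Prod.fst) := by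
    refine PTime.map (β := fun _ => ℕ × AnyCircuit) (γ := fun _ => ℕ)
      (fun _ => PTime.encTest) (fun _ => unary) (h.fst.trans (ptime_tests.reindex Prod.fst)) ?_
    exact (PTime.refl fun x : Σ _ : Inst × List (List Bool), ℕ × AnyCircuit =>
      Data.node (Enc.enc x.1) (.node (unary x.2.1) (Enc.enc x.2.2))).snd.fst
  have hzip := PTime.zipPad unary (Enc.enc : Bool → Data) hlabels h.snd
  have hT : ∀ k, SmallInt (Enc.enc : Inst × List (List Bool) → Data) fun p =>
      tally k (zipPad (p.1.tests.map Prod.fst) p.2) := by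
    intro k
    have h' := PTime.refl fun x : Σ _ : Inst × List (List Bool), ℕ × List Bool =>
      Data.node (Enc.enc x.1) (.node (unary x.2.1) (encList Enc.enc x.2.2))
    have hk := PTime.unary_eq h'.snd.fst (PTime.unary_const k)
    have hb : PTime _ fun x : Σ _ : Inst × List (List Bool), ℕ × List Bool =>
        Enc.enc (x.2.2.headD false) :=
      PTime.headD (β := fun _ => Bool) (fun _ => Enc.enc) h'.snd.snd fun _ => rfl
    exact (SmallInt.natCast (PTime.countP (β := fun _ => ℕ × List Bool) _ hzip
      (hk.bool_and hb.bool_not))).sub (SmallInt.natCast (PTime.countP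
        (β := fun _ => ℕ × List Bool) _ hzip (hk.bool_and hb)))
  have hlam : SmallInt (Enc.enc : Inst × List (List Bool) → Data) fun p =>
      3 * ((p.1.gap : ℤ) * p.1.resolution) :=
    (SmallInt.natCast (PTime.unary_const 3)).mul
      ((SmallInt.natCast (h.fst.trans (ptime_gap.reindex Prod.fst))).mul
        (SmallInt.natCast (h.fst.trans (ptime_resolution.reindex Prod.fst))))
  have h₁ := (hT 0).add hlam
  have h₂ := (hT 1).add hlam
  have hdet := (h₁.mul h₂).sub (((hT 2).mul (hT 2)).add ((hT 3).mul (hT 3)))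
  have hden := (hdet.toNat.unary_sub (PTime.unary_const 1)).unary_succ.binary_of_unary
  exact PTime.node
    (((((h₂.mul (hT 4)).sub (((hT 2).mul (hT 6)).sub ((hT 3).mul (hT 7)))).enc.node hden)).node
    (((h₂.mul (hT 5)).neg.add (((hT 2).mul (hT 7)).add ((hT 3).mul (hT 6)))).enc.node hden))
    (((((h₁.mul (hT 6)).sub (((hT 2).mul (hT 4)).add ((hT 3).mul (hT 5)))).enc.node hden)).node
    (((h₁.mul (hT 7)).neg.add (((hT 2).mul (hT 5)).sub ((hT 3).mul (hT 4)))).enc.node hden))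

end Inst

theorem solvableInBQP_combProblem : SolvableInBQP combProblem :=
  ⟨_, _, Inst.polyTime_circuits, Inst.polyTime_coefficients,
    fun _ hI => Inst.two_thirds_le_runProb hI⟩

theorem solvableInBQP_combProblemAt (E : ℕ) : SolvableInBQP (combProblemAt E) :=
  ⟨_, _, Inst.polyTime_circuits, Inst.polyTime_coefficients, fun _ hI => by
    have h := Inst.two_thirds_le_runProb hI.1
    rw [hI.2] at h
    exact h⟩

/-! ### The instances with a controlled-NOT matrix -/

section Shift

open Function (update)

variable {n : ℕ}

/-- The state `|0⟩ψ₀ + |1⟩ψ₁`. -/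
def branch (ψ₀ ψ₁ : Basis n → ℂ) (x : Basis (n + 1)) : ℂ :=
  (if x 0 then ψ₁ else ψ₀) fun i => x i.succ

theorem update_succ (x : Basis (n + 1)) (q : Fin n) (b : Bool) :
    (fun i : Fin n => update x q.succ b i.succ) = update (fun i : Fin n => x i.succ) q b := by
  funext i
  by_cases h : i = q
  · subst h; simp
  · rw [Function.update_of_ne h, Function.update_of_ne]
    simpa using h

theorem shift_gate_mulVec (g : Gate n) (ψ₀ ψ₁ : Basis n → ℂ) :
    g.shift.mat *ᵥ branch ψ₀ ψ₁ = branch (g.mat *ᵥ ψ₀) (g.mat *ᵥ ψ₁) := by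
  funext x
  have h0 : ∀ q : Fin n, (0 : Fin (n + 1)) ≠ q.succ := fun q => (Fin.succ_ne_zero _).symm
  cases g with
  | had q =>
    rw [Gate.shift, had_mulVec]
    simp only [branch, Function.update_of_ne (h0 q), update_succ]
    cases x 0 <;> simp [had_mulVec]
  | tee q =>
    rw [Gate.shift, tee_mulVec]
    simp only [branch]
    cases x 0 <;> simp [tee_mulVec]
  | cnot c t h =>
    rw [Gate.shift, cnot_mulVec]
    simp only [branch, Function.update_of_ne (h0 t), update_succ]
    cases x 0 <;> simp [cnot_mulVec]

theorem shift_mulVec (c : Circuit n) (ψ₀ ψ₁ : Basis n → ℂ) :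
    Circuit.mat c.shift *ᵥ branch ψ₀ ψ₁ = branch (Circuit.mat c *ᵥ ψ₀) (Circuit.mat c *ᵥ ψ₁) := by
  induction c generalizing ψ₀ ψ₁ with
  | nil => simp only [Circuit.shift, List.map_nil, Circuit.mat_nil_mulVec]
  | cons g c ih =>
    rw [Circuit.shift, List.map_cons, Circuit.mat_cons_mulVec, shift_gate_mulVec, ← Circuit.shift,
      ih, Circuit.mat_cons_mulVec, Circuit.mat_cons_mulVec]

theorem single_zeroBasis_succ : (Pi.single (zeroBasis (n + 1)) 1 : Basis (n + 1) → ℂ) =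
    branch (Pi.single (zeroBasis n) 1) 0 := by
  funext x
  simp only [branch, Pi.single_apply]
  by_cases hx0 : x 0
  · rw [if_neg, if_pos hx0]
    · rfl
    · rintro rfl
      simp [zeroBasis] at hx0
  · rw [if_neg hx0]
    simp only [Pi.single_apply]
    congr 1
    refine propext ⟨fun h => by rw [h]; rfl, fun h => ?_⟩
    funext i
    refine Fin.cases ?_ (fun i => ?_) i
    · simpa [zeroBasis] using hx0
    · exact congrFun h i

theorem shift_state (c : Circuit n) : Circuit.state c.shift = branch (Circuit.state c) 0 := by
  rw [Circuit.state, single_zeroBasis_succ, shift_mulVec, Matrix.mulVec_zero, ← Circuit.state]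

theorem flipFirst_shift_state (c : Circuit n) :
    Circuit.state (flipFirst n ++ c.shift) = branch 0 (Circuit.state c) := by
  have h : Circuit.mat (flipFirst n) *ᵥ branch (Pi.single (zeroBasis n) 1) 0 =
      branch 0 (Pi.single (zeroBasis n) 1) := by
    funext x
    rw [flipFirst_mulVec]
    have h2 : (fun i : Fin n => update x 0 (!x 0) i.succ) = fun i : Fin n => x i.succ := by
      funext i; rw [Function.update_of_ne (Fin.succ_ne_zero _)]
    simp only [branch, Function.update_self, h2]
    cases x 0 <;> rfl
  rw [Circuit.state, single_zeroBasis_succ, Circuit.mat_append_mulVec, h, shift_mulVec,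
    Matrix.mulVec_zero, ← Circuit.state]

end Shift

theorem prob_nonneg {n : ℕ} (c : Circuit (n + 1)) (v : Bool) : 0 ≤ Circuit.prob c v :=
  Finset.sum_nonneg fun z _ => by split_ifs <;> positivity

theorem prob_add_prob {n : ℕ} (c : Circuit (n + 1)) :
    Circuit.prob c false + Circuit.prob c true = 1 := by
  rw [← Circuit.normSq_state c, Circuit.prob, Circuit.prob, ← Finset.sum_add_distrib]
  refine Finset.sum_congr rfl fun z _ => ?_
  cases z 0 <;> simp

section CnotInst

variable (Q : OutCircuit) (E : ℕ) (code : Code) (time : ℕ)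

theorem cnotInst_A : (cnotInst Q E code time).A =
    (Gate.cnot 1 0 (by simp) : Gate (Q.n + 2)).mat := by
  have h : Frac.val ⟨1, 1⟩ = 1 := by simp [Frac.val]
  have hA : (cnotInst Q E code time).A =
      ([((⟨1, 1⟩ : Frac), ([.cnot 1 0 (by simp)] : Circuit (Q.n + 2)))].map
        fun t => (t.1.val : ℂ) • Circuit.mat t.2).sum := rfl
  rw [hA, List.map_singleton, List.sum_singleton, h, Complex.ofReal_one, one_smul,
    Circuit.mat, Circuit.mat, one_mul]

theorem cnotInst_loss_eq_sum (α₁ α₂ : ℂ) : (cnotInst Q E code time).loss α₁ α₂ =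
    Circuit.prob Q.circ false * (‖α₁ - 1‖ ^ 2 + ‖α₂‖ ^ 2) +
      Circuit.prob Q.circ true * (‖α₂ - 1‖ ^ 2 + ‖α₁‖ ^ 2) := by
  have h1 : ∀ (y : Basis (Q.n + 1)) (b c : Bool),
      Function.update (Fin.cons b y : Basis (Q.n + 2)) 0 c = Fin.cons c y := fun y b c => by
    rw [Fin.update_cons_zero]
  have h2 : ∀ (y : Basis (Q.n + 1)) (b : Bool), (Fin.cons b y : Basis (Q.n + 2)) 1 = y 0 :=
    fun y b => rfl
  have h3 : ∀ (ψ₀ ψ₁ : Basis (Q.n + 1) → ℂ) (y : Basis (Q.n + 1)) (b : Bool),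
      branch ψ₀ ψ₁ (Fin.cons b y) = if b then ψ₁ y else ψ₀ y := fun ψ₀ ψ₁ y b => by
    cases b <;> rfl
  rw [Inst.loss, regLoss, cnotInst_A]
  change ‖(WithLp.toLp 2 ((Gate.cnot 1 0 (by simp) : Gate (Q.n + 2)).mat *ᵥ
    (α₁ • Circuit.state (Circuit.shift Q.circ) +
      α₂ • Circuit.state (flipFirst (Q.n + 1) ++ Circuit.shift Q.circ)) -
    Circuit.state (Circuit.shift Q.circ)) : EuclideanSpace ℂ (Basis (Q.n + 2)))‖ ^ 2 = _
  rw [norm_toLp_sq, shift_state, flipFirst_shift_state, normSq, sum_basis_succ]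
  simp only [Pi.sub_apply, cnot_mulVec, Pi.add_apply, Pi.smul_apply, smul_eq_mul, h1, h2, h3,
    Fin.cons_zero, Circuit.prob, Pi.zero_apply]
  rw [← Finset.sum_add_distrib, Finset.sum_mul, Finset.sum_mul, ← Finset.sum_add_distrib]
  refine Finset.sum_congr rfl fun y _ => ?_
  generalize Circuit.state Q.circ y = ψ
  have hm : ∀ a : ℂ, ‖a * ψ - ψ‖ ^ 2 = ‖ψ‖ ^ 2 * ‖a - 1‖ ^ 2 := fun a => by
    rw [← mul_pow, ← norm_mul]; congr 2; ring
  cases y 0 <;> simp [hm, mul_pow] <;> ring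

/-- The loss is the squared distance from the vector of the two probabilities, up to a constant. -/
theorem cnotInst_loss (α₁ α₂ : ℂ) : (cnotInst Q E code time).loss α₁ α₂ =
    ‖α₁ - (Circuit.prob Q.circ false : ℂ)‖ ^ 2 + ‖α₂ - (Circuit.prob Q.circ true : ℂ)‖ ^ 2 +
      (1 - Circuit.prob Q.circ false ^ 2 - Circuit.prob Q.circ true ^ 2) := by
  have h := prob_add_prob Q.circ
  rw [cnotInst_loss_eq_sum]
  generalize Circuit.prob Q.circ false = p at *
  have hq : Circuit.prob Q.circ true = 1 - p := by linarith
  rw [hq]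
  simp only [← Complex.normSq_eq_norm_sq, Complex.normSq_apply]
  simp
  ring

theorem cnotInst_nearOptimal_iff (ε : ℝ) (α₁ α₂ : ℂ) :
    (cnotInst Q E code time).NearOptimal ε α₁ α₂ ↔
      ‖α₁ - (Circuit.prob Q.circ false : ℂ)‖ ^ 2 + ‖α₂ - (Circuit.prob Q.circ true : ℂ)‖ ^ 2 ≤
        ε := by
  simp only [Inst.NearOptimal, cnotInst_loss]
  constructor
  · intro h
    have := h (Circuit.prob Q.circ false) (Circuit.prob Q.circ true)
    simp only [sub_self, norm_zero, ne_eq, OfNat.ofNat_ne_zero, not_false_eq_true, zero_pow,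
      add_zero] at this
    linarith
  · intro h γ₁ γ₂
    have h1 := sq_nonneg ‖γ₁ - (Circuit.prob Q.circ false : ℂ)‖
    have h2 := sq_nonneg ‖γ₂ - (Circuit.prob Q.circ true : ℂ)‖
    linarith

theorem cnotInst_optimal_iff (α₁ α₂ : ℂ) :
    (cnotInst Q E code time).NearOptimal 0 α₁ α₂ ↔
      α₁ = (Circuit.prob Q.circ false : ℂ) ∧ α₂ = (Circuit.prob Q.circ true : ℂ) := by
  rw [cnotInst_nearOptimal_iff]
  constructor
  · intro h
    have h1 := sq_nonneg ‖α₁ - (Circuit.prob Q.circ false : ℂ)‖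
    have h2 := sq_nonneg ‖α₂ - (Circuit.prob Q.circ true : ℂ)‖
    have h3 : ‖α₁ - (Circuit.prob Q.circ false : ℂ)‖ ^ 2 = 0 := by linarith
    have h4 : ‖α₂ - (Circuit.prob Q.circ true : ℂ)‖ ^ 2 = 0 := by linarith
    rw [sq_eq_zero_iff, norm_eq_zero, sub_eq_zero] at h3 h4
    exact ⟨h3, h4⟩
  · rintro ⟨rfl, rfl⟩
    simp

end CnotInst

theorem cnot_isHermitian {n : ℕ} (c t : Fin n) (h : c ≠ t) :
    (Gate.cnot c t h).mat.IsHermitian := by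
  refine Matrix.IsHermitian.ext fun x y => ?_
  have key : ∀ {x y : Basis n}, x = Function.update y t (xor (y t) (y c)) →
      y = Function.update x t (xor (x t) (x c)) := by
    rintro _ y rfl
    simp [Function.update_of_ne h]
  simp only [Gate.mat, Matrix.of_apply]
  by_cases hxy : x = Function.update y t (xor (y t) (y c))
  · rw [if_pos hxy, if_pos (key hxy), star_one]
  · rw [if_neg hxy, if_neg fun h' => hxy (key h'), star_zero]

theorem cnot_mul_self {n : ℕ} (c t : Fin n) (h : c ≠ t) :
    (Gate.cnot c t h).mat * (Gate.cnot c t h).mat = 1 := by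
  refine Matrix.mulVec_injective (funext fun ψ => funext fun x => ?_)
  rw [← Matrix.mulVec_mulVec, cnot_mulVec, cnot_mulVec, Matrix.one_mulVec]
  simp [Function.update_of_ne h]

theorem spectralRadius_le_one_of_mul_self {ι : Type} [Fintype ι] [DecidableEq ι]
    {A : Matrix ι ι ℂ} (hA : A * A = 1) : spectralRadius ℂ A ≤ 1 := by
  refine iSup₂_le fun k hk => ?_
  have h1 : k ^ 2 ∈ spectrum ℂ (A ^ 2) := spectrum.pow_mem_pow A 2 hk
  have h2 : k ^ 2 = 1 := by
    rw [sq A, hA, spectrum.mem_iff] at h1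
    by_contra hne
    apply h1
    rw [show algebraMap ℂ (Matrix ι ι ℂ) (k ^ 2) - 1 = algebraMap ℂ (Matrix ι ι ℂ) (k ^ 2 - 1) by
      rw [map_sub, map_one]]
    exact (IsUnit.mk0 _ (sub_ne_zero.2 hne)).map _
  have h3 : ‖k‖ ^ 2 = 1 := by rw [← norm_pow, h2, norm_one]
  have h4 : ‖k‖ ≤ 1 := by nlinarith [norm_nonneg k]
  exact_mod_cast h4

/-! ### The program for the entries of the matrix -/

theorem bitsVal_injective {l l' : List Bool} (hl : l.length = l'.length)
    (h : bitsVal l = bitsVal l') : l = l' := by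
  induction l generalizing l' with
  | nil => exact (List.length_eq_zero_iff.1 hl.symm).symm
  | cons b l ih =>
    obtain _ | ⟨b', l'⟩ := l'
    · simp at hl
    · simp only [bitsVal] at h
      have hb : b = b' := by cases b <;> cases b' <;> simp at h ⊢ <;> omega
      subst hb
      rw [ih (by simpa using hl) (by omega)]

/-- The entry of the controlled-NOT matrix in the row `p.1` and the column `p.2`, for lists of the
same length, where the first bit is the target and the second bit is the control.  The remaining
bits are compared as binary numbers, by `PTime.mul_bitsVal_le` with factors `1`. -/
def cnotEntry (p : List Bool × List Bool) : Cyc :=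
  if !xor (p.1.headD false) (xor (p.2.headD false) (p.2.tail.headD false)) &&
    (decide (1 * bitsVal p.1.tail ≤ 1 * bitsVal p.2.tail) &&
      decide (1 * bitsVal p.2.tail ≤ 1 * bitsVal p.1.tail))
  then ⟨1, 0, 0, 0, 1⟩ else ⟨0, 0, 0, 0, 1⟩

theorem polyTime_cnotEntry : PolyTime cnotEntry := by
  have h := PTime.refl (Enc.enc : List Bool × List Bool → Data)
  have hd : ∀ {l : List Bool × List Bool → List Bool}, (PTime Enc.enc fun p => Enc.enc (l p)) →
      PTime Enc.enc fun p => Enc.enc ((l p).headD false) := fun hl =>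
    PTime.headD (β := fun _ => Bool) (fun _ => Enc.enc) hl fun _ => rfl
  have tl : ∀ {l : List Bool × List Bool → List Bool}, (PTime Enc.enc fun p => Enc.enc (l p)) →
      PTime Enc.enc fun p => Enc.enc (l p).tail := fun hl =>
    PTime.tail (β := fun _ => Bool) (fun _ => Enc.enc) hl
  refine ((((hd h.fst).bool_xor ((hd h.snd).bool_xor (hd (tl h.snd)))).bool_not.bool_and
    ((PTime.mul_bitsVal_le (PTime.unary_const 1) (PTime.unary_const 1) (tl h.snd)
      (tl h.fst)).bool_and (PTime.mul_bitsVal_le (PTime.unary_const 1) (PTime.unary_const 1)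
      (tl h.fst) (tl h.snd)))).ite (PTime.const (Enc.enc (⟨1, 0, 0, 0, 1⟩ : Cyc)))
    (PTime.const (Enc.enc (⟨0, 0, 0, 0, 1⟩ : Cyc)))).congr fun p => ?_
  rw [cnotEntry]
  split_ifs <;> rfl

theorem cnotEntry_val {n : ℕ} (x y : Basis (n + 2)) :
    (cnotEntry (List.ofFn x, List.ofFn y)).val =
      (Gate.cnot 1 0 (by simp) : Gate (n + 2)).mat x y := by
  have h1 : Cyc.val ⟨1, 0, 0, 0, 1⟩ = 1 := by simp [Cyc.val]
  have h0 : Cyc.val ⟨0, 0, 0, 0, 1⟩ = 0 := by simp [Cyc.val]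
  have hiff : ((!xor ((List.ofFn x).headD false) (xor ((List.ofFn y).headD false)
      ((List.ofFn y).tail.headD false)) &&
      (decide (1 * bitsVal (List.ofFn x).tail ≤ 1 * bitsVal (List.ofFn y).tail) &&
      decide (1 * bitsVal (List.ofFn y).tail ≤ 1 * bitsVal (List.ofFn x).tail))) = true) ↔
      x = Function.update y 0 (xor (y 0) (y 1)) := by
    have hx : List.ofFn x = x 0 :: List.ofFn fun i : Fin (n + 1) => x i.succ := List.ofFn_succ
    have hy : List.ofFn y = y 0 :: List.ofFn fun i : Fin (n + 1) => y i.succ := List.ofFn_succ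
    have hy' : (List.ofFn fun i : Fin (n + 1) => y i.succ).headD false = y 1 := by
      rw [List.ofFn_succ]; rfl
    rw [hx, hy, List.headD_cons, List.headD_cons, List.tail_cons, List.tail_cons, hy',
      Bool.and_eq_true, Bool.and_eq_true, decide_eq_true_eq, decide_eq_true_eq, one_mul, one_mul,
      ← le_antisymm_iff]
    constructor
    · rintro ⟨hb, ht⟩
      have ht' := List.ofFn_injective (bitsVal_injective (by simp) ht)
      funext i
      refine Fin.cases ?_ (fun i => ?_) i
      · rw [Function.update_self]
        simpa using hb
      · rw [Function.update_of_ne (Fin.succ_ne_zero _)]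
        exact congrFun ht' i
    · intro hxy
      have hs : (fun i : Fin (n + 1) => x i.succ) = fun i => y i.succ := by
        funext i
        rw [hxy, Function.update_of_ne (Fin.succ_ne_zero _)]
      refine ⟨?_, by rw [hs]⟩
      rw [hxy, Function.update_self]
      simp
  rw [cnotEntry, Gate.mat, Matrix.of_apply]
  by_cases hxy : x = Function.update y 0 (xor (y 0) (y 1))
  · rw [if_pos hxy, if_pos (hiff.2 hxy), h1]
  · rw [if_neg hxy, if_neg fun h => hxy (hiff.1 h), h0]

theorem size_enc_bits (l : List Bool) : (Enc.enc l : Data).size ≤ 4 * l.length + 1 := by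
  induction l with
  | nil => exact le_rfl
  | cons b l ih =>
    have h : (Enc.enc (b :: l) : Data) = .node (Enc.enc b) (Enc.enc l) := rfl
    have hb : ∀ b : Bool, (Enc.enc b).size ≤ 3 := by decide
    have := hb b
    rw [h, Data.size, List.length_cons]
    omega

/-- A program for the entries of the controlled-NOT matrix on `n + 2` qubits, with a time bound that
is a polynomial in `n`. -/
theorem exists_cnot_program : ∃ (code : Code) (p : Polynomial ℕ), ∀ (n : ℕ) (x y : Basis (n + 2)),
    ∃ t, t ≤ p.eval n ∧ Eval code (Enc.enc (List.ofFn x, List.ofFn y))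
      (Enc.enc (cnotEntry (List.ofFn x, List.ofFn y))) t := by
  obtain ⟨code, p, h⟩ := polyTime_cnotEntry
  refine ⟨code, p.comp (8 * Polynomial.X + 19), fun n x y => ?_⟩
  obtain ⟨t, ht, hE⟩ := h (List.ofFn x, List.ofFn y)
  refine ⟨t, ht.trans ?_, hE⟩
  rw [Polynomial.eval_comp]
  apply eval_mono_nat
  have hx := size_enc_bits (List.ofFn x)
  have hy := size_enc_bits (List.ofFn y)
  rw [List.length_ofFn] at hx hy
  change (Data.node (Enc.enc (List.ofFn x)) (Enc.enc (List.ofFn y))).size ≤ _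
  simp only [Data.size, Polynomial.eval_add, Polynomial.eval_mul, Polynomial.eval_X,
    Polynomial.eval_ofNat]
  omega

theorem cnotInst_valid (Q : OutCircuit) {E : ℕ} (hE : 0 < E) {code : Code} {time : ℕ}
    (h : ∀ x y : Basis (Q.n + 2), ∃ t, t ≤ time ∧ Eval code (Enc.enc (List.ofFn x, List.ofFn y))
      (Enc.enc (cnotEntry (List.ofFn x, List.ofFn y))) t) : (cnotInst Q E code time).Valid where
  hermitian := by rw [cnotInst_A]; exact cnot_isHermitian _ _ _
  spectral := by
    rw [cnotInst_A]
    exact spectralRadius_le_one_of_mul_self (cnot_mul_self _ _ _)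
  beta_pos := by
    intro t ht
    rw [List.mem_singleton.1 ht]
    norm_num [Frac.val]
  entries := fun x y => by
    obtain ⟨t, ht, hE⟩ := h x y
    refine ⟨_, t, ht, hE, ?_⟩
    rw [cnotInst_A]
    exact cnotEntry_val x y
  beta_sum := by simp [cnotInst, Frac.val]
  coeff_bound := by
    have h0 := prob_nonneg Q.circ false
    have h1 := prob_nonneg Q.circ true
    have h2 := prob_add_prob Q.circ
    have hb : ((cnotInst Q E code time).bound : ℝ) = 1 := by simp [cnotInst]
    refine ⟨Circuit.prob Q.circ false, Circuit.prob Q.circ true, ?_, ?_,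
      (cnotInst_optimal_iff Q E code time _ _).2 ⟨rfl, rfl⟩⟩
    · rw [Complex.norm_real, Real.norm_of_nonneg h0, hb]; linarith
    · rw [Complex.norm_real, Real.norm_of_nonneg h1, hb]; linarith
  invEps_pos := hE

/-! ### The reduction -/

theorem ptime_shift_gate :
    PTime (fun g : Σ n, Gate n => Enc.enc g.2) fun g => Enc.enc g.2.shift := by
  refine PTime.gate_cases ?_ ?_ ?_
  · exact PTime.had (PTime.unary_succ (PTime.refl _))
  · exact PTime.tee (PTime.unary_succ (PTime.refl _))
  · have h := PTime.refl fun x : Σ n, {p : Fin n × Fin n // p.1 ≠ p.2} =>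
      Data.node (unary x.2.1.1) (unary x.2.1.2)
    exact PTime.cnot h.fst.unary_succ h.snd.unary_succ

theorem polyTime_cnotInst (E : ℕ) (code : Code) (p : Polynomial ℕ) :
    PolyTime fun Q : OutCircuit => cnotInst Q E code (p.eval Q.n) := by
  have h := PTime.refl (Enc.enc : OutCircuit → Data)
  have hn : PTime Enc.enc fun Q : OutCircuit => unary Q.n := h.fst.unary_pred
  have hshift : PTime Enc.enc fun Q : OutCircuit => Enc.enc (Circuit.shift Q.circ) :=
    PTime.map (β := fun Q : OutCircuit => Gate (Q.n + 1))
      (γ := fun Q : OutCircuit => Gate (Q.n + 2)) (fun _ => Enc.enc) (fun _ => Enc.enc) h.snd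
      ((PTime.refl _).snd.trans (ptime_shift_gate.reindex
        fun x : Σ Q : OutCircuit, Gate (Q.n + 1) => ⟨x.1.n + 1, x.2⟩))
  have hterms : PTime Enc.enc fun Q : OutCircuit =>
      Enc.enc (cnotInst Q E code (p.eval Q.n)).terms :=
    (PTime.const (.node (.node (Enc.enc (⟨1, 1⟩ : Frac)) (Enc.enc
      ([.cnot 1 0 (by simp)] : Circuit 2))) .leaf)).congr fun Q => by
        have h1 : ((1 : Fin (Q.n + 2)) : ℕ) = 1 := by simp
        change _ = Data.node (.node (Enc.enc (⟨1, 1⟩ : Frac))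
          (.node (.node (unary 2) (.node (unary (1 : Fin (Q.n + 2))) (unary 0))) .leaf)) .leaf
        rw [h1]
        rfl
  exact (hn.unary_succ.unary_succ.node (hterms.node
    ((PTime.const (Enc.enc code)).node (PTime.unary_eval p hn)))).node
    ((hshift.node (hshift.node (PTime.circuit_append PTime.flipFirst hshift))).node
    ((PTime.unary_const 1).node (PTime.unary_const E)))

/-- Whether the real part of the second coefficient exceeds `1 / 2`. -/
def readAnswer (p : List Bool × (CFrac × CFrac)) : Bool :=
  !decide (p.2.2.re.num < 0) && !decide (2 * p.2.2.re.num.natAbs ≤ 1 * (p.2.2.re.den : ℕ))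

theorem polyTime_readAnswer : PolyTime readAnswer := by
  have h := PTime.refl (Enc.enc : List Bool × (CFrac × CFrac) → Data)
  have hre : PTime Enc.enc fun p : List Bool × (CFrac × CFrac) => Enc.enc p.2.2.re :=
    h.snd.snd.fst
  exact hre.fst.fst.bool_not.bool_and
    (PTime.mul_binary_le (PTime.unary_const 1) (PTime.unary_const 2) hre.snd hre.fst.snd).bool_not

theorem readAnswer_iff (x : List Bool) (y : CFrac × CFrac) :
    readAnswer (x, y) = true ↔ 1 / 2 < y.2.val.re := by
  have hden : (0 : ℝ) < ((y.2.re.den : ℕ) : ℝ) := by exact_mod_cast y.2.re.den.pos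
  have h : y.2.val.re = (y.2.re.num : ℝ) / ((y.2.re.den : ℕ) : ℝ) := rfl
  rw [h, lt_div_iff₀ hden, readAnswer, Bool.and_eq_true, Bool.not_eq_true', Bool.not_eq_true',
    decide_eq_false_iff_not, decide_eq_false_iff_not]
  have h2 : 1 / 2 * ((y.2.re.den : ℕ) : ℝ) < (y.2.re.num : ℝ) ↔
      ((y.2.re.den : ℕ) : ℤ) < 2 * y.2.re.num := by
    rw [← @Int.cast_lt ℝ]
    push_cast
    constructor <;> intro h <;> linarith
  rw [h2]
  have := y.2.re.den.pos
  dsimp only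
  omega

/-- For `ε ≤ 1 / 37` the second coefficient separates probabilities of at most `1 / 3` from those of
at least `2 / 3`, because `1 / 37` is less than the square of `1 / 6`. -/
theorem reduction_cnotInst {L : PromiseProblem} {Q : List Bool → OutCircuit} (hQ : PolyTime Q)
    (hL : Decides Q L) {code : Code} {p : Polynomial ℕ}
    (hp : ∀ (n : ℕ) (x y : Basis (n + 2)), ∃ t, t ≤ p.eval n ∧
      Eval code (Enc.enc (List.ofFn x, List.ofFn y))
        (Enc.enc (cnotEntry (List.ofFn x, List.ofFn y))) t) {E : ℕ} (hE : 37 ≤ E) :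
    Reduction L (combProblemAt E) (fun x => cnotInst (Q x) E code (p.eval (Q x).n))
      readAnswer := by
  have hvalid : ∀ x, (combProblemAt E).promise (cnotInst (Q x) E code (p.eval (Q x).n)) := fun x =>
    ⟨cnotInst_valid (Q x) (by omega) (hp (Q x).n), rfl⟩
  have hclose : ∀ x y, (combProblemAt E).sol (cnotInst (Q x) E code (p.eval (Q x).n)) y →
      (y.2.val.re - Circuit.prob (Q x).circ true) ^ 2 < 1 / 36 := by
    intro x y hy
    have h1 := (cnotInst_nearOptimal_iff (Q x) E code _ _ _ _).1 hy
    have h2 := sq_nonneg ‖y.1.val - (Circuit.prob (Q x).circ false : ℂ)‖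
    have h3 : (y.2.val.re - Circuit.prob (Q x).circ true) ^ 2 ≤
        ‖y.2.val - (Circuit.prob (Q x).circ true : ℂ)‖ ^ 2 := by
      rw [← sq_abs (_ - _ : ℝ)]
      gcongr
      simpa using Complex.abs_re_le_norm (y.2.val - (Circuit.prob (Q x).circ true : ℂ))
    have h4 : (1 : ℝ) / E ≤ 1 / 37 :=
      one_div_le_one_div_of_le (by norm_num) (by exact_mod_cast hE)
    linarith
  refine ⟨PTime.trans (show PTime Enc.enc fun x => Enc.enc (Q x) from hQ)
    (PTime.reindex (polyTime_cnotInst E code p) Q), polyTime_readAnswer,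
    fun x hx => ⟨hvalid x, fun y hy => ?_⟩, fun x hx => ⟨hvalid x, fun y hy => ?_⟩⟩
  · have h1 := hL.1 x hx
    have h2 := hclose x y hy
    rw [readAnswer_iff]
    nlinarith
  · have h1 := hL.2 x hx
    have h2 := hclose x y hy
    rw [← Bool.not_eq_true, readAnswer_iff]
    nlinarith

theorem bqpHard_combProblemAt {E : ℕ} (hE : 37 ≤ E) : BQPHard (combProblemAt E) := by
  obtain ⟨code, p, hp⟩ := exists_cnot_program
  rintro L ⟨Q, hQ, hL⟩
  exact ⟨_, _, reduction_cnotInst hQ hL hp hE⟩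

theorem bqpHard_combProblem : BQPHard combProblem := by
  intro L hL
  obtain ⟨f, g, hf, hg, hyes, hno⟩ := bqpHard_combProblemAt le_rfl L hL
  refine ⟨f, g, hf, hg, fun x hx => ?_, fun x hx => ?_⟩
  · obtain ⟨⟨hv, he⟩, hs⟩ := hyes x hx
    exact ⟨hv, fun y hy => hs y (by simpa [combProblem, combProblemAt, he] using hy)⟩
  · obtain ⟨⟨hv, he⟩, hs⟩ := hno x hx
    exact ⟨hv, fun y hy => hs y (by simpa [combProblem, combProblemAt, he] using hy)⟩

end QLS

theorem proposition6 :
    -- the problem with the precision as part of the input, and for every small fixed precision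
    QLS.BQPComplete QLS.combProblem ∧
    (∀ E : ℕ, 37 ≤ E → QLS.BQPComplete (QLS.combProblemAt E)) ∧
    -- hardness holds through instances whose matrix is a controlled-NOT
    ∃ (entryCode : QLS.Code) (entryTime : ℕ → ℕ),
      (∀ E : ℕ, QLS.PolyTime fun Q : QLS.OutCircuit =>
        QLS.cnotInst Q E entryCode (entryTime Q.n)) ∧
      (∀ (Q : QLS.OutCircuit) (E : ℕ), 0 < E →
        (QLS.cnotInst Q E entryCode (entryTime Q.n)).Valid ∧
        (∀ α₁ α₂ : ℂ,
          (QLS.cnotInst Q E entryCode (entryTime Q.n)).NearOptimal 0 α₁ α₂ ↔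
            α₁ = (QLS.Circuit.prob Q.circ false : ℂ) ∧
            α₂ = (QLS.Circuit.prob Q.circ true : ℂ)) ∧
        (∀ (ε : ℝ) (α₁ α₂ : ℂ),
          (QLS.cnotInst Q E entryCode (entryTime Q.n)).NearOptimal ε α₁ α₂ ↔
            ‖α₁ - (QLS.Circuit.prob Q.circ false : ℂ)‖ ^ 2 +
              ‖α₂ - (QLS.Circuit.prob Q.circ true : ℂ)‖ ^ 2 ≤ ε)) ∧
      (∀ (L : QLS.PromiseProblem) (Q : List Bool → QLS.OutCircuit),
        QLS.PolyTime Q → QLS.Decides Q L → ∀ E : ℕ, 37 ≤ E →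
          ∃ g : List Bool × (QLS.CFrac × QLS.CFrac) → Bool,
            QLS.Reduction L (QLS.combProblemAt E)
              (fun x => QLS.cnotInst (Q x) E entryCode (entryTime (Q x).n)) g) := by
  obtain ⟨code, p, hp⟩ := QLS.exists_cnot_program
  exact ⟨⟨QLS.solvableInBQP_combProblem, QLS.bqpHard_combProblem⟩,
    fun E hE => ⟨QLS.solvableInBQP_combProblemAt E, QLS.bqpHard_combProblemAt hE⟩,
    code, fun n => p.eval n, fun E => QLS.polyTime_cnotInst E code p,
    fun Q E hE => ⟨QLS.cnotInst_valid Q hE (hp Q.n), QLS.cnotInst_optimal_iff Q E code _,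
      QLS.cnotInst_nearOptimal_iff Q E code _⟩,
    fun L Q hQ hL E hE => ⟨_, QLS.reduction_cnotInst hQ hL hp hE⟩⟩
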